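/- Fix $n,k\in\mathbb N$, $n,k\ge 1$. Let $X$ be a Banach space of real sequences $a=\{a_l\}_{l\in\mathbb Z}$ with monotone norm: if $a\in X$ and $|a'_l|\le|a_l|$ for all $l$, then $a'\in X$ and $\|a'\|_X\le\|a\|_X$ (sequences outside $X$ have norm $\infty$). A Young function is a continuous, convex, nondecreasing $\mathcal A:[0,\infty)\to[0,\infty)$ with $\mathcal A(0)=0$ and $\lim_{t\to\infty}\mathcal A(t)=\infty$; $\overline{\mathcal A}(s)=\sup_{t\ge0}(st-\mathcal A(t))\in[0,\infty]$ is its complementary function, and $\Phi^{-1}(t)=\inf\{s:\Phi(s)>t\}$. For a ball $Q\subset\mathbb R^n$, $$\|f\|_{\Phi,Q}=\inf\Big\{\lambda>0:\frac1{|Q|}\int_Q\Phi\big(|f|/\lambda\big)\le1\Big\},\qquad M_\Phi f(x)=\sup_{Q\ni x}\|f\|_{\Phi,Q},\qquad \|f\|_{\Phi,|y|\sim s}=\|f\chi_{\{s<|y|\le 2s\}}\|_{\Phi,B(0,2s)} .$$ For a kernel $K=\{K_l\}_{l\in\mathbb Z}:\mathbb R^n\to X$ and $j\ge0$, we say that $K\in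 H^\dagger_{\Phi,X,j}$ if there are $c>1$, $C>0$ such that for all $x\in\mathbb R^n$ and $R>c|x|$ $$\Big\|\Big\{\sum_{m=1}^\infty(2^mR)^n m^j\,\|K_l(\cdot-x)-K_l(\cdot)\|_{\Phi,|y|\sim2^mR}\Big\}_{l\in\mathbb Z}\Big\|_X\le C,$$ and $H^\dagger_{\Phi,X}=H^\dagger_{\Phi,X,0}$. We say that $K\in H_{1,X}$ if there are $c>1$, $C>0$ such that for all $x$ and $R>c|x|$, with $\Phi(t)=t$, $$\sum_{m=1}^\infty(2^mR)^n\big\|\,\|K(\cdot-x)-K(\cdot)\|_X\big\|_{\Phi,|y|\sim2^mR}\le C .$$ The operator $Tf(x)=\{\mathrm{p.v.}\int K_l(x-y)f(y)\,dy\}_{l}$ is a singular integral operator if $K$ is strongly measurable, each $K_l$ is locally integrable on $\mathbb R^n\setminus\{0\}$, $K\in H_{1,X}$, and for some $1<p_0<\infty$ the following holds for all compactly supported $f\in L^{p_0}(\mathbb R^n)$: $Tf(x)$ exists in $X$ for a.e. $x$, is strongly measurable, and $\big(\int\|Tf\|_X^{p_0}\big)^{1/p_0}\le C\|f\|_{L^{p_0}}$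 with $C$ independent of $f$. For $b\in BMO$, with $\|b\|_{BMO}=\|M^\#b\|_\infty$, its $k$-th order commutator is $$T_b^kf(x)=\Big\{\mathrm{p.v.}\int_{\mathbb R^n}(b(x)-b(y))^kK_l(x-y)f(y)\,dy\Big\}_{l\in\mathbb Z}.$$ Let $A_\infty=\bigcup_{1<p<\infty}A_p$ (Muckenhoupt weights), let $M$ be the Hardy–Littlewood maximal operator, and let $L_c^\infty$ be the space of bounded measurable functions on $\mathbb R^n$ with compact support. **Theorem.** Let $\mathcal A,\mathcal B$ be Young functions such that $$\overline{\mathcal A}^{-1}(t)\,\mathcal B^{-1}(t)\,\overline{\mathcal C}_k^{-1}(t)\le t\quad\text{for all }t\ge1,\qquad \overline{\mathcal C}_k(t)=\exp(t^{1/k}),\ \text{that is, } \overline{\mathcal C}_k^{-1}(t)=(\log t)^k .$$ Let $T$ be a singular integral operator with kernel $K\in H^\dagger_{\mathcal B,X}\cap H^\dagger_{\mathcal A,X,k}$. (a) For every $b\in BMO$, $0<p<\infty$ and $w\in A_\infty$ there is a constant $C$ such that for all $f\in L_c^\infty$ $$\int_{\mathbb R^n}\|T_b^kf\|_X^p\,w\le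 C\int_{\mathbb R^n}(M_{\overline{\mathcal A}}f)^p\,w$$ whenever the left-hand side is finite. (b) If moreover $\overline{\mathcal A}$ is finite-valued and submultiplicative, i.e. $\overline{\mathcal A}(st)\le D\,\overline{\mathcal A}(s)\overline{\mathcal A}(t)$ for all $s,t\ge0$ and some constant $D$, then for every $w\in A_\infty$ there is a constant $c$ such that for all $b\in BMO$, $f\in L^\infty_c$ and $\lambda>0$ $$w\{x\in\mathbb R^n:\|T_b^kf(x)\|_X>\lambda\}\le c\int_{\mathbb R^n}\overline{\mathcal A}\Big(\frac{\|b\|_{BMO}^k|f(x)|}{\lambda}\Big)Mw(x)\,dx .$$ -/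

import Mathlib

open MeasureTheory Filter Topology
open scoped NNReal ENNReal

noncomputable section

/-- `ℝⁿ` with the Euclidean norm. -/
abbrev Rn (n : ℕ) := EuclideanSpace ℝ (Fin n)

/-! ### Spaces of real sequences with a monotone norm -/

/-- `X` is a space of real sequences indexed by `ℤ` (through the injective linear map `coord`)
whose norm is monotone: if `v ∈ X` and `|a l| ≤ |v l|` for all `l`, then `a ∈ X` and
`‖a‖ ≤ ‖v‖`.  (The sequences outside `X` are those of infinite norm.) -/
class MonotoneSequenceSpace (X : Type*) [NormedAddCommGroup X] [NormedSpace ℝ X] where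
  coord : X →ₗ[ℝ] (ℤ → ℝ)
  coord_injective : Function.Injective coord
  solid : ∀ (v : X) (a : ℤ → ℝ), (∀ l, |a l| ≤ |coord v l|) → ∃ u : X, coord u = a ∧ ‖u‖ ≤ ‖v‖

open MonotoneSequenceSpace (coord)

/-- The norm in `X` of a sequence `s` of non-negative extended reals; it is `∞` if `s` is not
(the sequence of absolute values of) an element of `X`. -/
def seqNorm (X : Type*) [NormedAddCommGroup X] [NormedSpace ℝ X] [MonotoneSequenceSpace X]
    (s : ℤ → ℝ≥0∞) : ℝ≥0∞ :=
  ⨅ (v : X) (_ : ∀ l, ‖coord v l‖ₑ = s l), ‖v‖ₑ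

/-! ### Young functions -/

/-- Young functions `A : [0,∞) → [0,∞)`. -/
structure IsYoung (A : ℝ≥0 → ℝ≥0) : Prop where
  continuous : Continuous A
  convex : ConvexOn ℝ≥0 Set.univ A
  monotone : Monotone A
  map_zero : A 0 = 0
  tendsto : Tendsto A atTop atTop

/-- A Young function, with values regarded in `[0,∞]`. -/
def toGauge (A : ℝ≥0 → ℝ≥0) : ℝ≥0 → ℝ≥0∞ := fun t => (A t : ℝ≥0∞)

/-- The complementary function `Ā(s) = sup_{t ≥ 0} (s t - A(t))`, with values in `[0,∞]`. -/
def complYoung (A : ℝ≥0 → ℝ≥0) : ℝ≥0 → ℝ≥0∞ :=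
  fun s => ⨆ t : ℝ≥0, ((s * t : ℝ≥0) : ℝ≥0∞) - (A t : ℝ≥0∞)

/-- The (right-continuous) inverse `Φ⁻¹(t) = inf {s : Φ(s) > t}`. -/
def youngInv (Φ : ℝ≥0 → ℝ≥0∞) (t : ℝ≥0) : ℝ≥0∞ :=
  ⨅ (s : ℝ≥0) (_ : (t : ℝ≥0∞) < Φ s), (s : ℝ≥0∞)

/-- Submultiplicativity (up to a multiplicative constant). -/
def Submultiplicative (Φ : ℝ≥0 → ℝ≥0∞) : Prop :=
  ∃ D : ℝ≥0, ∀ s t : ℝ≥0, Φ (s * t) ≤ D * (Φ s * Φ t)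

/-! ### Averages, Luxemburg norms and maximal operators -/

variable {n : ℕ}

/-- The average of `g` over the set `S`. -/
def avg (S : Set (Rn n)) (g : Rn n → ℝ≥0∞) : ℝ≥0∞ :=
  (volume S)⁻¹ * ∫⁻ y in S, g y

/-- The averaged Luxemburg norm `‖g‖_{Φ,S}`. -/
def luxNorm (Φ : ℝ≥0 → ℝ≥0∞) (S : Set (Rn n)) (g : Rn n → ℝ≥0) : ℝ≥0∞ :=
  ⨅ (r : ℝ≥0) (_ : 0 < r) (_ : avg S (fun y => Φ (g y / r)) ≤ 1), (r : ℝ≥0∞)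

/-- The Luxemburg norm on the annulus `|y| ∼ s`, that is `‖g χ_{s < |y| ≤ 2s}‖_{Φ, B(0,2s)}`. -/
def luxAnnulus (Φ : ℝ≥0 → ℝ≥0∞) (s : ℝ) (g : Rn n → ℝ≥0) : ℝ≥0∞ :=
  luxNorm Φ (Metric.ball 0 (2 * s)) (Set.indicator {y | s < ‖y‖ ∧ ‖y‖ ≤ 2 * s} g)

/-- The maximal operator `M_Φ f(x) = sup_{B ∋ x} ‖f‖_{Φ,B}`. -/
def youngMaximal (Φ : ℝ≥0 → ℝ≥0∞) (f : Rn n → ℝ) (x : Rn n) : ℝ≥0∞ :=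
  ⨆ (c : Rn n) (r : ℝ) (_ : x ∈ Metric.ball c r),
    luxNorm Φ (Metric.ball c r) (fun y => ‖f y‖₊)

/-- The Hardy-Littlewood maximal function. -/
def hlMaximal (w : Rn n → ℝ) (x : Rn n) : ℝ≥0∞ :=
  ⨆ (c : Rn n) (r : ℝ) (_ : x ∈ Metric.ball c r), avg (Metric.ball c r) (fun y => ‖w y‖ₑ)

/-- The sharp maximal function. -/
def sharpMaximal (b : Rn n → ℝ) (x : Rn n) : ℝ≥0∞ :=
  ⨆ (c : Rn n) (r : ℝ) (_ : x ∈ Metric.ball c r),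
    avg (Metric.ball c r) (fun y => ‖b y - ⨍ z in Metric.ball c r, b z‖ₑ)

/-- `‖b‖_BMO = ‖M^# b‖_∞`. -/
def bmoNorm (b : Rn n → ℝ) : ℝ≥0∞ := essSup (sharpMaximal b) volume

/-- `b ∈ BMO`. -/
def IsBMO (b : Rn n → ℝ) : Prop := LocallyIntegrable b volume ∧ bmoNorm b < ∞

/-! ### Weights -/

/-- `w ∈ A_p`, for `1 < p < ∞`. -/
def IsAp (p : ℝ) (w : Rn n → ℝ) : Prop :=
  (∀ x, 0 ≤ w x) ∧ LocallyIntegrable w volume ∧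
    ∃ C : ℝ≥0, ∀ (c : Rn n) (r : ℝ), 0 < r →
      avg (Metric.ball c r) (fun y => ENNReal.ofReal (w y)) *
        avg (Metric.ball c r) (fun y => ENNReal.ofReal (w y) ^ (-(1 / (p - 1)))) ^ (p - 1) ≤ C

/-- `A_∞` is the union of the classes `A_p`, `1 < p < ∞`. -/
def IsAInfty (w : Rn n → ℝ) : Prop := ∃ p : ℝ, 1 < p ∧ IsAp p w

/-! ### Kernels, singular integrals and commutators -/

variable {X : Type*} [NormedAddCommGroup X] [NormedSpace ℝ X] [MonotoneSequenceSpace X]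

/-- The class `H_{Φ,X,k}`. -/
def HormanderClass (Φ : ℝ≥0 → ℝ≥0∞) (k : ℕ) (K : Rn n → X) : Prop :=
  ∃ c : ℝ, 1 < c ∧ ∃ C : ℝ≥0, ∀ (x : Rn n) (R : ℝ), c * ‖x‖ < R →
    ∑' m : ℕ+, ENNReal.ofReal ((2 ^ (m : ℕ) * R) ^ n) * ((m : ℕ) : ℝ≥0∞) ^ k *
      luxAnnulus Φ (2 ^ (m : ℕ) * R) (fun y => ‖K (y - x) - K y‖₊) ≤ C

/-- The class `H†_{Φ,X,k}`: the norm of `X` is taken outside the sum. -/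
def HormanderDagger (Φ : ℝ≥0 → ℝ≥0∞) (k : ℕ) (K : Rn n → X) : Prop :=
  ∃ c : ℝ, 1 < c ∧ ∃ C : ℝ≥0, ∀ (x : Rn n) (R : ℝ), c * ‖x‖ < R →
    seqNorm X (fun l =>
      ∑' m : ℕ+, ENNReal.ofReal ((2 ^ (m : ℕ) * R) ^ n) * ((m : ℕ) : ℝ≥0∞) ^ k *
        luxAnnulus Φ (2 ^ (m : ℕ) * R) (fun y => ‖coord (K (y - x)) l - coord (K y) l‖₊)) ≤ C

/-- The principal value at `x` of the integral of `h` exists and is equal to `v`. -/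
def HasPV (h : Rn n → ℝ) (x : Rn n) (v : ℝ) : Prop :=
  (∀ ε : ℝ, 0 < ε → IntegrableOn h {y | ε < ‖x - y‖} volume) ∧
    Tendsto (fun ε : ℝ => ∫ y in {y | ε < ‖x - y‖}, h y) (𝓝[>] 0) (𝓝 v)

/-- `v = T f(x)`, where `T f(x) = {p.v. ∫ K_l(x - y) f(y) dy}_l`. -/
def IsSingularIntegralValue (K : Rn n → X) (f : Rn n → ℝ) (x : Rn n) (v : X) : Prop :=
  ∀ l : ℤ, HasPV (fun y => coord (K (x - y)) l * f y) x (coord v l)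

/-- `v = T_b^k f(x)`, where `T_b^k f(x) = {p.v. ∫ (b(x) - b(y))^k K_l(x - y) f(y) dy}_l`. -/
def IsCommutatorValue (K : Rn n → X) (b : Rn n → ℝ) (k : ℕ) (f : Rn n → ℝ) (x : Rn n)
    (v : X) : Prop :=
  ∀ l : ℤ, HasPV (fun y => (b x - b y) ^ k * coord (K (x - y)) l * f y) x (coord v l)

/-- `‖T_b^k f(x)‖_X`.  It is `∞` at the points where one of the principal values fails to exist
or where they do not form an element of `X`; where they do, that element is unique. -/
def commutatorNorm (K : Rn n → X) (b : Rn n → ℝ) (k : ℕ) (f : Rn n → ℝ) (x : Rn n) : ℝ≥0∞ :=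
  ⨅ (v : X) (_ : IsCommutatorValue K b k f x v), ‖v‖ₑ

/-- The convolution operator `T` with the vector-valued kernel `K` is a singular integral
operator: the components of `K` are locally integrable away from the origin, `T` is of strong type
`(p₀,p₀)` for some `1 < p₀ < ∞` in the sense of Bochner-Lebesgue spaces (on functions of compact
support, where the truncated integrals make sense), and `K ∈ H_{1,X}`. -/
structure IsSingularIntegralKernel (K : Rn n → X) : Prop where
  aestronglyMeasurable : AEStronglyMeasurable K volume
  locallyIntegrableOn : ∀ l : ℤ, LocallyIntegrableOn (fun y => coord (K y) l) {0}ᶜ volume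
  strong_type : ∃ p₀ : ℝ, 1 < p₀ ∧ ∃ C : ℝ≥0, ∀ f : Rn n → ℝ,
    MemLp f (ENNReal.ofReal p₀) volume → HasCompactSupport f →
      ∃ F : Rn n → X, AEStronglyMeasurable F volume ∧
        (∀ᵐ x ∂volume, IsSingularIntegralValue K f x (F x)) ∧
        eLpNorm F (ENNReal.ofReal p₀) volume ≤ C * eLpNorm f (ENNReal.ofReal p₀) volume
  hormander : HormanderClass (toGauge id) 0 K

/-- `f ∈ L^∞_c(ℝⁿ)`. -/
def IsBoundedCompact (f : Rn n → ℝ) : Prop := MemLp f ∞ volume ∧ HasCompactSupport f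

end

/-! The theorem is proved by a good-λ argument run directly on the vector-valued commutators, with
weight `w` and dyadic cubes. The commutator is homogeneous of degree `k` in `b`, so `b` may be taken
with mean oscillation at most 1.

Local step (`exists_oscillation_le`). Suppose a cube `P` contains a point where `M_Ā f < μ`, and the
commutators of order below `j` exceed `μ` only on a tiny part of `P`. Then `T_b^j f` lies within a
multiple of `μ` of one fixed vector, off a small part of `P`. Indeed, let `d` be a mean of `b` near
`P`. By the binomial formula `T_b^j f` is `T((d - b)^j f)` minus lower commutators multiplied by
powers of `d - b(x)`, and these powers are bounded off a small set. The part of `(d - b)^j f` near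
`P` is handled by the weak type (1,1) of `T`. The far part is almost constant on `P`
(`exists_far_le`): on the annulus of radius `2^m R` one has, up to constants, `|b - d|^j ≤ m^k + |b
- d_m|^k`, where `d_m` is a mean of `b` at that scale. The first term pairs `A` with `Ā` and
consumes the factor `m^k` of the condition on `A`. The second pairs `B`, `Ā` and `exp(t^{1/k})`
through the hypothesis on inverses and John-Nirenberg, and consumes the condition on `B`. Both
estimates are made coordinate by coordinate, and monotonicity of the norm converts them into an
estimate in `X`.

Global step (`measure_heavySet_le_of_oscillation`, `le_mul_of_good_lambda`,
`exists_measure_heavySet_commutator_le`). Let `u_j(t)` be the weight of the union of the dyadic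
cubes of which `{‖T_b^j f‖ > t}` covers more than a fixed proportion. The local step gives `u_j(t) ≤
ρ u_j(t/τ) + C H(t)`, with `ρ < 1` supplied by `A_∞` and `τ > 1` as close to 1 as desired; the lower
orders are absorbed into `H` by induction on `j`. Here `H(t) = ∑ q^{-i} w{M_Ā f > t τ^{-i}}`, which
grows at most by the factor `q` when `t` is divided by `τ`, and `ρ q < 1`, so the iteration
converges. Its remainder vanishes when `w` and `b` are truncated, because then `T_b^j f` is in some
`L^p` and `ρ τ^p < 1`. The constants do not see the truncations, which are removed by monotone
convergence and by almost everywhere convergence along a subsequence.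

The outcome is `w{‖T_b^k f‖ > t} ≤ C H(t)` (`exists_measure_commutator_le`). For (a), integrate
against `p t^{p-1}`: the series converges when `τ^p < q`. For (b), apply the weak type inequality of
`M_Ā` for the pair `(w, Mw)` at each level: submultiplicativity and convexity give `Ā(τ s) ≤ q₁
Ā(s)` with `q₁ < q` for `τ` near 1, and again the series is geometric. -/

noncomputable section

open MonotoneSequenceSpace (coord)

/-! ### Dyadic cubes -/

section Dyadic

variable {n : ℕ}

/-- The index of the dyadic cube of side `2 ^ j` that contains `x`. -/
def dyadicIndex (j : ℤ) (x : Rn n) : Fin n → ℤ := fun i => ⌊x i / 2 ^ j⌋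

/-- The half-open dyadic cube of side `2 ^ Q.1` with index `Q.2`. -/
def cube (Q : ℤ × (Fin n → ℤ)) : Set (Rn n) := {x | dyadicIndex Q.1 x = Q.2}

/-- The dyadic cube of side `2 ^ j` that contains `x`. -/
def cubeAt (j : ℤ) (x : Rn n) : ℤ × (Fin n → ℤ) := (j, dyadicIndex j x)

lemma mem_cube_cubeAt (j : ℤ) (x : Rn n) : x ∈ cube (cubeAt j x) := rfl

lemma cubeAt_eq_of_mem {Q : ℤ × (Fin n → ℤ)} {x : Rn n} (hx : x ∈ cube Q) :
    cubeAt Q.1 x = Q := Prod.ext rfl hx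

lemma mem_cube_iff {Q : ℤ × (Fin n → ℤ)} {x : Rn n} :
    x ∈ cube Q ↔ ∀ i, Q.2 i * 2 ^ Q.1 ≤ x i ∧ x i < (Q.2 i + 1) * 2 ^ Q.1 := by
  have h : (0 : ℝ) < 2 ^ Q.1 := by positivity
  simp only [cube, dyadicIndex, Set.mem_ofPred_eq, funext_iff, Int.floor_eq_iff, le_div_iff₀ h,
    div_lt_iff₀ h]

lemma cube_eq_preimage (Q : ℤ × (Fin n → ℤ)) :
    cube Q = (WithLp.ofLp : Rn n → (Fin n → ℝ)) ⁻¹'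
      Set.univ.pi fun i => Set.Ico (Q.2 i * 2 ^ Q.1 : ℝ) ((Q.2 i + 1) * 2 ^ Q.1) := by
  ext x
  simp [mem_cube_iff, Set.mem_pi]

lemma measurableSet_cube (Q : ℤ × (Fin n → ℤ)) : MeasurableSet (cube Q) := by
  rw [cube_eq_preimage]
  exact (PiLp.volume_preserving_ofLp (Fin n)).measurable
    (MeasurableSet.univ_pi fun i => measurableSet_Ico)

lemma volume_cube (Q : ℤ × (Fin n → ℤ)) : volume (cube Q) = ENNReal.ofReal ((2 ^ Q.1) ^ n) := by
  rw [cube_eq_preimage, (PiLp.volume_preserving_ofLp (Fin n)).measure_preimage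
    (MeasurableSet.univ_pi fun i => measurableSet_Ico).nullMeasurableSet, Real.volume_pi_Ico]
  have : ∀ i : Fin n, ENNReal.ofReal ((Q.2 i + 1) * 2 ^ Q.1 - Q.2 i * 2 ^ Q.1 : ℝ) =
      ENNReal.ofReal (2 ^ Q.1) := fun i => by congr 1; ring
  simp only [this, Finset.prod_const, Finset.card_univ, Fintype.card_fin]
  rw [ENNReal.ofReal_pow (by positivity)]

lemma volume_cube_pos (Q : ℤ × (Fin n → ℤ)) : 0 < volume (cube Q) := by
  rw [volume_cube, ENNReal.ofReal_pos]; positivity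

lemma volume_cube_ne_top (Q : ℤ × (Fin n → ℤ)) : volume (cube Q) ≠ ∞ := by
  rw [volume_cube]; exact ENNReal.ofReal_ne_top

/-- Passing to a coarser scale is integer division of the index, so the fine index determines the
coarse one. This is the source of the nesting of dyadic cubes. -/
lemma dyadicIndex_add_nat (j : ℤ) (d : ℕ) (x : Rn n) :
    dyadicIndex (j + d) x = fun i => dyadicIndex j x i / ((2 ^ d : ℕ) : ℤ) := by
  funext i
  have : x i / 2 ^ (j + d : ℤ) = x i / 2 ^ j / ((2 ^ d : ℕ) : ℝ) := by
    rw [zpow_add₀ two_ne_zero, div_div]; simp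
  rw [dyadicIndex, this, Int.floor_div_natCast]; rfl

lemma dyadicIndex_eq_of_le {j j' : ℤ} (h : j ≤ j') {x y : Rn n}
    (hxy : dyadicIndex j x = dyadicIndex j y) : dyadicIndex j' x = dyadicIndex j' y := by
  obtain ⟨d, rfl⟩ := Int.le.dest h
  rw [dyadicIndex_add_nat, dyadicIndex_add_nat, hxy]

lemma cube_subset_of_mem {Q R : ℤ × (Fin n → ℤ)} {x : Rn n} (hQ : x ∈ cube Q) (hR : x ∈ cube R)
    (h : Q.1 ≤ R.1) : cube Q ⊆ cube R := fun y hy => by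
  have : dyadicIndex Q.1 y = dyadicIndex Q.1 x := by rw [show _ = _ from hy, show _ = _ from hQ]
  have := dyadicIndex_eq_of_le h this
  rw [show dyadicIndex R.1 x = _ from hR] at this
  exact this

lemma cube_nonempty (Q : ℤ × (Fin n → ℤ)) : (cube Q).Nonempty :=
  nonempty_of_measure_ne_zero (volume_cube_pos Q).ne'

/-- The dyadic parent. -/
def parent (Q : ℤ × (Fin n → ℤ)) : ℤ × (Fin n → ℤ) := (Q.1 + 1, fun i => Q.2 i / 2)

lemma cube_subset_parent (Q : ℤ × (Fin n → ℤ)) : cube Q ⊆ cube (parent Q) := fun x hx => by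
  have h := dyadicIndex_add_nat Q.1 1 x
  rw [show dyadicIndex Q.1 x = _ from hx] at h
  simpa [cube, parent] using h

lemma volume_parent (Q : ℤ × (Fin n → ℤ)) :
    volume (cube (parent Q)) = 2 ^ n * volume (cube Q) := by
  rw [volume_cube, volume_cube]
  have : ((2 : ℝ) ^ (parent Q).1) ^ n = 2 ^ n * (2 ^ Q.1) ^ n := by
    rw [← mul_pow, parent]; congr 1; rw [zpow_add₀ two_ne_zero, zpow_one, mul_comm]
  rw [this, ENNReal.ofReal_mul (by positivity), ENNReal.ofReal_pow (by norm_num)]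
  simp

lemma norm_sub_le_of_mem_cube {Q : ℤ × (Fin n → ℤ)} {x y : Rn n} (hx : x ∈ cube Q)
    (hy : y ∈ cube Q) : ‖x - y‖ ≤ n * 2 ^ Q.1 := by
  rw [mem_cube_iff] at hx hy
  have h : ∀ i, ‖(x - y) i‖ ≤ 2 ^ Q.1 := fun i => by
    have h1 := hx i; have h2 := hy i
    rw [Real.norm_eq_abs, abs_le, PiLp.sub_apply]
    constructor <;> nlinarith
  have h0 : (0 : ℝ) ≤ 2 ^ Q.1 := by positivity
  rw [EuclideanSpace.norm_eq]
  apply Real.sqrt_le_iff.2 ⟨by positivity, ?_⟩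
  calc ∑ i, ‖(x - y) i‖ ^ 2 ≤ ∑ _i : Fin n, ((2 : ℝ) ^ Q.1) ^ 2 :=
        Finset.sum_le_sum fun i _ => pow_le_pow_left₀ (norm_nonneg _) (h i) 2
    _ = n * (2 ^ Q.1) ^ 2 := by simp
    _ ≤ (n * 2 ^ Q.1) ^ 2 := by
        rw [mul_pow]
        gcongr
        rcases Nat.eq_zero_or_pos n with rfl | hn
        · simp
        · exact_mod_cast Nat.le_self_pow two_ne_zero n

lemma cube_subset_closedBall {Q : ℤ × (Fin n → ℤ)} {x : Rn n} (hx : x ∈ cube Q) :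
    cube Q ⊆ Metric.closedBall x (n * 2 ^ Q.1) := fun y hy => by
  rw [Metric.mem_closedBall, dist_eq_norm]; exact norm_sub_le_of_mem_cube hy hx

/-- The maximal cubes of a family of dyadic cubes. -/
def maximalCubes (𝓕 : Set (ℤ × (Fin n → ℤ))) : Set (ℤ × (Fin n → ℤ)) :=
  {Q ∈ 𝓕 | ∀ R ∈ 𝓕, Q.1 ≤ R.1 → cube Q ⊆ cube R → R = Q}

lemma maximalCubes_subset (𝓕 : Set (ℤ × (Fin n → ℤ))) : maximalCubes 𝓕 ⊆ 𝓕 := fun _ h => h.1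

lemma maximalCubes_pairwiseDisjoint (𝓕 : Set (ℤ × (Fin n → ℤ))) :
    (maximalCubes 𝓕).PairwiseDisjoint cube := fun Q hQ R hR hne => by
  by_contra h
  obtain ⟨x, hxQ, hxR⟩ := Set.not_disjoint_iff.1 h
  rcases le_total Q.1 R.1 with hle | hle
  · exact hne (hQ.2 R hR.1 hle (cube_subset_of_mem hxQ hxR hle)).symm
  · exact hne (hR.2 Q hQ.1 hle (cube_subset_of_mem hxR hxQ hle))

/-- The cubes through a fixed point form a chain indexed by the generation, and the bound `J`
provides a last one in `𝓕`. Maximality involves generations as well as inclusion because in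
dimension 0 cubes of all generations coincide as sets. -/
lemma exists_maximalCube {𝓕 : Set (ℤ × (Fin n → ℤ))} {J : ℤ} (hJ : ∀ Q ∈ 𝓕, Q.1 ≤ J)
    {R : ℤ × (Fin n → ℤ)} (hR : R ∈ 𝓕) : ∃ Q ∈ maximalCubes 𝓕, cube R ⊆ cube Q := by
  obtain ⟨x, hx⟩ := cube_nonempty R
  obtain ⟨j, ⟨hj, hRj⟩, hmax⟩ := Int.exists_greatest_of_bdd
    (P := fun j => cubeAt j x ∈ 𝓕 ∧ R.1 ≤ j) ⟨J, fun z hz => hJ _ hz.1⟩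
    ⟨R.1, by rwa [cubeAt_eq_of_mem hx], le_rfl⟩
  refine ⟨cubeAt j x, ⟨hj, fun S hS hle hsub => ?_⟩, cube_subset_of_mem hx (mem_cube_cubeAt j x) hRj⟩
  have hxS : x ∈ cube S := hsub (mem_cube_cubeAt j x)
  have hj' := hmax S.1 ⟨by rwa [cubeAt_eq_of_mem hxS], hRj.trans hle⟩
  rw [← cubeAt_eq_of_mem hxS, le_antisymm hj' hle]

lemma biUnion_maximalCubes {𝓕 : Set (ℤ × (Fin n → ℤ))} {J : ℤ} (hJ : ∀ Q ∈ 𝓕, Q.1 ≤ J) :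
    ⋃ Q ∈ maximalCubes 𝓕, cube Q = ⋃ Q ∈ 𝓕, cube Q := by
  apply Set.Subset.antisymm (Set.biUnion_subset_biUnion_left (maximalCubes_subset 𝓕))
  refine Set.iUnion₂_subset fun R hR => ?_
  obtain ⟨Q, hQ, hRQ⟩ := exists_maximalCube hJ hR
  exact hRQ.trans (Set.subset_biUnion_of_mem (u := cube) hQ)

lemma measure_biUnion_maximalCubes (ν : Measure (Rn n)) {𝓕 : Set (ℤ × (Fin n → ℤ))} {J : ℤ}
    (hJ : ∀ Q ∈ 𝓕, Q.1 ≤ J) :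
    ν (⋃ Q ∈ 𝓕, cube Q) = ∑' Q : maximalCubes 𝓕, ν (cube Q) := by
  rw [← biUnion_maximalCubes hJ, measure_biUnion (Set.to_countable _)
    (maximalCubes_pairwiseDisjoint 𝓕) fun Q _ => measurableSet_cube Q]

/-- If `ν (cube Q) ≤ ρ (cube Q)` for all cubes of a family, then the union `U` of the family
satisfies `ν U ≤ ρ U`. -/
lemma measure_biUnion_cube_le {ν ρ : Measure (Rn n)} {𝓕 : Set (ℤ × (Fin n → ℤ))} {J : ℤ}
    (hJ : ∀ Q ∈ 𝓕, Q.1 ≤ J) (h : ∀ Q ∈ 𝓕, ν (cube Q) ≤ ρ (cube Q)) :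
    ν (⋃ Q ∈ 𝓕, cube Q) ≤ ρ (⋃ Q ∈ 𝓕, cube Q) := by
  rw [measure_biUnion_maximalCubes ν hJ, measure_biUnion_maximalCubes ρ hJ]
  exact ENNReal.tsum_le_tsum fun Q => h Q Q.2.1

lemma exists_volume_closedBall_le_cube (n : ℕ) (L : ℝ) : ∃ C : ℝ≥0,
    ∀ (Q : ℤ × (Fin n → ℤ)) (x : Rn n) (r : ℝ), r ≤ L * 2 ^ Q.1 →
      volume (Metric.closedBall x r) ≤ C * volume (cube Q) := by
  refine ⟨(|L| ^ n).toNNReal * (volume (Metric.ball (0 : Rn n) 1)).toNNReal, fun Q x r hr => ?_⟩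
  have hr' : r ≤ |L| * 2 ^ Q.1 := hr.trans (by gcongr; exact le_abs_self L)
  refine (measure_mono (Metric.closedBall_subset_closedBall hr')).trans ?_
  rw [Measure.addHaar_closedBall _ _ (by positivity), volume_cube, finrank_euclideanSpace_fin,
    mul_pow, ENNReal.ofReal_mul (by positivity), ENNReal.coe_mul,
    ENNReal.coe_toNNReal measure_ball_lt_top.ne, mul_right_comm]
  rfl

/-- Lebesgue differentiation along dyadic cubes. -/
lemma ae_enorm_le_of_cube_average_le {E : Type*} [NormedAddCommGroup E] {f : Rn n → E}
    (hf : LocallyIntegrable f volume) :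
    ∀ᵐ x, ∀ (a : ℝ≥0∞) (J : ℤ),
      (∀ j ≤ J, ∫⁻ y in cube (cubeAt j x), ‖f y‖ₑ ≤ a * volume (cube (cubeAt j x))) →
        ‖f x‖ₑ ≤ a := by
  obtain ⟨C, hC⟩ := exists_volume_closedBall_le_cube n (n + 1)
  filter_upwards [(IsUnifLocDoublingMeasure.vitaliFamily (volume : Measure (Rn n))
    1).ae_tendsto_lintegral_enorm_sub_div hf] with x hx a J ha
  have hlim : Tendsto (fun j : ℕ => ((n : ℝ) + 1) * 2 ^ (-(j : ℤ))) atTop (𝓝[>] 0) := by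
    refine tendsto_nhdsWithin_iff.2 ⟨?_, .of_forall fun j => ?_⟩
    · have := (tendsto_pow_atTop_nhds_zero_of_lt_one (r := (1 / 2 : ℝ)) (by norm_num)
        (by norm_num)).const_mul ((n : ℝ) + 1)
      simpa using this
    · simp only [Set.mem_Ioi]; positivity
  have hball := hx.comp (IsUnifLocDoublingMeasure.tendsto_closedBall_filterAt (K := 1) volume
    (fun _ => x) _ hlim (.of_forall fun j => Metric.mem_closedBall_self (by positivity)))
  have hball := (ENNReal.Tendsto.const_mul hball (.inr (ENNReal.coe_ne_top (r := C)))).const_add a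
  rw [mul_zero, add_zero] at hball
  refine ge_of_tendsto hball ?_
  filter_upwards [eventually_ge_atTop (-J).toNat] with j hj
  have hj' : -(j : ℤ) ≤ J := by omega
  set Q := cubeAt (-(j : ℤ)) x with hQ
  set B := Metric.closedBall x (((n : ℝ) + 1) * 2 ^ (-(j : ℤ)))
  have hvB : volume B ≤ C * volume (cube Q) := hC Q x _ le_rfl
  have hBpos : volume B ≠ 0 := (Metric.measure_closedBall_pos _ _ (by positivity)).ne'
  have hBtop : volume B ≠ ∞ := measure_closedBall_lt_top.ne
  have hQB : cube Q ⊆ B := (cube_subset_closedBall (mem_cube_cubeAt _ x)).trans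
    (Metric.closedBall_subset_closedBall (by simp only [cubeAt]; gcongr; linarith))
  -- The small cube lies in a ball about `x` of comparable volume, so the mean of `|f - f x|` on the
  -- cube is at most `C` times its mean on the ball, which tends to 0 at a Lebesgue point. The
  -- exceptional null set depends neither on `a` nor on `J`.
  have key : ‖f x‖ₑ * volume (cube Q) ≤
      (a + C * ((∫⁻ y in B, ‖f y - f x‖ₑ) / volume B)) * volume (cube Q) := by
    calc ‖f x‖ₑ * volume (cube Q) = ∫⁻ y in cube Q, ‖f x‖ₑ := by rw [setLIntegral_const]
      _ ≤ ∫⁻ y in cube Q, (‖f y‖ₑ + ‖f y - f x‖ₑ) := by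
          refine lintegral_mono fun y => ?_
          calc ‖f x‖ₑ = ‖f y - (f y - f x)‖ₑ := by rw [sub_sub_cancel]
            _ ≤ _ := enorm_sub_le
      _ = (∫⁻ y in cube Q, ‖f y‖ₑ) + ∫⁻ y in cube Q, ‖f y - f x‖ₑ :=
          lintegral_add_left' hf.aestronglyMeasurable.enorm.restrict _
      _ ≤ a * volume (cube Q) + ∫⁻ y in B, ‖f y - f x‖ₑ := by
          gcongr
          exact ha _ hj'
      _ = a * volume (cube Q) + ((∫⁻ y in B, ‖f y - f x‖ₑ) / volume B) * volume B := by
          rw [ENNReal.div_mul_cancel hBpos hBtop]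
      _ ≤ a * volume (cube Q) + ((∫⁻ y in B, ‖f y - f x‖ₑ) / volume B) *
            (C * volume (cube Q)) := by gcongr
      _ = _ := by ring
  exact (ENNReal.mul_le_mul_iff_left (volume_cube_pos Q).ne' (volume_cube_ne_top Q)).1 key

/-- The dyadic cubes more than a proportion `s` of which is covered by `E`. -/
def heavyCubes (E : Set (Rn n)) (s : ℝ≥0∞) : Set (ℤ × (Fin n → ℤ)) :=
  {Q | s * volume (cube Q) < volume (cube Q ∩ E)}

/-- The union of the heavy cubes. -/
def heavySet (E : Set (Rn n)) (s : ℝ≥0∞) : Set (Rn n) := ⋃ Q ∈ heavyCubes E s, cube Q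

lemma measurableSet_heavySet (E : Set (Rn n)) (s : ℝ≥0∞) : MeasurableSet (heavySet E s) :=
  MeasurableSet.biUnion (Set.to_countable _) fun Q _ => measurableSet_cube Q

lemma heavyCubes_mono {E F : Set (Rn n)} (h : E ⊆ F) (s : ℝ≥0∞) :
    heavyCubes E s ⊆ heavyCubes F s := fun _ hQ =>
  lt_of_lt_of_le hQ (measure_mono (Set.inter_subset_inter_right _ h))

lemma heavySet_mono {E F : Set (Rn n)} (h : E ⊆ F) (s : ℝ≥0∞) :
    heavySet E s ⊆ heavySet F s := Set.biUnion_subset_biUnion_left (heavyCubes_mono h s)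

lemma measure_inter_le_of_notMem_heavySet {E : Set (Rn n)} {s : ℝ≥0∞}
    {Q : ℤ × (Fin n → ℤ)} {x : Rn n} (hx : x ∈ cube Q) (h : x ∉ heavySet E s) :
    volume (cube Q ∩ E) ≤ s * volume (cube Q) := by
  by_contra hlt
  exact h (Set.mem_biUnion (s := heavyCubes E s) (not_le.1 hlt) hx)

/-- In positive dimension the generation of a cube is controlled by its volume. -/
lemma exists_bound_of_volume_le (hn : 1 ≤ n) {V : ℝ≥0∞} (hV : V ≠ ∞) :
    ∃ J : ℤ, ∀ Q : ℤ × (Fin n → ℤ), volume (cube Q) ≤ V → Q.1 ≤ J := by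
  obtain ⟨m, hm⟩ := pow_unbounded_of_one_lt (V.toReal) (one_lt_two (α := ℝ))
  refine ⟨m, fun Q hQ => ?_⟩
  by_contra! hlt
  rw [volume_cube, ENNReal.ofReal_le_iff_le_toReal hV] at hQ
  have h1 : (2 : ℝ) ^ m ≤ 2 ^ Q.1 := by
    rw [← zpow_natCast]; exact zpow_le_zpow_right₀ one_le_two hlt.le
  have h2 : (1 : ℝ) ≤ 2 ^ m := one_le_pow₀ one_le_two
  have h3 : (2 : ℝ) ^ Q.1 ≤ (2 ^ Q.1) ^ n := le_self_pow₀ (h2.trans h1) (by omega)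
  linarith

/-- A heavy cube has volume at most `|E| / s`. The resulting bound on generations is what makes
maximal heavy cubes exist. -/
lemma heavyCubes_bounded (hn : 1 ≤ n) {E : Set (Rn n)} {s : ℝ≥0∞} (hs : s ≠ 0)
    (hE : volume E ≠ ∞) : ∃ J : ℤ, ∀ Q ∈ heavyCubes E s, Q.1 ≤ J := by
  by_cases hs' : s = ∞
  · refine ⟨0, fun Q hQ => ?_⟩
    simp [heavyCubes, hs', ENNReal.top_mul (volume_cube_pos Q).ne'] at hQ
  obtain ⟨J, hJ⟩ := exists_bound_of_volume_le hn (V := volume E / s)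
    (ENNReal.div_ne_top hE hs)
  refine ⟨J, fun Q hQ => hJ Q ?_⟩
  rw [ENNReal.le_div_iff_mul_le (.inl hs) (.inl hs'), mul_comm]
  exact hQ.le.trans (measure_mono Set.inter_subset_right)

/-- The weak type estimate for a family of heavy cubes. -/
lemma mul_volume_biUnion_le {E : Set (Rn n)} {s : ℝ≥0∞} {𝓕 : Set (ℤ × (Fin n → ℤ))} {J : ℤ}
    (hJ : ∀ Q ∈ 𝓕, Q.1 ≤ J) (h𝓕 : 𝓕 ⊆ heavyCubes E s) :
    s * volume (⋃ Q ∈ 𝓕, cube Q) ≤ volume ((⋃ Q ∈ 𝓕, cube Q) ∩ E) := by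
  rw [← smul_eq_mul, ← Measure.smul_apply, ← Measure.restrict_apply
    (MeasurableSet.biUnion (Set.to_countable _) fun Q _ => measurableSet_cube Q)]
  refine measure_biUnion_cube_le hJ fun Q hQ => ?_
  rw [Measure.restrict_apply (measurableSet_cube Q)]
  exact (h𝓕 hQ).le

/-- Almost every point of `E` lies in a heavy cube. -/
lemma measure_diff_heavySet {E : Set (Rn n)} (hE : NullMeasurableSet E volume) {s : ℝ≥0∞}
    (hs : s < 1) : volume (E \ heavySet E s) = 0 := by
  have hloc : LocallyIntegrable (E.indicator fun _ => (1 : ℝ)) (volume : Measure (Rn n)) := by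
    have h1 : LocallyIntegrable (fun _ : Rn n => (1 : ℝ)) volume := locallyIntegrable_const 1
    refine h1.mono (aestronglyMeasurable_const.indicator₀ hE) (.of_forall fun x => ?_)
    by_cases hx : x ∈ E <;> simp [hx]
  refine measure_mono_null ?_ (ae_iff.1 (ae_enorm_le_of_cube_average_le hloc))
  rintro x ⟨hxE, hxH⟩ hx
  have := hx s 0 fun j _ => by
    have : ∀ y, ‖E.indicator (fun _ => (1 : ℝ)) y‖ₑ = E.indicator (fun _ => (1 : ℝ≥0∞)) y := by
      intro y; by_cases hy : y ∈ E <;> simp [hy]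
    simp only [this]
    rw [lintegral_indicator_const₀ (hE.mono_ac Measure.restrict_le_self.absolutelyContinuous),
      one_mul, Measure.restrict_apply₀' (measurableSet_cube _).nullMeasurableSet, Set.inter_comm]
    exact measure_inter_le_of_notMem_heavySet (mem_cube_cubeAt j x) hxH
  simp only [Set.indicator_of_mem hxE, enorm_one] at this
  exact absurd this (not_le.2 hs)

end Dyadic

/-! ### A good-`λ` inequality -/

section GoodLambda

variable {n : ℕ}

/-- `ν` does not charge more than the proportion `ρ` of a dyadic cube to a subset of at most half
the volume. -/
def SmallSubsets (ν : Measure (Rn n)) (ρ : ℝ≥0∞) : Prop :=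
  ∀ (Q : ℤ × (Fin n → ℤ)) (E : Set (Rn n)), MeasurableSet E → E ⊆ cube Q →
    2 * volume E ≤ volume (cube Q) → ν E ≤ ρ * ν (cube Q)

/-- One step of the good-λ argument, carried out on each maximal heavy cube `Q` of `{‖F‖ > t}`. If
`Q ⊆ S`, it is charged to `ν S`. Otherwise the parent is not heavy, so `‖F‖ ≤ t` on much of it,
which forces `‖c‖ ≤ (1 + κ) t`. Hence `‖F‖ > (1 + 2κ) t` implies `‖F - c‖ > κ t`, which is rare in
the parent. The heavy cubes of the higher level inside `Q` therefore fill at most half of `Q`, and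
`SmallSubsets` yields the factor `ρ`. -/
lemma measure_heavySet_le_of_oscillation {X : Type*} [NormedAddCommGroup X] (hn : 1 ≤ n)
    {ν : Measure (Rn n)} {ρ : ℝ≥0∞} (hν : SmallSubsets ν ρ) {F : Rn n → X} {s s' : ℝ≥0∞}
    (hs : s ≠ 0) (hss : s + s' < 1) (hss' : 2 * (2 ^ n * s') ≤ s) {κ t : ℝ}
    (hκ : 0 ≤ κ) (ht : 0 ≤ t) (hvol : volume {x | t < ‖F x‖} ≠ ∞) {S : Set (Rn n)}
    (hosc : ∀ P, ¬ cube P ⊆ S →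
      ∃ c, volume (cube P ∩ {x | κ * t < ‖F x - c‖}) ≤ s' * volume (cube P)) :
    ν (heavySet {x | (1 + 2 * κ) * t < ‖F x‖} s) ≤
      ρ * ν (heavySet {x | t < ‖F x‖} s) + ν S := by
  set E := {x | t < ‖F x‖}
  set E' := {x | (1 + 2 * κ) * t < ‖F x‖}
  have hs1 : s < 1 := lt_of_le_of_lt le_self_add hss
  have hE' : E' ⊆ E := fun x hx => by
    have hx' : (1 + 2 * κ) * t < ‖F x‖ := hx
    exact lt_of_le_of_lt (by nlinarith [mul_nonneg hκ ht]) hx'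
  obtain ⟨J, hJ⟩ := heavyCubes_bounded hn hs hvol
  have hJ' : ∀ Q ∈ maximalCubes (heavyCubes E s), Q.1 ≤ J := fun Q hQ => hJ Q hQ.1
  have hU : ⋃ Q ∈ maximalCubes (heavyCubes E s), cube Q = heavySet E s := biUnion_maximalCubes hJ
  have key : ∀ Q ∈ maximalCubes (heavyCubes E s),
      (ν.restrict (heavySet E' s)) (cube Q) ≤ (ρ • ν + ν.restrict S) (cube Q) := by
    intro Q hQ
    rw [Measure.restrict_apply (measurableSet_cube Q), Measure.add_apply, Measure.smul_apply,
      Measure.restrict_apply (measurableSet_cube Q), smul_eq_mul]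
    by_cases hQS : cube Q ⊆ S
    · refine le_add_left (measure_mono ?_)
      rw [Set.inter_eq_left.2 hQS]; exact Set.inter_subset_left
    refine le_add_right (hν Q _ ((measurableSet_cube Q).inter (measurableSet_heavySet _ _))
      Set.inter_subset_left ?_)
    obtain ⟨c, hc⟩ := hosc (parent Q) fun h => hQS ((cube_subset_parent Q).trans h)
    have hPnot : parent Q ∉ heavyCubes E s := fun h => by
      have := congrArg Prod.fst (hQ.2 _ h (by simp [parent]) (cube_subset_parent Q))
      simp [parent] at this
    have hPE : volume (cube (parent Q) ∩ E) ≤ s * volume (cube (parent Q)) := not_lt.1 hPnot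
    -- The two exceptional sets cover at most the proportion `s + s' < 1` of the parent.
    obtain ⟨x, hxP, hxE, hxc⟩ : ∃ x ∈ cube (parent Q), ‖F x‖ ≤ t ∧ ‖F x - c‖ ≤ κ * t := by
      by_contra! hcon
      have h1 : cube (parent Q) ⊆ (cube (parent Q) ∩ E) ∪
          (cube (parent Q) ∩ {x | κ * t < ‖F x - c‖}) := fun x hx => by
        by_cases hxE : ‖F x‖ ≤ t
        · exact .inr ⟨hx, hcon x hx hxE⟩
        · exact .inl ⟨hx, not_le.1 hxE⟩
      have h2 := ((measure_mono h1).trans (measure_union_le _ _)).trans (add_le_add hPE hc)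
      rw [← add_mul] at h2
      have h3 := ENNReal.mul_lt_mul_left (volume_cube_pos (parent Q)).ne'
        (volume_cube_ne_top _) hss
      rw [one_mul] at h3
      exact absurd h2 (not_le.2 h3)
    have hc' : ‖c‖ ≤ (1 + κ) * t := by
      have := norm_sub_norm_le c (F x)
      rw [norm_sub_rev] at this
      linarith
    have hE'c : cube Q ∩ E' ⊆ cube (parent Q) ∩ {x | κ * t < ‖F x - c‖} := fun y hy => by
      refine ⟨cube_subset_parent Q hy.1, ?_⟩
      have h1 : (1 + 2 * κ) * t < ‖F y‖ := hy.2
      have h2 := norm_sub_norm_le (F y) c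
      simp only [Set.mem_ofPred_eq]
      linarith
    -- A heavy cube of the higher level meeting `Q` either lies in `Q` or contains it; in the latter
    -- case it is also heavy for the lower level, and maximality makes it equal to `Q`.
    set 𝓖 := {R ∈ heavyCubes E' s | cube R ⊆ cube Q ∧ R.1 ≤ J}
    have hsub : cube Q ∩ heavySet E' s ⊆ ⋃ R ∈ 𝓖, cube R := by
      rintro y ⟨hyQ, hy⟩
      obtain ⟨R, hR, hyR⟩ := Set.mem_iUnion₂.1 hy
      have hRE := heavyCubes_mono hE' s hR
      refine Set.mem_biUnion (s := 𝓖) ⟨hR, ?_, hJ R hRE⟩ hyR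
      rcases le_total R.1 Q.1 with hle | hle
      · exact cube_subset_of_mem hyR hyQ hle
      · rw [hQ.2 R hRE hle (cube_subset_of_mem hyQ hyR hle)]
    have h1 := mul_volume_biUnion_le (𝓕 := 𝓖) (J := J) (fun R hR => hR.2.2)
      (fun R hR => hR.1)
    have h2 : (⋃ R ∈ 𝓖, cube R) ∩ E' ⊆ cube Q ∩ E' :=
      Set.inter_subset_inter_left _ (Set.iUnion₂_subset fun R hR => hR.2.1)
    have h3 : s * volume (⋃ R ∈ 𝓖, cube R) ≤ s' * (2 ^ n * volume (cube Q)) := by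
      rw [← volume_parent]
      exact (h1.trans (measure_mono (h2.trans hE'c))).trans hc
    have h4 : s * (2 * volume (cube Q ∩ heavySet E' s)) ≤ s * volume (cube Q) := calc
      _ = 2 * (s * volume (cube Q ∩ heavySet E' s)) := by ring
      _ ≤ 2 * (s' * (2 ^ n * volume (cube Q))) := by
          refine mul_le_mul_right ?_ 2
          exact (mul_le_mul_right (measure_mono hsub) _).trans h3
      _ = 2 * (2 ^ n * s') * volume (cube Q) := by ring
      _ ≤ s * volume (cube Q) := by gcongr
    exact (ENNReal.mul_le_mul_iff_right hs hs1.ne_top).1 h4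
  have h := measure_biUnion_cube_le hJ' key
  rw [hU] at h
  rw [Measure.restrict_apply (measurableSet_heavySet _ _),
    Set.inter_eq_right.2 (heavySet_mono hE' s), Measure.add_apply, Measure.smul_apply,
    smul_eq_mul] at h
  refine h.trans (add_le_add le_rfl ?_)
  rw [Measure.restrict_apply (measurableSet_heavySet _ _)]
  exact measure_mono Set.inter_subset_right

/-- Iteration of a good-`λ` inequality. -/
lemma le_mul_of_good_lambda {u H : ℝ → ℝ≥0∞} {ρ q C : ℝ≥0∞} {τ : ℝ} (hτ : 1 ≤ τ)
    (hq : ∀ t, 0 < t → H (t / τ) ≤ q * H t)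
    (hu : ∀ t, 0 < t → u t ≤ ρ * u (t / τ) + C * H t)
    (hlim : ∀ t, 0 < t → Tendsto (fun m : ℕ => ρ ^ m * u (t / τ ^ m)) atTop (𝓝 0))
    {t : ℝ} (ht : 0 < t) : u t ≤ C * (1 - ρ * q)⁻¹ * H t := by
  have hH : ∀ m : ℕ, H (t / τ ^ m) ≤ q ^ m * H t := by
    intro m
    induction m with
    | zero => simp
    | succ m ih =>
      have := hq (t / τ ^ m) (by positivity)
      rw [div_div, ← pow_succ] at this
      calc _ ≤ q * (q ^ m * H t) := this.trans (by gcongr)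
        _ = _ := by rw [pow_succ]; ring
  -- Each iteration costs a factor `q` in `H` and gains a factor `ρ`, which produces the geometric
  -- series of ratio `ρ q`.
  have key : ∀ m : ℕ, u t ≤ ρ ^ m * u (t / τ ^ m) +
      C * (∑ i ∈ Finset.range m, (ρ * q) ^ i) * H t := by
    intro m
    induction m with
    | zero => simp
    | succ m ih =>
      have := hu (t / τ ^ m) (by positivity)
      rw [div_div, ← pow_succ] at this
      calc u t ≤ _ := ih
        _ ≤ ρ ^ m * (ρ * u (t / τ ^ (m + 1)) + C * (q ^ m * H t)) +
            C * (∑ i ∈ Finset.range m, (ρ * q) ^ i) * H t := by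
          gcongr
          exact this.trans (by gcongr; exact hH m)
        _ = _ := by rw [Finset.sum_range_succ, mul_pow]; ring
  have hle : ∀ m : ℕ, u t ≤ ρ ^ m * u (t / τ ^ m) + C * (1 - ρ * q)⁻¹ * H t := fun m => by
    refine (key m).trans ?_
    gcongr
    rw [← ENNReal.tsum_geometric]
    exact ENNReal.sum_le_tsum _
  have := (hlim t ht).add_const (C * (1 - ρ * q)⁻¹ * H t)
  rw [zero_add] at this
  exact ge_of_tendsto' this hle

end GoodLambda

/-! ### Muckenhoupt weights -/

section Weights

variable {n : ℕ}

/-- Subsets of a dyadic cube with at least a quarter of its volume have a comparable weight. -/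
lemma IsAInfty.exists_withDensity_cube_le {w : Rn n → ℝ} (hw : IsAInfty w) :
    ∃ C : ℝ≥0, ∀ (Q : ℤ × (Fin n → ℤ)) (E : Set (Rn n)), MeasurableSet E → E ⊆ cube Q →
      volume (cube Q) ≤ 4 * volume E →
      volume.withDensity (fun x => ENNReal.ofReal (w x)) (cube Q) ≤
        C * volume.withDensity (fun x => ENNReal.ofReal (w x)) E := by
  obtain ⟨p, hp, -, hloc, C, hC⟩ := hw
  obtain ⟨C₀, hC₀⟩ := exists_volume_closedBall_le_cube n (n + 1)
  set W : Rn n → ℝ≥0∞ := fun x => ENNReal.ofReal (w x) with hW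
  have hWm : AEMeasurable W volume := hloc.aestronglyMeasurable.aemeasurable.ennreal_ofReal
  have hp0 : 0 < p := by linarith
  refine ⟨C * (C₀ * 4) ^ p, fun Q E hE hEQ hvol => ?_⟩
  rw [withDensity_apply _ (measurableSet_cube Q), withDensity_apply _ hE]
  obtain ⟨x, hx⟩ := cube_nonempty Q
  set B := Metric.ball x ((n + 1) * 2 ^ Q.1)
  have hQB : cube Q ⊆ B := (cube_subset_closedBall hx).trans
    (Metric.closedBall_subset_ball (by gcongr; linarith))
  have hB0 : volume B ≠ 0 := (Metric.measure_ball_pos _ _ (by positivity)).ne'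
  have hBt : volume B ≠ ∞ := measure_ball_lt_top.ne
  have hE0 : volume E ≠ 0 := fun h => by
    rw [h, mul_zero] at hvol
    exact (volume_cube_pos Q).ne' (le_antisymm hvol zero_le)
  have hEt : volume E ≠ ∞ := ((measure_mono hEQ).trans_lt (volume_cube_ne_top Q).lt_top).ne
  have hBE : volume B ≤ (C₀ * 4 : ℝ≥0) * volume E := calc
    _ ≤ C₀ * volume (cube Q) := (measure_mono Metric.ball_subset_closedBall).trans (hC₀ Q x _ le_rfl)
    _ ≤ C₀ * (4 * volume E) := by gcongr
    _ = _ := by push_cast; ring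
  have hAp := hC x ((n + 1) * 2 ^ Q.1) (by positivity)
  refine (lintegral_mono_set hQB).trans ?_
  by_cases hB : ∫⁻ y in B, W y = 0
  · rw [hB]; exact zero_le
  -- As `W` has positive integral over `B`, an infinite dual integral would make the `A_p` product
  -- infinite. Finiteness in turn forces `W ≠ 0` almost everywhere on `B`, since negative powers of
  -- 0 are infinite; this justifies `W^{1/p} W^{-1/p} = 1` in Hölder's inequality.
  have hσ : ∫⁻ y in B, W y ^ (-(1 / (p - 1))) ≠ ∞ := fun h => by
    rw [avg, avg, h, ENNReal.mul_top (ENNReal.inv_ne_zero.2 hBt),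
      ENNReal.top_rpow_of_pos (by linarith), ENNReal.mul_top] at hAp
    · exact ENNReal.coe_ne_top (top_le_iff.1 hAp)
    · exact mul_ne_zero (ENNReal.inv_ne_zero.2 hBt) hB
  have hpos : ∀ᵐ y ∂volume.restrict B, W y ≠ 0 := by
    filter_upwards [ae_lt_top' (hWm.restrict.pow_const _) hσ] with y hy h0
    rw [h0, ENNReal.zero_rpow_of_neg (by simpa using hp)] at hy
    exact lt_irrefl _ hy
  have hpq : p.HolderConjugate (p / (p - 1)) := Real.HolderConjugate.conjExponent hp
  have hHolder : volume E ≤ (∫⁻ y in E, W y) ^ (1 / p) *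
      (∫⁻ y in B, W y ^ (-(1 / (p - 1)))) ^ ((p - 1) / p) := by
    have h := ENNReal.lintegral_mul_le_Lp_mul_Lq (volume.restrict E) hpq
      (f := fun y => W y ^ (1 / p)) (g := fun y => W y ^ (-(1 / p)))
      (hWm.restrict.pow_const _) (hWm.restrict.pow_const _)
    have h1 : ∫⁻ y in E, ((fun y => W y ^ (1 / p)) * fun y => W y ^ (-(1 / p))) y = volume E := by
      rw [← setLIntegral_one]
      refine lintegral_congr_ae ?_
      filter_upwards [ae_restrict_of_ae_restrict_of_subset (hEQ.trans hQB) hpos] with y hy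
      rw [Pi.mul_apply, ← ENNReal.rpow_add _ _ hy ENNReal.ofReal_ne_top]
      simp
    rw [h1] at h
    refine h.trans (mul_le_mul' (le_of_eq ?_) ?_)
    · simp_rw [← ENNReal.rpow_mul, one_div_mul_cancel hp0.ne', ENNReal.rpow_one]
    · rw [one_div_div]
      refine ENNReal.rpow_le_rpow ?_ (div_nonneg (by linarith) hp0.le)
      refine le_trans (le_of_eq ?_) (lintegral_mono_set (hEQ.trans hQB))
      have hexp : -(1 / p) * (p / (p - 1)) = -(1 / (p - 1)) := by
        have : p - 1 ≠ 0 := by linarith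
        field_simp
      simp_rw [← ENNReal.rpow_mul, hexp]
  have hHolder' : volume E ^ p ≤ (∫⁻ y in E, W y) *
      (∫⁻ y in B, W y ^ (-(1 / (p - 1)))) ^ (p - 1) := by
    have := ENNReal.rpow_le_rpow hHolder hp0.le
    rwa [ENNReal.mul_rpow_of_nonneg _ _ hp0.le, ← ENNReal.rpow_mul, ← ENNReal.rpow_mul,
      one_div_mul_cancel hp0.ne', ENNReal.rpow_one, div_mul_cancel₀ _ hp0.ne'] at this
  have hEp0 : volume E ^ p ≠ 0 := (ENNReal.rpow_pos hE0.bot_lt hEt).ne'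
  have hEpt : volume E ^ p ≠ ∞ := ENNReal.rpow_ne_top_of_nonneg hp0.le hEt
  have hAp' : (∫⁻ y in B, W y) * (∫⁻ y in B, W y ^ (-(1 / (p - 1)))) ^ (p - 1) ≤
      C * volume B ^ p := by
    have h1 : volume B ^ p = volume B * volume B ^ (p - 1) := by
      conv_lhs => rw [show p = 1 + (p - 1) by ring, ENNReal.rpow_add _ _ hB0 hBt, ENNReal.rpow_one]
    have h2 : ∀ a : ℝ≥0∞, a = volume B * ((volume B)⁻¹ * a) := fun a => by
      rw [← mul_assoc, ENNReal.mul_inv_cancel hB0 hBt, one_mul]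
    calc _ = volume B * avg B W *
          (volume B * avg B (fun y => W y ^ (-(1 / (p - 1))))) ^ (p - 1) := by
            rw [avg, avg, ← h2, ← h2]
      _ = avg B W * avg B (fun y => W y ^ (-(1 / (p - 1)))) ^ (p - 1) * volume B ^ p := by
            rw [ENNReal.mul_rpow_of_nonneg _ _ (by linarith), h1]; ring
      _ ≤ _ := by gcongr
  refine (ENNReal.mul_le_mul_iff_left hEp0 hEpt).1 ?_
  calc (∫⁻ y in B, W y) * volume E ^ p ≤ (∫⁻ y in B, W y) * ((∫⁻ y in E, W y) *
        (∫⁻ y in B, W y ^ (-(1 / (p - 1)))) ^ (p - 1)) := by gcongr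
    _ = (∫⁻ y in E, W y) * ((∫⁻ y in B, W y) *
        (∫⁻ y in B, W y ^ (-(1 / (p - 1)))) ^ (p - 1)) := by ring
    _ ≤ (∫⁻ y in E, W y) * (C * ((C₀ * 4 : ℝ≥0) * volume E) ^ p) := by
        refine mul_le_mul_right (hAp'.trans (mul_le_mul_right ?_ _)) _
        exact ENNReal.rpow_le_rpow hBE hp0.le
    _ = _ := by
        rw [ENNReal.mul_rpow_of_nonneg _ _ hp0.le, ENNReal.coe_mul C,
          ENNReal.coe_rpow_of_nonneg _ hp0.le]
        ring

/-- The truncations of an `A_∞` weight do not concentrate on small subsets of dyadic cubes,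
uniformly in the truncation. -/
lemma IsAInfty.exists_smallSubsets {w : Rn n → ℝ} (hw : IsAInfty w) :
    ∃ ρ : ℝ≥0, ρ < 1 ∧ ∀ N : ℕ,
      SmallSubsets (volume.withDensity fun x => min (ENNReal.ofReal (w x)) N) ρ := by
  obtain ⟨C, hC⟩ := hw.exists_withDensity_cube_le
  have hWm : AEMeasurable (fun x => ENNReal.ofReal (w x)) (volume : Measure (Rn n)) := by
    obtain ⟨p, -, -, hloc, -⟩ := hw
    exact hloc.aestronglyMeasurable.aemeasurable.ennreal_ofReal
  set W := hWm.mk _ with hW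
  have hWmeas : Measurable W := hWm.measurable_mk
  have hWN : ∀ N : ℕ, volume.withDensity (fun x => min (ENNReal.ofReal (w x)) N) =
      volume.withDensity fun x => min (W x) N := fun N =>
    withDensity_congr_ae (hWm.ae_eq_mk.mono fun x hx => by simp only [hx, ← hW])
  rw [withDensity_congr_ae hWm.ae_eq_mk] at hC
  -- `C` serves the region where `W ≤ N`, and 4 the region where the truncation is active and `ν` is
  -- `N` times Lebesgue measure. From `ν Q ≤ D ν (Q \ F)` one gets `ν F ≤ (1 - 1/D) ν Q`, with no
  -- dependence on `N`.
  set D : ℝ≥0 := max C 4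
  have hD : (4 : ℝ≥0) ≤ D := le_max_right _ _
  refine ⟨1 - D⁻¹, tsub_lt_self one_pos (inv_pos.2 (lt_of_lt_of_le (by norm_num) hD)),
    fun N Q F hF hFQ hvol => ?_⟩
  rw [hWN]
  set ν := volume.withDensity fun x => min (W x) N
  have hνle : ν ≤ volume.withDensity W := withDensity_mono (.of_forall fun x => min_le_left _ _)
  have hνvol : ∀ E, MeasurableSet E → ν E ≤ N * volume E := fun E hE => by
    rw [withDensity_apply _ hE, ← setLIntegral_const]
    exact lintegral_mono fun x => min_le_right _ _
  have hνQ : ν (cube Q) ≠ ∞ := ((hνvol _ (measurableSet_cube Q)).trans_lt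
    (ENNReal.mul_lt_top (by simp) (volume_cube_ne_top Q).lt_top)).ne
  have hFt : volume F ≠ ∞ := ((measure_mono hFQ).trans_lt (volume_cube_ne_top Q).lt_top).ne
  have hEvol : volume (cube Q) ≤ 2 * volume (cube Q \ F) := by
    rw [measure_sdiff hFQ hF.nullMeasurableSet hFt, ENNReal.mul_sub (by simp)]
    refine ENNReal.le_sub_of_add_le_left (by finiteness) ?_
    rw [two_mul (volume (cube Q))]
    gcongr
  have hEν : ν (cube Q) ≤ D * ν (cube Q \ F) := by
    have hs : MeasurableSet {x | W x ≤ N} := measurableSet_le hWmeas measurable_const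
    have hE : MeasurableSet (cube Q \ F) := (measurableSet_cube Q).diff hF
    set E₁ := (cube Q \ F) ∩ {x | W x ≤ N}
    set E₂ := (cube Q \ F) \ {x | W x ≤ N}
    have hsplit : volume (cube Q \ F) = volume E₁ + volume E₂ :=
      (measure_inter_add_sdiff _ hs).symm
    -- `Q \ F` is at least half of `Q`, so the larger of its two pieces is at least a quarter.
    have : volume (cube Q) ≤ 4 * volume E₁ ∨ volume (cube Q) ≤ 4 * volume E₂ := by
      rcases le_total (volume E₁) (volume E₂) with h | h
      · right
        calc _ ≤ _ := hEvol
          _ ≤ 2 * (volume E₂ + volume E₂) := by rw [hsplit]; gcongr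
          _ = _ := by ring
      · left
        calc _ ≤ _ := hEvol
          _ ≤ 2 * (volume E₁ + volume E₁) := by rw [hsplit]; gcongr
          _ = _ := by ring
    rcases this with h | h
    · calc ν (cube Q) ≤ volume.withDensity W (cube Q) := hνle _
        _ ≤ C * volume.withDensity W E₁ :=
            hC Q E₁ (hE.inter hs) (Set.inter_subset_left.trans Set.sdiff_subset) h
        _ = C * ν E₁ := by
            rw [withDensity_apply _ (hE.inter hs), withDensity_apply _ (hE.inter hs)]
            congr 1
            exact setLIntegral_congr_fun (hE.inter hs) fun x hx => (min_eq_left hx.2).symm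
        _ ≤ D * ν (cube Q \ F) := by
            gcongr
            · exact le_max_left _ _
            · exact Set.inter_subset_left
    · calc ν (cube Q) ≤ N * volume (cube Q) := hνvol _ (measurableSet_cube Q)
        _ ≤ N * (4 * volume E₂) := by gcongr
        _ = 4 * ν E₂ := by
            have : ν E₂ = ∫⁻ _x in E₂, (N : ℝ≥0∞) := by
              rw [withDensity_apply _ (hE.diff hs)]
              exact setLIntegral_congr_fun (hE.diff hs) fun x hx =>
                min_eq_right (not_le.1 hx.2).le
            rw [this, setLIntegral_const]; ring
        _ ≤ D * ν (cube Q \ F) := by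
            gcongr
            · exact_mod_cast hD
            · exact Set.sdiff_subset
  have hadd : ν F + ν (cube Q \ F) = ν (cube Q) := by
    have := measure_inter_add_sdiff (μ := ν) (cube Q) hF
    rwa [Set.inter_eq_right.2 hFQ] at this
  have hD0 : (D : ℝ≥0∞) ≠ 0 := by
    simpa using (lt_of_lt_of_le (by norm_num) hD : 0 < D).ne'
  have h1 : (D : ℝ≥0∞)⁻¹ * ν (cube Q) ≤ ν (cube Q \ F) := by
    rw [mul_comm, ← div_eq_mul_inv]
    exact ENNReal.div_le_of_le_mul' hEν
  rw [ENNReal.coe_sub, ENNReal.coe_one, ENNReal.coe_inv (by simpa using hD0),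
    ENNReal.sub_mul (fun _ _ => hνQ), one_mul]
  refine ENNReal.le_sub_of_add_le_right (by finiteness) ?_
  rw [← hadd]
  gcongr
  rw [hadd]; exact h1

end Weights

/-! ### The John-Nirenberg inequality -/

section JohnNirenberg

variable {n : ℕ}

/-- The mean oscillation of `b` over every ball, with respect to some constant, is at most `1`. -/
def UnitOscillation (b : Rn n → ℝ) : Prop :=
  LocallyIntegrable b volume ∧ ∀ (x : Rn n) (r : ℝ), 0 < r →
    ∃ c : ℝ, ∫⁻ y in Metric.ball x r, ‖b y - c‖ₑ ≤ volume (Metric.ball x r)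

/-- The integrated triangle inequality: two constants that both approximate `b` in mean on `S` are
close. All comparisons of means over different balls and cubes rest on it. -/
lemma enorm_sub_mul_volume_le {b : Rn n → ℝ} (hb : AEStronglyMeasurable b volume) (c c' : ℝ)
    (S : Set (Rn n)) :
    ‖c - c'‖ₑ * volume S ≤ (∫⁻ y in S, ‖b y - c‖ₑ) + ∫⁻ y in S, ‖b y - c'‖ₑ := by
  calc ‖c - c'‖ₑ * volume S = ∫⁻ _ in S, ‖c - c'‖ₑ := (setLIntegral_const _ _).symm
    _ ≤ ∫⁻ y in S, (‖b y - c‖ₑ + ‖b y - c'‖ₑ) := lintegral_mono fun y => by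
        calc ‖c - c'‖ₑ = ‖(b y - c') - (b y - c)‖ₑ := by congr 1; ring
          _ ≤ ‖b y - c'‖ₑ + ‖b y - c‖ₑ := enorm_sub_le
          _ = _ := add_comm _ _
    _ = _ := lintegral_add_left' (hb.sub aestronglyMeasurable_const).enorm.restrict _

lemma UnitOscillation.exists_cube (n : ℕ) : ∃ C : ℝ≥0, 1 ≤ C ∧ ∀ b : Rn n → ℝ,
    UnitOscillation b → ∀ Q : ℤ × (Fin n → ℤ), ∃ c : ℝ,
      ∫⁻ y in cube Q, ‖b y - c‖ₑ ≤ C * volume (cube Q) := by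
  obtain ⟨C, hC⟩ := exists_volume_closedBall_le_cube n (n + 1)
  refine ⟨max C 1, le_max_right _ _, fun b hb Q => ?_⟩
  obtain ⟨x, hx⟩ := cube_nonempty Q
  obtain ⟨c, hc⟩ := hb.2 x ((n + 1) * 2 ^ Q.1) (by positivity)
  refine ⟨c, (lintegral_mono_set ((cube_subset_closedBall hx).trans
    (Metric.closedBall_subset_ball (by gcongr; linarith)))).trans (hc.trans ?_)⟩
  refine (measure_mono Metric.ball_subset_closedBall).trans ((hC Q x _ le_rfl).trans ?_)
  gcongr
  exact le_max_left _ _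

/-- The distributional form of the John-Nirenberg inequality on dyadic cubes. -/
lemma exists_volume_cube_inter_le (n : ℕ) {C : ℝ≥0} (hC : 1 ≤ C) : ∃ L : ℝ≥0, 0 < L ∧
    ∀ (b : Rn n → ℝ), LocallyIntegrable b volume → ∀ c : (ℤ × (Fin n → ℤ)) → ℝ,
      (∀ Q, ∫⁻ y in cube Q, ‖b y - c Q‖ₑ ≤ C * volume (cube Q)) →
      ∀ (m : ℕ) (Q : ℤ × (Fin n → ℤ)),
        volume (cube Q ∩ {x | (m * L : ℝ≥0) < ‖b x - c Q‖ₑ}) ≤ 2⁻¹ ^ m * volume (cube Q) := by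
  -- `L` bounds the jump from `c Q` to `c R` for a stopping cube `R`: `C` is the oscillation over
  -- `R`, and `2^n * 2C` comes from the parent of `R`, where the mean of `|b - c Q|` is still at
  -- most `2C`.
  refine ⟨C + 2 ^ n * (2 * C), by positivity, fun b hb c hc m => ?_⟩
  set L := C + 2 ^ n * (2 * C) with hL
  have h2CL : 2 * C ≤ L := by
    calc 2 * C = 1 * (2 * C) := (one_mul _).symm
      _ ≤ 2 ^ n * (2 * C) := by gcongr; exact one_le_pow₀ one_le_two
      _ ≤ L := le_add_self
  induction m with
  | zero => intro Q; simpa using measure_mono Set.inter_subset_left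
  | succ m ih =>
  intro Q
  -- Stopping cubes at height `2C`, twice the mean oscillation allowed on `Q`. That factor 2 is why
  -- they fill at most half of `Q`.
  set 𝓕 := {R : ℤ × (Fin n → ℤ) | cube R ⊆ cube Q ∧ R.1 ≤ Q.1 ∧
    (2 * C : ℝ≥0) * volume (cube R) < ∫⁻ y in cube R, ‖b y - c Q‖ₑ}
  have hJ : ∀ R ∈ 𝓕, R.1 ≤ Q.1 := fun R hR => hR.2.1
  have hJ' : ∀ R ∈ maximalCubes 𝓕, R.1 ≤ Q.1 := fun R hR => hJ R hR.1
  have hQ𝓕 : Q ∉ 𝓕 := fun h => by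
    refine absurd h.2.2 (not_lt.2 ((hc Q).trans ?_))
    gcongr
    exact le_mul_of_one_le_left zero_le one_le_two
  have hdiff : ∀ R ∈ maximalCubes 𝓕, ‖c R - c Q‖ₑ ≤ L := by
    intro R hR
    obtain ⟨x, hx⟩ := cube_nonempty R
    have hxQ := hR.1.1 hx
    have hlt : R.1 < Q.1 := by
      refine lt_of_le_of_ne hR.1.2.1 fun h => hQ𝓕 ?_
      rw [← cubeAt_eq_of_mem hxQ, ← h, cubeAt_eq_of_mem hx]
      exact hR.1
    have hP : parent R ∉ 𝓕 := fun h => by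
      have := congrArg Prod.fst (hR.2 _ h (by simp [parent]) (cube_subset_parent R))
      simp [parent] at this
    have hPQ : cube (parent R) ⊆ cube Q :=
      cube_subset_of_mem (cube_subset_parent R hx) hxQ (by simp only [parent]; omega)
    have hP' : ∫⁻ y in cube (parent R), ‖b y - c Q‖ₑ ≤ (2 * C : ℝ≥0) * volume (cube (parent R)) := by
      by_contra h
      exact hP ⟨hPQ, by simp only [parent]; omega, not_le.1 h⟩
    refine (ENNReal.mul_le_mul_iff_left (volume_cube_pos R).ne' (volume_cube_ne_top R)).1 ?_
    calc _ ≤ _ := enorm_sub_mul_volume_le hb.aestronglyMeasurable _ _ _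
      _ ≤ C * volume (cube R) + (2 * C : ℝ≥0) * volume (cube (parent R)) := by
          gcongr
          · exact hc R
          · exact (lintegral_mono_set (cube_subset_parent R)).trans hP'
      _ = L * volume (cube R) := by rw [volume_parent, hL]; push_cast; ring
  -- Off the stopping cubes Lebesgue differentiation gives `|b - c Q| ≤ 2C ≤ L`.
  have hcover : volume ((cube Q ∩ {x | ((m + 1 : ℕ) * L : ℝ≥0) < ‖b x - c Q‖ₑ}) \
      ⋃ R ∈ 𝓕, cube R) = 0 := by
    refine measure_mono_null ?_ (ae_iff.1 (ae_enorm_le_of_cube_average_le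
      (f := fun x => b x - c Q) (hb.sub (locallyIntegrable_const _))))
    rintro x ⟨⟨hxQ, hx⟩, hxU⟩ hcon
    have h1 := hcon (2 * C : ℝ≥0) Q.1 fun j hj => by
      by_contra hlt
      refine hxU (Set.mem_biUnion (s := 𝓕) (x := cubeAt j x) ⟨?_, hj, not_le.1 hlt⟩
        (mem_cube_cubeAt j x))
      exact cube_subset_of_mem (mem_cube_cubeAt j x) hxQ hj
    have h2 : ((m + 1 : ℕ) * L : ℝ≥0) < (2 * C : ℝ≥0) := by exact_mod_cast lt_of_lt_of_le hx h1
    refine absurd (h2.trans_le h2CL) (not_lt.2 ?_)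
    exact le_mul_of_one_le_left zero_le (by push_cast; exact le_add_self)
  -- On a maximal stopping cube `R`, exceeding `(m + 1) L` relative to `c Q` forces exceeding `m L`
  -- relative to `c R`, so the induction hypothesis applies to `R`.
  have hsum : (volume.restrict {x | ((m + 1 : ℕ) * L : ℝ≥0) < ‖b x - c Q‖ₑ}) (⋃ R ∈ 𝓕, cube R) ≤
      2⁻¹ ^ m * volume (⋃ R ∈ 𝓕, cube R) := by
    have := measure_biUnion_cube_le (ν := volume.restrict {x | ((m + 1 : ℕ) * L : ℝ≥0) < ‖b x - c Q‖ₑ})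
      (ρ := (2⁻¹ ^ m : ℝ≥0∞) • volume) hJ' fun R hR => by
        rw [Measure.restrict_apply (measurableSet_cube R), Measure.smul_apply, smul_eq_mul]
        refine (measure_mono ?_).trans (ih R)
        refine Set.inter_subset_inter_right _ fun x hx => ?_
        by_contra hcon
        have h1 : ‖b x - c R‖ₑ ≤ (m * L : ℝ≥0) := not_lt.1 hcon
        have h2 : ‖b x - c Q‖ₑ ≤ ((m + 1 : ℕ) * L : ℝ≥0) := calc
          ‖b x - c Q‖ₑ = ‖(b x - c R) + (c R - c Q)‖ₑ := by congr 1; ring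
          _ ≤ ‖b x - c R‖ₑ + ‖c R - c Q‖ₑ := enorm_add_le _ _
          _ ≤ (m * L : ℝ≥0) + L := add_le_add h1 (hdiff R hR)
          _ = _ := by push_cast; ring
        exact absurd hx (not_lt.2 h2)
    rwa [biUnion_maximalCubes hJ, Measure.smul_apply, smul_eq_mul] at this
  have hU : MeasurableSet (⋃ R ∈ 𝓕, cube R) :=
    MeasurableSet.biUnion (Set.to_countable _) fun R _ => measurableSet_cube R
  have hhalf : 2 * volume (⋃ R ∈ 𝓕, cube R) ≤ volume (cube Q) := by
    have := measure_biUnion_cube_le (ν := (2 * C : ℝ≥0) • volume)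
      (ρ := volume.withDensity fun y => ‖b y - c Q‖ₑ) hJ fun R hR => by
        rw [withDensity_apply _ (measurableSet_cube R)]
        exact hR.2.2.le
    rw [withDensity_apply _ hU] at this
    have h1 : (2 * C : ℝ≥0) * volume (⋃ R ∈ 𝓕, cube R) ≤ C * volume (cube Q) :=
      (this.trans (lintegral_mono_set (Set.iUnion₂_subset fun R hR => hR.1))).trans (hc Q)
    have hC0 : (C : ℝ≥0∞) ≠ 0 := by simpa using (lt_of_lt_of_le one_pos hC).ne'
    refine (ENNReal.mul_le_mul_iff_right hC0 ENNReal.coe_ne_top).1 (le_trans (le_of_eq ?_) h1)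
    push_cast; ring
  have hsplit := measure_inter_add_sdiff (μ := volume)
    (cube Q ∩ {x | ((m + 1 : ℕ) * L : ℝ≥0) < ‖b x - c Q‖ₑ}) hU
  rw [hcover, add_zero] at hsplit
  rw [Measure.restrict_apply hU] at hsum
  rw [← hsplit]
  calc _ ≤ _ := (measure_mono (Set.subset_inter Set.inter_subset_right
        (Set.inter_subset_left.trans Set.inter_subset_right))).trans hsum
    _ = 2⁻¹ ^ (m + 1) * (2 * volume (⋃ R ∈ 𝓕, cube R)) := by
        rw [pow_succ, mul_assoc, ← mul_assoc 2⁻¹, ENNReal.inv_mul_cancel (by simp) (by simp), one_mul]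
    _ ≤ _ := by gcongr

/-- Exponential integrability from exponential decay of the distribution function. -/
lemma lintegral_exp_le {g : Rn n → ℝ} (hg : AEMeasurable g volume) {L : ℝ≥0} (hL : 0 < L)
    {S : Set (Rn n)} (hS : MeasurableSet S)
    (h : ∀ m : ℕ, volume (S ∩ {x | (m * L : ℝ≥0) < ‖g x‖ₑ}) ≤ 2⁻¹ ^ m * volume S) :
    ∫⁻ x in S, ENNReal.ofReal (Real.exp (Real.log (3 / 2) / L * |g x|)) ≤ 7 * volume S := by
  -- On `m L < |g| ≤ (m + 1) L` the exponential is at most `(3/2)^(m+1)`. Against the measure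
  -- `2^{-m}` the series `∑ (3/2)(3/4)^m` sums to 6; with the 1 that takes care of `g = 0` this
  -- makes 7.
  have hpt : ∀ x, ENNReal.ofReal (Real.exp (Real.log (3 / 2) / L * |g x|)) ≤
      1 + ∑' m : ℕ, {x | (m * L : ℝ≥0) < ‖g x‖ₑ}.indicator
        (fun _ => ENNReal.ofReal ((3 / 2) ^ (m + 1))) x := by
    intro x
    by_cases hx : g x = 0
    · refine le_add_right ?_
      simp [hx]
    refine le_add_left ?_
    have hL' : (0 : ℝ) < L := hL
    set m := ⌈|g x| / L⌉₊ - 1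
    have hpos : 0 < ⌈|g x| / L⌉₊ := Nat.ceil_pos.2 (by positivity)
    have hm1 : m + 1 = ⌈|g x| / L⌉₊ := Nat.sub_add_cancel hpos
    have h1 : (m : ℝ) < |g x| / L := Nat.lt_ceil.1 (by omega)
    have h2 : |g x| / L ≤ (m : ℝ) + 1 := by
      have := Nat.le_ceil (|g x| / (L : ℝ))
      rw [← hm1] at this; exact_mod_cast this
    refine le_trans ?_ (ENNReal.le_tsum m)
    rw [Set.indicator_of_mem]
    · refine ENNReal.ofReal_le_ofReal ?_
      have h32 : (3 / 2 : ℝ) ^ (m + 1) = Real.exp (Real.log (3 / 2) * (m + 1)) := by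
        rw [mul_comm, ← Nat.cast_succ, Real.exp_nat_mul, Real.exp_log (by norm_num)]
      rw [h32]
      refine Real.exp_le_exp.2 ?_
      rw [div_mul_eq_mul_div, mul_div_assoc]
      exact mul_le_mul_of_nonneg_left h2 (Real.log_nonneg (by norm_num))
    · have : ((m * L : ℝ≥0) : ℝ) < ‖g x‖ := by
        push_cast; rw [lt_div_iff₀ hL'] at h1; exact h1
      simp only [Set.mem_ofPred_eq, ← ofReal_norm]
      rwa [← ENNReal.ofReal_coe_nnreal, ENNReal.ofReal_lt_ofReal_iff_of_nonneg (NNReal.coe_nonneg _)]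
  have hmeas : ∀ m : ℕ, NullMeasurableSet {x | (m * L : ℝ≥0) < ‖g x‖ₑ} volume := fun m =>
    nullMeasurableSet_lt aemeasurable_const hg.enorm
  calc _ ≤ _ := lintegral_mono hpt
    _ = volume S + ∑' m : ℕ, ENNReal.ofReal ((3 / 2) ^ (m + 1)) *
          volume (S ∩ {x | (m * L : ℝ≥0) < ‖g x‖ₑ}) := by
        rw [lintegral_add_left measurable_const, setLIntegral_one, lintegral_tsum fun m =>
          aemeasurable_const.indicator₀ ((hmeas m).mono_ac Measure.restrict_le_self.absolutelyContinuous)]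
        congr 2
        funext m
        rw [lintegral_indicator_const₀ ((hmeas m).mono_ac
          Measure.restrict_le_self.absolutelyContinuous), Measure.restrict_apply₀'
          hS.nullMeasurableSet, Set.inter_comm]
    _ ≤ volume S + ∑' m : ℕ, ENNReal.ofReal ((3 / 2) ^ (m + 1)) * (2⁻¹ ^ m * volume S) := by
        gcongr with m; exact h m
    _ = 7 * volume S := by
        have : ∀ m : ℕ, ENNReal.ofReal ((3 / 2) ^ (m + 1)) * (2⁻¹ ^ m * volume S) =
            ENNReal.ofReal (3 / 2 * (3 / 4) ^ m) * volume S := fun m => by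
          rw [← mul_assoc]
          congr 1
          have : (2⁻¹ : ℝ≥0∞) ^ m = ENNReal.ofReal ((1 / 2) ^ m) := by
            rw [ENNReal.ofReal_pow (by norm_num)]; congr 1
            rw [one_div, ENNReal.ofReal_inv_of_pos two_pos]; simp
          rw [this, ← ENNReal.ofReal_mul (by positivity)]
          congr 1
          rw [pow_succ, show (3 / 4 : ℝ) = 3 / 2 * (1 / 2) by norm_num, mul_pow]; ring
        simp_rw [this]
        rw [ENNReal.tsum_mul_right, ← ENNReal.ofReal_tsum_of_nonneg (fun m => by positivity)
          ((summable_geometric_of_lt_one (by norm_num) (by norm_num)).mul_left _), tsum_mul_left,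
          tsum_geometric_of_lt_one (by norm_num) (by norm_num)]
        norm_num
        ring

/-- The John-Nirenberg inequality on balls. -/
lemma exists_lintegral_ball_exp_le (n : ℕ) : ∃ a : ℝ, 0 < a ∧ ∃ C : ℝ≥0, ∀ b : Rn n → ℝ,
    UnitOscillation b → ∀ (x : Rn n) (r : ℝ), 0 < r → ∀ c : ℝ,
      ∫⁻ y in Metric.ball x r, ‖b y - c‖ₑ ≤ volume (Metric.ball x r) →
        ∫⁻ y in Metric.ball x r, ENNReal.ofReal (Real.exp (a * |b y - c|)) ≤
          C * volume (Metric.ball x r) := by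
  obtain ⟨C₀, hC₀, hcube⟩ := UnitOscillation.exists_cube n
  obtain ⟨L, hL, hJN⟩ := exists_volume_cube_inter_le n hC₀
  obtain ⟨C₂, hC₂⟩ := exists_volume_closedBall_le_cube n (2 * n + 2)
  set a : ℝ := Real.log (3 / 2) / L
  have ha : 0 < a := div_pos (Real.log_pos (by norm_num)) hL
  set C₁ : ℝ≥0 := (2 * n + 2) ^ n
  have hC₁ : ∀ (x : Rn n) (r : ℝ), 0 < r →
      volume (Metric.ball x ((2 * n + 2) * r)) = C₁ * volume (Metric.ball x r) := by
    intro x r hr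
    rw [Measure.addHaar_ball_of_pos _ _ (by positivity), Measure.addHaar_ball_of_pos _ _ hr,
      finrank_euclideanSpace_fin, mul_pow, ENNReal.ofReal_mul (by positivity), mul_assoc]
    congr 1
    rw [ENNReal.ofReal_pow (by positivity)]
    simp only [C₁, ENNReal.coe_pow]
    congr 1
    rw [ENNReal.ofReal, ENNReal.coe_inj]
    ext; simp
  -- With `c'` the constant of the enlarged ball `B'`, the first bracket bounds `|c_Q - c'|` for the
  -- cubes `Q` meeting the ball, and the second bounds `|c' - c|`.
  set D : ℝ≥0 := (C₀ + C₂) + (1 + C₁)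
  refine ⟨a, ha, (Real.exp (a * D)).toNNReal * 7 * C₁, fun b hb x r hr c hc => ?_⟩
  choose cQ hcQ using hcube b hb
  have hbm := hb.1.aestronglyMeasurable
  -- Cubes of side `2^(j+1)`, which lies in `[r, 2r)`: small enough that those meeting `B` stay
  -- inside `B'`, large enough that `B'` has volume comparable with theirs.
  obtain ⟨j, hj⟩ := exists_mem_Ioc_zpow hr (one_lt_two (α := ℝ))
  set B := Metric.ball x r
  set B' := Metric.ball x ((2 * n + 2) * r)
  have hBB' : B ⊆ B' := Metric.ball_subset_ball (by nlinarith [(Nat.cast_nonneg n : (0 : ℝ) ≤ n)])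
  obtain ⟨c', hc'⟩ := hb.2 x ((2 * n + 2) * r) (by positivity)
  have hB0 : volume B ≠ 0 := (Metric.measure_ball_pos _ _ hr).ne'
  have hBt : volume B ≠ ∞ := measure_ball_lt_top.ne
  have hcc' : ‖c' - c‖ₑ ≤ (1 + C₁ : ℝ≥0) := by
    refine (ENNReal.mul_le_mul_iff_left hB0 hBt).1 ?_
    calc _ ≤ _ := enorm_sub_mul_volume_le hbm c' c B
      _ ≤ volume B' + volume B := add_le_add ((lintegral_mono_set hBB').trans hc') hc
      _ = _ := by rw [hC₁ x r hr]; push_cast; ring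
  set 𝓕 := {Q : ℤ × (Fin n → ℤ) | Q.1 = j + 1 ∧ (cube Q ∩ B).Nonempty}
  have h𝓕B' : ∀ Q ∈ 𝓕, cube Q ⊆ B' := by
    rintro Q ⟨hQ, z, hzQ, hzB⟩ y hy
    have h1 := norm_sub_le_of_mem_cube hy hzQ
    have h2 : ‖z - x‖ < r := by rwa [← dist_eq_norm]
    have h3 : (2 : ℝ) ^ Q.1 < 2 * r := by
      rw [hQ, zpow_add₀ two_ne_zero, zpow_one]; linarith [hj.1]
    have h4 : ‖y - x‖ ≤ ‖y - z‖ + ‖z - x‖ := by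
      simpa using norm_add_le (y - z) (z - x)
    have h5 : (n : ℝ) * 2 ^ Q.1 ≤ n * (2 * r) := by gcongr
    show dist y x < _
    rw [dist_eq_norm]
    linarith
  have hcov : B ⊆ ⋃ Q ∈ 𝓕, cube Q := fun y hy =>
    Set.mem_biUnion (s := 𝓕) (x := cubeAt (j + 1) y) ⟨rfl, y, mem_cube_cubeAt _ _, hy⟩
      (mem_cube_cubeAt _ _)
  have hcQc : ∀ Q ∈ 𝓕, ‖cQ Q - c‖ₑ ≤ D := by
    intro Q hQ
    have h1 : ‖cQ Q - c'‖ₑ ≤ (C₀ + C₂ : ℝ≥0) := by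
      refine (ENNReal.mul_le_mul_iff_left (volume_cube_pos Q).ne' (volume_cube_ne_top Q)).1 ?_
      calc _ ≤ _ := enorm_sub_mul_volume_le hbm (cQ Q) c' (cube Q)
        _ ≤ C₀ * volume (cube Q) + volume B' :=
            add_le_add (hcQ Q) ((lintegral_mono_set (h𝓕B' Q hQ)).trans hc')
        _ ≤ C₀ * volume (cube Q) + C₂ * volume (cube Q) := by
            gcongr
            refine (measure_mono Metric.ball_subset_closedBall).trans (hC₂ Q x _ ?_)
            rw [hQ.1]; gcongr; exact hj.2
        _ = _ := by push_cast; ring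
    calc ‖cQ Q - c‖ₑ = ‖(cQ Q - c') + (c' - c)‖ₑ := by congr 1; ring
      _ ≤ _ := enorm_add_le _ _
      _ ≤ _ := add_le_add h1 hcc'
      _ = D := by simp [D]
  set e : ℝ≥0 := (Real.exp (a * D)).toNNReal
  have he : (e : ℝ) = Real.exp (a * D) := Real.coe_toNNReal _ (Real.exp_pos _).le
  have hkey := measure_biUnion_cube_le (𝓕 := 𝓕) (J := j + 1)
    (ν := volume.withDensity fun y => ENNReal.ofReal (Real.exp (a * |b y - c|)))
    (ρ := (e * 7 : ℝ≥0) • volume) (fun Q hQ => hQ.1.le) fun Q hQ => by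
      rw [withDensity_apply _ (measurableSet_cube Q)]
      have hpt : ∀ y, ENNReal.ofReal (Real.exp (a * |b y - c|)) ≤
          e * ENNReal.ofReal (Real.exp (a * |b y - cQ Q|)) := fun y => by
        rw [← ENNReal.ofReal_coe_nnreal, ← ENNReal.ofReal_mul (NNReal.coe_nonneg _)]
        refine ENNReal.ofReal_le_ofReal ?_
        rw [he, ← Real.exp_add, ← mul_add]
        refine Real.exp_le_exp.2 (mul_le_mul_of_nonneg_left ?_ ha.le)
        have h1 : |cQ Q - c| ≤ D := by
          have := hcQc Q hQ
          rw [← ofReal_norm, ← ENNReal.ofReal_coe_nnreal,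
            ENNReal.ofReal_le_ofReal_iff (NNReal.coe_nonneg _)] at this
          exact this
        have := abs_sub_le (b y) (cQ Q) c
        linarith
      refine (lintegral_mono hpt).trans ?_
      rw [lintegral_const_mul' _ _ ENNReal.coe_ne_top]
      have := lintegral_exp_le (g := fun y => b y - cQ Q) (hbm.sub
        aestronglyMeasurable_const).aemeasurable hL (measurableSet_cube Q)
        (fun m => hJN b hb.1 cQ hcQ m Q)
      calc _ ≤ e * (7 * volume (cube Q)) := by gcongr
        _ = _ := by
          rw [Measure.smul_apply, ENNReal.smul_def, smul_eq_mul]; push_cast; ring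
  rw [withDensity_apply _ (MeasurableSet.biUnion (Set.to_countable _)
    fun Q _ => measurableSet_cube Q)] at hkey
  refine (lintegral_mono_set hcov).trans (hkey.trans ?_)
  rw [Measure.smul_apply, ENNReal.smul_def, smul_eq_mul, ENNReal.coe_mul _ C₁, mul_assoc, ← hC₁ x r hr]
  gcongr
  exact Set.iUnion₂_subset h𝓕B'

end JohnNirenberg

/-! ### Young functions, Luxemburg norms and maximal operators -/

section Orlicz

variable {n : ℕ}

lemma young_inequality (A : ℝ≥0 → ℝ≥0) (s t : ℝ≥0) :
    ((s * t : ℝ≥0) : ℝ≥0∞) ≤ A t + complYoung A s := by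
  rw [← tsub_le_iff_left]
  exact le_iSup (fun t : ℝ≥0 => ((s * t : ℝ≥0) : ℝ≥0∞) - (A t : ℝ≥0∞)) t

lemma complYoung_mono (A : ℝ≥0 → ℝ≥0) : Monotone (complYoung A) := fun s s' h =>
  iSup_mono fun t => tsub_le_tsub_right (by gcongr) _

lemma complYoung_zero (A : ℝ≥0 → ℝ≥0) : complYoung A 0 = 0 := by simp [complYoung]

/-- A supremum of positive parts of affine functions of `s` is convex, even with infinite values. -/
lemma complYoung_convex (A : ℝ≥0 → ℝ≥0) {a b : ℝ≥0} (hab : a + b = 1) (s s' : ℝ≥0) :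
    complYoung A (a * s + b * s') ≤ a * complYoung A s + b * complYoung A s' := by
  refine iSup_le fun t => ?_
  rw [tsub_le_iff_left]
  calc (((a * s + b * s') * t : ℝ≥0) : ℝ≥0∞) = a * (s * t : ℝ≥0) + b * (s' * t : ℝ≥0) := by
        push_cast; ring
    _ ≤ a * (A t + complYoung A s) + b * (A t + complYoung A s') := by
        gcongr <;> exact young_inequality _ _ _
    _ = ((a + b : ℝ≥0) : ℝ≥0∞) * A t + (a * complYoung A s + b * complYoung A s') := by
        push_cast; ring
    _ = _ := by rw [hab, ENNReal.coe_one, one_mul]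

/-- If `A t₀ ≥ 1`, convexity and `A 0 = 0` give `A t ≥ t / t₀` for `t ≥ t₀`, so `ε = 1 / t₀` works.
It makes `M_Ā f` finite for bounded `f`. -/
lemma IsYoung.exists_complYoung_le_one {A : ℝ≥0 → ℝ≥0} (hA : IsYoung A) :
    ∃ ε : ℝ≥0, 0 < ε ∧ complYoung A ε ≤ 1 := by
  obtain ⟨t₀, ht₀, hAt⟩ := ((eventually_gt_atTop 0).and
    (hA.tendsto.eventually_ge_atTop 1)).exists
  refine ⟨t₀⁻¹, by positivity, iSup_le fun t => ?_⟩
  rcases le_total t t₀ with h | h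
  · refine tsub_le_self.trans ?_
    rw [← ENNReal.coe_one, ENNReal.coe_le_coe, inv_mul_le_iff₀ ht₀, mul_one]
    exact h
  · refine le_trans (le_of_eq (tsub_eq_zero_of_le ?_)) zero_le
    have ht : 0 < t := ht₀.trans_le h
    rw [ENNReal.coe_le_coe, inv_mul_le_iff₀ ht₀]
    have hle : t₀ / t ≤ 1 := div_le_one_of_le₀ h zero_le
    have := hA.convex.2 (Set.mem_univ t) (Set.mem_univ 0) (zero_le (a := t₀ / t))
      (zero_le (a := 1 - t₀ / t)) (add_tsub_cancel_of_le hle)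
    simp only [smul_eq_mul, mul_zero, add_zero, hA.map_zero, div_mul_cancel₀ _ ht.ne'] at this
    have h2 := hAt.trans this
    rw [div_mul_eq_mul_div, le_div_iff₀ ht, one_mul] at h2
    exact h2

/-- The dilation inequality for the complementary function, under submultiplicativity. -/
lemma Submultiplicative.exists_dilation_le {A : ℝ≥0 → ℝ≥0} (hfin : ∀ s, complYoung A s < ∞)
    (hsub : Submultiplicative (complYoung A)) {q : ℝ≥0} (hq : 1 < q) :
    ∃ θ : ℝ≥0, 0 < θ ∧ ∀ τ ≤ 1 + θ, ∀ t, complYoung A (τ * t) ≤ q * complYoung A t := by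
  obtain ⟨D, hD⟩ := hsub
  set E : ℝ≥0 := D * (complYoung A 2).toNNReal
  have hE : ∀ t, complYoung A (2 * t) ≤ E * complYoung A t := fun t => by
    refine (hD 2 t).trans (le_of_eq ?_)
    rw [ENNReal.coe_mul, ENNReal.coe_toNNReal (hfin 2).ne, mul_assoc]
  set θ := min 1 ((q - 1) / (E + 1))
  have hq' : 0 < q - 1 := tsub_pos_of_lt hq
  refine ⟨θ, lt_min one_pos (by positivity), fun τ hτ t => ?_⟩
  -- Convexity between `t` and `2 t`, with the doubling constant `E` from submultiplicativity, gives
  -- the factor `1 + θ E`, and `θ` is chosen to make this at most `q`.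
  have h1 : τ * t ≤ (1 - θ) * t + θ * (2 * t) := by
    calc τ * t ≤ (1 + θ) * t := by gcongr
      _ = ((1 - θ + θ) + θ) * t := by rw [tsub_add_cancel_of_le (min_le_left _ _)]
      _ = _ := by ring
  calc complYoung A (τ * t) ≤ _ := complYoung_mono A h1
    _ ≤ (1 - θ : ℝ≥0) * complYoung A t + θ * complYoung A (2 * t) :=
        complYoung_convex A (tsub_add_cancel_of_le (min_le_left _ _)) _ _
    _ ≤ (1 : ℝ≥0) * complYoung A t + θ * (E * complYoung A t) := by
        gcongr
        · exact tsub_le_self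
        · exact hE t
    _ = (1 + θ * E : ℝ≥0) * complYoung A t := by push_cast; ring
    _ ≤ _ := by
        gcongr
        calc 1 + θ * E ≤ 1 + (q - 1) / (E + 1) * (E + 1) := by
              gcongr
              · exact min_le_right _ _
              · exact le_self_add
          _ = q := by
              rw [div_mul_cancel₀ _ (by positivity), add_tsub_cancel_of_le hq.le]

lemma le_youngInv {Φ : ℝ≥0 → ℝ≥0∞} (hΦ : Monotone Φ) {s t : ℝ≥0} (h : Φ s ≤ t) :
    (s : ℝ≥0∞) ≤ youngInv Φ t :=
  le_iInf₂ fun r hr => by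
    rw [ENNReal.coe_le_coe]
    by_contra! hlt
    exact absurd (hr.trans_le (hΦ hlt.le)) (not_lt.2 h)

/-- The pointwise form of the generalized Hölder inequality with the exponential function. -/
lemma mul_mul_pow_le {k : ℕ} {A B : ℝ≥0 → ℝ≥0} (hB : IsYoung B)
    (hAB : ∀ t : ℝ≥0, 1 ≤ t → youngInv (complYoung A) t * youngInv (toGauge B) t *
        ENNReal.ofReal (Real.log t ^ k) ≤ t) (u v : ℝ≥0) {q : ℝ} (hq : 0 ≤ q) :
    (u : ℝ≥0∞) * v * ENNReal.ofReal (q ^ k) ≤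
      B v + (complYoung A u + ENNReal.ofReal (Real.exp q)) := by
  by_cases hu : complYoung A u = ∞
  · simp [hu]
  -- At this `t` each of `u`, `v`, `q` is bounded by the corresponding inverse function or
  -- logarithm, and `exp q ≥ 1` places `t` in the range of the hypothesis. The maximum is then
  -- bounded by the sum.
  set t : ℝ≥0 := max (max (complYoung A u).toNNReal (B v)) (Real.exp q).toNNReal
  have hexp : (Real.exp q).toNNReal ≤ t := le_max_right _ _
  have ht1 : 1 ≤ t := by
    refine le_trans ?_ hexp
    rw [← Real.toNNReal_one]
    exact Real.toNNReal_le_toNNReal (Real.one_le_exp hq)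
  have h1 : (u : ℝ≥0∞) ≤ youngInv (complYoung A) t := le_youngInv (complYoung_mono A) (by
    rw [← ENNReal.coe_toNNReal hu, ENNReal.coe_le_coe]
    exact (le_max_left _ _).trans (le_max_left _ _))
  have h2 : (v : ℝ≥0∞) ≤ youngInv (toGauge B) t := le_youngInv
    (fun a b hab => ENNReal.coe_le_coe.2 (hB.monotone hab))
    (ENNReal.coe_le_coe.2 ((le_max_right _ _).trans (le_max_left _ _)))
  have h3 : q ≤ Real.log t := by
    rw [Real.le_log_iff_exp_le (by exact_mod_cast lt_of_lt_of_le one_pos ht1)]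
    exact Real.toNNReal_le_iff_le_coe.1 hexp
  calc _ ≤ youngInv (complYoung A) t * youngInv (toGauge B) t *
          ENNReal.ofReal (Real.log t ^ k) := by gcongr
    _ ≤ t := hAB t ht1
    _ ≤ ((complYoung A u).toNNReal + B v + (Real.exp q).toNNReal : ℝ≥0) := by
        rw [ENNReal.coe_le_coe]
        refine max_le (max_le ?_ ?_) le_add_self
        · rw [add_assoc]; exact le_self_add
        · exact le_add_right le_add_self
    _ = _ := by
        rw [ENNReal.coe_add, ENNReal.coe_add, ENNReal.coe_toNNReal hu, ENNReal.ofReal]; ring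

lemma IsYoung.exists_pos_le_one {B : ℝ≥0 → ℝ≥0} (hB : IsYoung B) : ∃ β : ℝ≥0, 0 < β ∧ B β ≤ 1 := by
  have h : ∀ᶠ s in 𝓝 (0 : ℝ≥0), B s < 1 :=
    hB.continuous.continuousAt.eventually (gt_mem_nhds (by rw [hB.map_zero]; exact one_pos))
  obtain ⟨β, hβ, hpos⟩ := ((h.filter_mono nhdsWithin_le_nhds).and
    (self_mem_nhdsWithin (a := (0 : ℝ≥0)) (s := Set.Ioi 0))).exists
  exact ⟨β, hpos, hβ.le⟩

lemma avg_le_one_iff {S : Set (Rn n)} (h0 : volume S ≠ 0) (ht : volume S ≠ ∞)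
    (g : Rn n → ℝ≥0∞) : avg S g ≤ 1 ↔ ∫⁻ y in S, g y ≤ volume S := by
  rw [avg, mul_comm, ← div_eq_mul_inv, ENNReal.div_le_iff h0 ht, one_mul]

/-- Strictness yields an admissible value below `μ` in the Luxemburg infimum, so `μ` itself is
admissible by monotonicity; attainment of the infimum plays no role. -/
lemma lintegral_le_of_youngMaximal_lt {Φ : ℝ≥0 → ℝ≥0∞} (hΦ : Monotone Φ) {f : Rn n → ℝ}
    {x : Rn n} {μ : ℝ≥0} (h : youngMaximal Φ f x < μ) {c : Rn n} {r : ℝ}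
    (hx : x ∈ Metric.ball c r) :
    ∫⁻ y in Metric.ball c r, Φ (‖f y‖₊ / μ) ≤ volume (Metric.ball c r) := by
  have h1 : luxNorm Φ (Metric.ball c r) (fun y => ‖f y‖₊) < μ := by
    refine lt_of_le_of_lt ?_ h
    refine le_iSup_of_le c (le_iSup_of_le r ?_)
    exact le_iSup (fun _ : x ∈ Metric.ball c r =>
      luxNorm Φ (Metric.ball c r) (fun y => ‖f y‖₊)) hx
  simp only [luxNorm, iInf_lt_iff] at h1
  obtain ⟨s, hs, havg, hlt⟩ := h1
  rw [ENNReal.coe_lt_coe] at hlt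
  have hr : 0 < r := Metric.pos_of_mem_ball hx
  rw [avg_le_one_iff (Metric.measure_ball_pos _ _ hr).ne' measure_ball_lt_top.ne] at havg
  refine le_trans (lintegral_mono fun y => hΦ ?_) havg
  gcongr

lemma youngMaximal_le {Φ : ℝ≥0 → ℝ≥0∞} (hΦ : Monotone Φ) {ε : ℝ≥0} (hε : 0 < ε) (h : Φ ε ≤ 1)
    {f : Rn n → ℝ} {M : ℝ≥0} (hM : 0 < M) (hf : ∀ᵐ x, ‖f x‖₊ ≤ M) (x : Rn n) :
    youngMaximal Φ f x ≤ (M / ε : ℝ≥0) := by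
  refine iSup_le fun c => iSup_le fun r => iSup_le fun hx => ?_
  have hr : 0 < r := Metric.pos_of_mem_ball hx
  refine iInf_le_of_le (M / ε) (iInf_le_of_le (by positivity) (iInf_le_of_le ?_ le_rfl))
  rw [avg_le_one_iff (Metric.measure_ball_pos _ _ hr).ne' measure_ball_lt_top.ne, ← setLIntegral_one]
  refine lintegral_mono_ae (ae_restrict_of_ae (hf.mono fun y hy => (hΦ ?_).trans h))
  rw [div_le_iff₀ (by positivity), mul_div_cancel₀ _ hε.ne']
  exact hy

lemma isOpen_lt_youngMaximal (Φ : ℝ≥0 → ℝ≥0∞) (f : Rn n → ℝ) (t : ℝ≥0∞) :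
    IsOpen {x | t < youngMaximal Φ f x} := by
  rw [isOpen_iff_mem_nhds]
  intro x hx
  simp only [youngMaximal, Set.mem_ofPred_eq, lt_iSup_iff] at hx
  obtain ⟨c, r, hxr, hlt⟩ := hx
  filter_upwards [Metric.isOpen_ball.mem_nhds hxr] with y hy
  exact hlt.trans_le (le_iSup_of_le c (le_iSup_of_le r (le_iSup_of_le hy le_rfl)))

lemma measurable_youngMaximal (Φ : ℝ≥0 → ℝ≥0∞) (f : Rn n → ℝ) : Measurable (youngMaximal Φ f) :=
  measurable_of_Ioi fun t => (isOpen_lt_youngMaximal Φ f t).measurableSet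

/-- The weak type inequality for `M_Φ` with respect to a pair of weights `(w, M w)`. -/
lemma withDensity_youngMaximal_le (hn : 1 ≤ n) (Φ : ℝ≥0 → ℝ≥0∞) (w f : Rn n → ℝ)
    {t : ℝ≥0} (ht : 0 < t) (hfin : ∫⁻ x, Φ (‖f x‖₊ / t) ≠ ∞) :
    volume.withDensity (fun x => ENNReal.ofReal (w x)) {x | (t : ℝ≥0∞) < youngMaximal Φ f x} ≤
      5 ^ n * ∫⁻ x, Φ (‖f x‖₊ / t) * hlMaximal w x := by
  set g : Rn n → ℝ≥0∞ := fun x => Φ (‖f x‖₊ / t)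
  -- Balls where `Φ(|f|/t)` has mean at least 1 cover the level set. Their volumes are at most the
  -- total integral, so their radii are bounded, as Vitali's covering lemma requires.
  set T : Set (Rn n × ℝ) := {p | 0 < p.2 ∧
    volume (Metric.ball p.1 p.2) ≤ ∫⁻ y in Metric.ball p.1 p.2, g y}
  obtain ⟨R, hR⟩ : ∃ R : ℝ, ∀ p ∈ T, p.2 ≤ R := by
    set V := volume (Metric.ball (0 : Rn n) 1)
    have hV0 : V ≠ 0 := (Metric.measure_ball_pos _ _ one_pos).ne'
    refine ⟨max 1 ((∫⁻ x, g x) / V).toReal, fun p hp => ?_⟩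
    rcases le_total p.2 1 with h1 | h1
    · exact h1.trans (le_max_left _ _)
    refine le_trans ?_ (le_max_right _ _)
    have h2 : ENNReal.ofReal (p.2 ^ n) * V ≤ ∫⁻ x, g x := by
      have := hp.2.trans (setLIntegral_le_lintegral _ _)
      rwa [Measure.addHaar_ball_of_pos _ _ hp.1, finrank_euclideanSpace_fin] at this
    rw [← ENNReal.le_div_iff_mul_le (.inl hV0) (.inl measure_ball_lt_top.ne),
      ENNReal.ofReal_le_iff_le_toReal (ENNReal.div_ne_top hfin hV0)] at h2
    exact (le_self_pow₀ h1 (by omega)).trans h2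
  obtain ⟨U, hUT, hdisj, hcov⟩ := Vitali.exists_disjoint_subfamily_covering_enlargement_ball T
    (fun p => p.1) (fun p => p.2) R hR 5 (by norm_num)
  have hUc : U.Countable := hdisj.countable_of_isOpen (fun p _ => Metric.isOpen_ball)
    fun p hp => Metric.nonempty_ball.2 (hUT hp).1
  have hsub : {x | (t : ℝ≥0∞) < youngMaximal Φ f x} ⊆ ⋃ p ∈ U, Metric.ball p.1 (5 * p.2) := by
    intro x hx
    simp only [youngMaximal, Set.mem_ofPred_eq, lt_iSup_iff] at hx
    obtain ⟨c, r, hxr, hlt⟩ := hx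
    have hr : 0 < r := Metric.pos_of_mem_ball hxr
    have hmem : (c, r) ∈ T := by
      refine ⟨hr, ?_⟩
      by_contra! hcon
      refine absurd hlt (not_lt.2 ?_)
      refine iInf_le_of_le t (iInf_le_of_le ht (iInf_le_of_le ?_ le_rfl))
      rw [avg_le_one_iff (Metric.measure_ball_pos _ _ hr).ne' measure_ball_lt_top.ne]
      exact hcon.le
    obtain ⟨p, hp, hsub⟩ := hcov _ hmem
    exact Set.mem_biUnion hp (hsub hxr)
  calc _ ≤ ∑' p : U, volume.withDensity (fun x => ENNReal.ofReal (w x))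
          (Metric.ball p.1.1 (5 * p.1.2)) :=
        (measure_mono hsub).trans (measure_biUnion_le _ hUc _)
    _ ≤ ∑' p : U, 5 ^ n * ∫⁻ y in Metric.ball p.1.1 p.1.2, g y * hlMaximal w y := by
        refine ENNReal.tsum_le_tsum fun p => ?_
        obtain ⟨hp0, hp⟩ := hUT p.2
        set B := Metric.ball p.1.1 p.1.2
        set B' := Metric.ball p.1.1 (5 * p.1.2)
        have hvol : volume B' = 5 ^ n * volume B := by
          rw [Measure.addHaar_ball_of_pos _ _ (by positivity), Measure.addHaar_ball_of_pos _ _ hp0,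
            finrank_euclideanSpace_fin, mul_pow, ENNReal.ofReal_mul (by positivity), mul_assoc,
            ENNReal.ofReal_pow (by norm_num)]
          simp
        have hB'0 : volume B' ≠ 0 := (Metric.measure_ball_pos _ _ (by positivity)).ne'
        set a := avg B' (fun y => ‖w y‖ₑ)
        have h1 : volume.withDensity (fun x => ENNReal.ofReal (w x)) B' ≤ volume B' * a := by
          rw [withDensity_apply _ measurableSet_ball]
          simp only [a]
          rw [avg, ← mul_assoc, ENNReal.mul_inv_cancel hB'0 measure_ball_lt_top.ne, one_mul]
          exact lintegral_mono fun y => Real.ofReal_le_enorm _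
        -- The fivefold ball contains each `y ∈ B`, so its mean of `|w|` is one of the competitors
        -- in `Mw(y)`.
        have h2 : ∀ y ∈ B, a ≤ hlMaximal w y := fun y hy =>
          le_iSup_of_le p.1.1 (le_iSup_of_le (5 * p.1.2) (le_iSup_of_le
            (Metric.ball_subset_ball (by linarith) hy) le_rfl))
        refine h1.trans ?_
        rw [hvol, mul_assoc]
        gcongr
        calc volume B * a ≤ (∫⁻ y in B, g y) * a := by gcongr
          _ ≤ ∫⁻ y in B, g y * a := lintegral_mul_const_le _ _
          _ ≤ _ := setLIntegral_mono' measurableSet_ball fun y hy => by gcongr; exact h2 y hy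
    _ = 5 ^ n * ∫⁻ y in ⋃ p ∈ U, Metric.ball p.1 p.2, g y * hlMaximal w y := by
        rw [ENNReal.tsum_mul_left, lintegral_biUnion hUc (fun p _ => measurableSet_ball) hdisj]
    _ ≤ _ := mul_le_mul_right (setLIntegral_le_lintegral _ _) _

/-- Hölder's inequality on an annulus. -/
lemma lintegral_annulus_le {Φ : ℝ≥0 → ℝ≥0∞} {s : ℝ} (hs : 0 < s) {g : Rn n → ℝ≥0}
    {ψ : Rn n → ℝ≥0∞} {G : Rn n → ℝ≥0∞} {C : ℝ≥0} (hG : AEMeasurable G volume)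
    (hψ : ∀ v y, v * ψ y ≤ Φ v + G y)
    (hGC : ∫⁻ y in Metric.ball 0 (2 * s), G y ≤ C * volume (Metric.ball (0 : Rn n) (2 * s))) :
    ∫⁻ y in {y | s < ‖y‖ ∧ ‖y‖ ≤ 2 * s}, g y * ψ y ≤
      (1 + C) * volume (Metric.ball (0 : Rn n) (2 * s)) * luxAnnulus Φ s g := by
  set S : Set (Rn n) := {y | s < ‖y‖ ∧ ‖y‖ ≤ 2 * s}
  set B := Metric.ball (0 : Rn n) (2 * s)
  have hB0 : volume B ≠ 0 := (Metric.measure_ball_pos _ _ (by positivity)).ne'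
  have hBt : volume B ≠ ∞ := measure_ball_lt_top.ne
  have hS : MeasurableSet S := (measurableSet_lt measurable_const measurable_norm).inter
    (measurableSet_le measurable_norm measurable_const)
  -- The annulus leaves the open ball only along the null sphere `‖y‖ = 2 s`.
  have hSB : volume.restrict S ≤ volume.restrict B := by
    refine Measure.restrict_mono_ae ?_
    have : ∀ᵐ y : Rn n, y ∉ Metric.sphere (0 : Rn n) (2 * s) :=
      measure_eq_zero_iff_ae_notMem.1 (Measure.addHaar_sphere_of_ne_zero _ _ (by positivity))
    filter_upwards [this] with y hy hyS
    have h1 : ‖y‖ ≠ 2 * s := by simpa using hy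
    exact mem_ball_zero_iff.2 (lt_of_le_of_ne hyS.2 h1)
  have hle : ∫⁻ y in S, g y * ψ y ≤ ∫⁻ y in B, S.indicator g y * ψ y := by
    refine le_trans (le_of_eq (setLIntegral_congr_fun hS fun y hy => ?_)) (lintegral_mono' hSB le_rfl)
    rw [Set.indicator_of_mem hy]
  refine hle.trans ?_
  rw [luxAnnulus, luxNorm]
  have key : ∀ r : ℝ≥0, 0 < r → avg B (fun y => Φ (S.indicator g y / r)) ≤ 1 →
      ∫⁻ y in B, S.indicator g y * ψ y ≤ (1 + C) * volume B * r := by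
    intro r hr havg
    rw [avg_le_one_iff hB0 hBt] at havg
    calc _ = ∫⁻ y in B, r * ((S.indicator g y / r : ℝ≥0) * ψ y) := by
          refine lintegral_congr fun y => ?_
          rw [← mul_assoc, ← ENNReal.coe_mul, mul_div_cancel₀ _ hr.ne']
      _ = r * ∫⁻ y in B, ((S.indicator g y / r : ℝ≥0) * ψ y) :=
          lintegral_const_mul' _ _ ENNReal.coe_ne_top
      _ ≤ r * ∫⁻ y in B, (Φ (S.indicator g y / r) + G y) := by
          gcongr with y; exact hψ _ _
      _ = r * ((∫⁻ y in B, Φ (S.indicator g y / r)) + ∫⁻ y in B, G y) := by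
          rw [lintegral_add_right' _ hG.restrict]
      _ ≤ r * (volume B + C * volume B) := by gcongr
      _ = _ := by ring
  have hK0 : (1 + C) * volume B ≠ 0 := mul_ne_zero (by simp) hB0
  have hKt : (1 + C) * volume B ≠ ∞ := by finiteness
  rw [ENNReal.mul_iInf_of_ne hK0 hKt]
  refine le_iInf fun r => ?_
  rw [ENNReal.mul_iInf_of_ne hK0 hKt]
  refine le_iInf fun hr => ?_
  rw [ENNReal.mul_iInf_of_ne hK0 hKt]
  exact le_iInf fun havg => key r hr havg

end Orlicz

/-! ### Principal values and singular integrals -/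

section PrincipalValues

variable {n : ℕ} {X : Type*} [NormedAddCommGroup X] [NormedSpace ℝ X] [MonotoneSequenceSpace X]

/-- The coordinates are continuous functionals. -/
lemma exists_coord_continuousLinearMap (X : Type*) [NormedAddCommGroup X] [NormedSpace ℝ X]
    [MonotoneSequenceSpace X] (l : ℤ) : ∃ L : X →L[ℝ] ℝ, ∀ v, L v = coord v l := by
  by_cases h : ∀ v : X, coord v l = 0
  · exact ⟨0, fun v => by simp [h v]⟩
  push Not at h
  obtain ⟨v₀, hv₀⟩ := h
  -- Solidity allows all coordinates but one to be erased without increasing the norm, whence `|v_l|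
  -- ‖e_l‖ ≤ ‖v‖` for the unit sequence `e_l`.
  have hsingle : ∀ v : X, ∃ u : X, coord u = Pi.single l (coord v l) ∧ ‖u‖ ≤ ‖v‖ := fun v =>
    MonotoneSequenceSpace.solid v _ fun m => by
      by_cases hm : m = l
      · subst hm; simp
      · simp [hm]
  obtain ⟨u, hu, -⟩ := hsingle v₀
  set e := (coord v₀ l)⁻¹ • u
  have he : coord e = Pi.single l 1 := by
    simp only [e, map_smul, hu]
    rw [← Pi.single_smul, smul_eq_mul, inv_mul_cancel₀ hv₀]
  have he0 : 0 < ‖e‖ := by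
    rw [norm_pos_iff]
    intro h0
    have := congrFun he l
    simp [h0] at this
  refine ⟨LinearMap.mkContinuous ((LinearMap.proj l).comp (coord (X := X))) ‖e‖⁻¹ fun v => ?_,
    fun v => rfl⟩
  obtain ⟨u', hu', hle⟩ := hsingle v
  have : u' = coord v l • e := MonotoneSequenceSpace.coord_injective (by
    rw [hu', map_smul, he, ← Pi.single_smul, smul_eq_mul, mul_one])
  rw [this, norm_smul] at hle
  rw [inv_mul_eq_div, le_div_iff₀ he0]
  exact hle

lemma HasPV.unique {h : Rn n → ℝ} {x : Rn n} {v v' : ℝ} (hv : HasPV h x v) (hv' : HasPV h x v') :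
    v = v' := tendsto_nhds_unique hv.2 hv'.2

lemma HasPV.add {h h' : Rn n → ℝ} {x : Rn n} {v v' : ℝ} (hv : HasPV h x v) (hv' : HasPV h' x v') :
    HasPV (fun y => h y + h' y) x (v + v') := by
  refine ⟨fun ε hε => (hv.1 ε hε).add (hv'.1 ε hε), (hv.2.add hv'.2).congr' ?_⟩
  filter_upwards [self_mem_nhdsWithin] with ε hε
  exact (integral_add (hv.1 ε hε) (hv'.1 ε hε)).symm

lemma HasPV.const_mul {h : Rn n → ℝ} {x : Rn n} {v : ℝ} (hv : HasPV h x v) (c : ℝ) :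
    HasPV (fun y => c * h y) x (c * v) := by
  refine ⟨fun ε hε => (hv.1 ε hε).const_mul c, (hv.2.const_mul c).congr fun ε => ?_⟩
  exact (integral_const_mul _ _).symm

lemma hasPV_zero (x : Rn n) : HasPV (fun _ => 0) x 0 := by
  refine ⟨fun ε _ => integrableOn_zero, ?_⟩
  simp

lemma HasPV.sum {ι : Type*} {s : Finset ι} {h : ι → Rn n → ℝ} {x : Rn n} {v : ι → ℝ}
    (hv : ∀ i ∈ s, HasPV (h i) x (v i)) : HasPV (fun y => ∑ i ∈ s, h i y) x (∑ i ∈ s, v i) := by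
  classical
  induction s using Finset.induction_on with
  | empty => simpa using hasPV_zero x
  | insert i s hi ih =>
    simp only [Finset.sum_insert hi]
    exact (hv i (Finset.mem_insert_self _ _)).add
      (ih fun j hj => hv j (Finset.mem_insert_of_mem hj))

/-- Away from the support of the integrand the principal value is an ordinary integral. -/
lemma HasPV.integrable_and_eq {h : Rn n → ℝ} {x : Rn n} {v δ : ℝ} (hv : HasPV h x v) (hδ : 0 < δ)
    (h0 : ∀ y, ‖x - y‖ < δ → h y = 0) : Integrable h volume ∧ v = ∫ y, h y := by
  have hsupp : ∀ ε < δ, Function.support h ⊆ {y | ε < ‖x - y‖} := fun ε hε y hy => by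
    by_contra hcon
    exact hy (h0 y ((not_lt.1 hcon).trans_lt hε))
  refine ⟨(integrableOn_iff_integrable_of_support_subset (hsupp (δ / 2) (by linarith))).1
    (hv.1 _ (by positivity)), tendsto_nhds_unique hv.2 (tendsto_const_nhds.congr' ?_)⟩
  filter_upwards [Ioo_mem_nhdsGT hδ] with ε hε
  exact (setIntegral_eq_integral_of_forall_compl_eq_zero fun y hy => by
    by_contra hne
    exact hy (hsupp ε hε.2 hne)).symm

lemma IsSingularIntegralValue.unique {K : Rn n → X} {f : Rn n → ℝ} {x : Rn n} {v v' : X}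
    (hv : IsSingularIntegralValue K f x v) (hv' : IsSingularIntegralValue K f x v') : v = v' :=
  MonotoneSequenceSpace.coord_injective (funext fun l => (hv l).unique (hv' l))

lemma IsSingularIntegralValue.add {K : Rn n → X} {f f' : Rn n → ℝ} {x : Rn n} {v v' : X}
    (hv : IsSingularIntegralValue K f x v) (hv' : IsSingularIntegralValue K f' x v') :
    IsSingularIntegralValue K (f + f') x (v + v') := fun l => by
  have := (hv l).add (hv' l)
  simpa only [map_add, Pi.add_apply, mul_add] using this

lemma IsSingularIntegralValue.smul {K : Rn n → X} {f : Rn n → ℝ} {x : Rn n} {v : X}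
    (hv : IsSingularIntegralValue K f x v) (c : ℝ) :
    IsSingularIntegralValue K (c • f) x (c • v) := fun l => by
  have := (hv l).const_mul c
  simpa only [map_smul, Pi.smul_apply, smul_eq_mul, mul_left_comm] using this

lemma IsSingularIntegralValue.sub {K : Rn n → X} {f f' : Rn n → ℝ} {x : Rn n} {v v' : X}
    (hv : IsSingularIntegralValue K f x v) (hv' : IsSingularIntegralValue K f' x v') :
    IsSingularIntegralValue K (f - f') x (v - v') := by
  have := hv.add (hv'.smul (-1))
  simpa only [neg_smul, one_smul, ← sub_eq_add_neg] using this

lemma IsSingularIntegralValue.sum {K : Rn n → X} {ι : Type*} {s : Finset ι} {f : ι → Rn n → ℝ}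
    {x : Rn n} {v : ι → X} (hv : ∀ i ∈ s, IsSingularIntegralValue K (f i) x (v i)) :
    IsSingularIntegralValue K (∑ i ∈ s, f i) x (∑ i ∈ s, v i) := fun l => by
  have := HasPV.sum (s := s) fun i hi => hv i hi l
  simpa only [map_sum, Finset.sum_apply, Finset.mul_sum] using this

/-- The strong type inequality holds for every version of `T f`. -/
lemma IsSingularIntegralKernel.exists_eLpNorm_le {K : Rn n → X} (hK : IsSingularIntegralKernel K) :
    ∃ p : ℝ, 1 < p ∧ ∃ C : ℝ≥0, ∀ f : Rn n → ℝ, MemLp f (ENNReal.ofReal p) volume →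
      HasCompactSupport f → (∃ F : Rn n → X, ∀ᵐ x, IsSingularIntegralValue K f x (F x)) ∧
        ∀ F : Rn n → X, (∀ᵐ x, IsSingularIntegralValue K f x (F x)) →
          MemLp F (ENNReal.ofReal p) volume ∧
          eLpNorm F (ENNReal.ofReal p) volume ≤ C * eLpNorm f (ENNReal.ofReal p) volume := by
  obtain ⟨p, hp, C, h⟩ := hK.strong_type
  refine ⟨p, hp, C, fun f hf hfc => ?_⟩
  obtain ⟨F₀, hm, hv, hle⟩ := h f hf hfc
  refine ⟨⟨F₀, hv⟩, fun F hF => ?_⟩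
  have hae : F =ᵐ[volume] F₀ := by
    filter_upwards [hv, hF] with x h1 h2 using h2.unique h1
  have hle' : eLpNorm F (ENNReal.ofReal p) volume ≤ C * eLpNorm f (ENNReal.ofReal p) volume := by
    rwa [eLpNorm_congr_ae hae]
  exact ⟨⟨hm.congr hae.symm, hle'.trans_lt (ENNReal.mul_lt_top (by simp) hf.2)⟩, hle'⟩

/-- The annuli of the Hörmander conditions start at `m = 1`, hence the region `‖z‖ > 2 R`. -/
lemma lintegral_far_le {R : ℝ} (hR : 0 < R) (g : Rn n → ℝ≥0∞) :
    ∫⁻ z in {z | 2 * R < ‖z‖}, g z ≤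
      ∑' m : ℕ+, ∫⁻ z in {z | 2 ^ (m : ℕ) * R < ‖z‖ ∧ ‖z‖ ≤ 2 * (2 ^ (m : ℕ) * R)}, g z := by
  refine le_trans (lintegral_mono_set fun z hz => ?_) (lintegral_iUnion_le _ _)
  have hz' : 2 * R < ‖z‖ := hz
  have hzR : 2 < ‖z‖ / R := by rwa [lt_div_iff₀ hR]
  obtain ⟨j, hj⟩ := exists_mem_Ioc_zpow (by linarith : 0 < ‖z‖ / R) (one_lt_two (α := ℝ))
  have hj1 : 1 ≤ j := by
    by_contra! hlt
    have : (2 : ℝ) ^ (j + 1) ≤ 2 ^ (1 : ℤ) := zpow_le_zpow_right₀ one_le_two (by omega)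
    rw [zpow_one] at this
    linarith [hj.2]
  obtain ⟨m, rfl⟩ := Int.eq_ofNat_of_zero_le (by omega : 0 ≤ j)
  have hm : 0 < m := by omega
  rw [zpow_natCast, ← Nat.cast_succ, zpow_natCast, Set.mem_Ioc, lt_div_iff₀ hR, div_le_iff₀ hR,
    pow_succ] at hj
  exact Set.mem_iUnion.2 ⟨⟨m, hm⟩, hj.1, by simpa [mul_comm, mul_left_comm, mul_assoc] using hj.2⟩

lemma volume_ball_two_mul {s : ℝ} (hs : 0 < s) : volume (Metric.ball (0 : Rn n) (2 * s)) =
    2 ^ n * volume (Metric.ball (0 : Rn n) 1) * ENNReal.ofReal (s ^ n) := by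
  rw [Measure.addHaar_ball_of_pos _ _ (by positivity), finrank_euclideanSpace_fin, mul_pow,
    ENNReal.ofReal_mul (by positivity), ENNReal.ofReal_pow (by norm_num)]
  simp only [ENNReal.ofReal_ofNat]
  ring

/-- The Hörmander condition in integral form. -/
lemma HormanderClass.exists_lintegral_le {Y : Type*} [NormedAddCommGroup Y] {K : Rn n → Y}
    (hK : HormanderClass (toGauge id) 0 K) :
    ∃ c : ℝ, 1 < c ∧ ∃ C : ℝ≥0, ∀ (h : Rn n) (R : ℝ), c * ‖h‖ < R →
      ∫⁻ z in {z | 2 * R < ‖z‖}, ‖K (z - h) - K z‖ₑ ≤ C := by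
  obtain ⟨c, hc, C, hC⟩ := hK
  set V := volume (Metric.ball (0 : Rn n) 1)
  have hV : V ≠ ∞ := measure_ball_lt_top.ne
  refine ⟨c, hc, 2 ^ n * V.toNNReal * C, fun h R hR => ?_⟩
  have hR0 : 0 < R := lt_of_le_of_lt (by positivity) hR
  refine (lintegral_far_le hR0 _).trans ?_
  calc _ ≤ ∑' m : ℕ+, 2 ^ n * V * (ENNReal.ofReal ((2 ^ (m : ℕ) * R) ^ n) * ((m : ℕ) : ℝ≥0∞) ^ 0 *
        luxAnnulus (toGauge id) (2 ^ (m : ℕ) * R) (fun y => ‖K (y - h) - K y‖₊)) := by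
        refine ENNReal.tsum_le_tsum fun m => ?_
        have hs : 0 < 2 ^ (m : ℕ) * R := by positivity
        have := lintegral_annulus_le (n := n) (Φ := toGauge id) hs
          (g := fun y => ‖K (y - h) - K y‖₊) (ψ := fun _ => 1) (G := fun _ => 0) (C := 0)
          aemeasurable_const (fun v _ => by simp [toGauge]) (by simp)
        rw [volume_ball_two_mul hs] at this
        simp only [mul_one, ENNReal.coe_zero, add_zero, one_mul, enorm_eq_nnnorm] at this ⊢
        refine this.trans (le_of_eq ?_)
        rw [pow_zero, mul_one]; ring
    _ ≤ 2 ^ n * V * C := by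
        rw [ENNReal.tsum_mul_left]
        gcongr
        exact hC h R hR
    _ = _ := by
        push_cast; rw [ENNReal.coe_toNNReal hV]

end PrincipalValues

/-! ### The weak type (1,1) inequality -/

section WeakType

variable {n : ℕ} {X : Type*} [NormedAddCommGroup X] [NormedSpace ℝ X] [CompleteSpace X]
  [MonotoneSequenceSpace X]

/-- Pointwise bound for a singular integral of a function with mean zero, away from its support. -/
lemma IsSingularIntegralValue.enorm_le_lintegral {K : Rn n → X} (hK : AEStronglyMeasurable K volume)
    {β : Rn n → ℝ} (hβ : Integrable β volume) (hβ0 : ∫ y, β y = 0) {x : Rn n} {δ : ℝ} (hδ : 0 < δ)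
    (hsupp : ∀ y, ‖x - y‖ < δ → β y = 0) (y₀ : Rn n) {v : X}
    (hv : IsSingularIntegralValue K β x v) :
    ‖v‖ₑ ≤ ∫⁻ y, ‖K (x - y) - K (x - y₀)‖ₑ * ‖β y‖ₑ := by
  set G : Rn n → X := fun y => β y • (K (x - y) - K (x - y₀))
  have hGe : ∀ y, ‖G y‖ₑ = ‖K (x - y) - K (x - y₀)‖ₑ * ‖β y‖ₑ := fun y => by
    simp only [G]; rw [enorm_smul, mul_comm]
  by_cases htop : ∫⁻ y, ‖K (x - y) - K (x - y₀)‖ₑ * ‖β y‖ₑ = ∞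
  · rw [htop]; exact le_top
  have hG : Integrable G volume := by
    refine ⟨hβ.aestronglyMeasurable.smul ((hK.comp_quasiMeasurePreserving
      (quasiMeasurePreserving_sub_left_of_right_invariant volume x)).sub
      aestronglyMeasurable_const), ?_⟩
    rw [hasFiniteIntegral_iff_enorm, lintegral_congr hGe]
    exact lt_top_iff_ne_top.2 htop
  -- The mean zero of `β` allows `K (x - y₀)` to be subtracted. The coordinates, being continuous
  -- functionals, identify the principal values with those of a Bochner integral in `X`.
  have hvG : v = ∫ y, G y := by
    refine MonotoneSequenceSpace.coord_injective (funext fun l => ?_)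
    obtain ⟨L, hL⟩ := exists_coord_continuousLinearMap X l
    obtain ⟨hint, heq⟩ := (hv l).integrable_and_eq hδ fun y hy => by rw [hsupp y hy, mul_zero]
    rw [heq, ← hL, ← L.integral_comp_comm hG]
    have : ∀ y, L (G y) = coord (K (x - y)) l * β y - coord (K (x - y₀)) l * β y := fun y => by
      simp only [G, hL, map_smul, map_sub, Pi.smul_apply, Pi.sub_apply, smul_eq_mul]; ring
    simp_rw [this]
    rw [integral_sub hint (hβ.const_mul _), integral_const_mul, hβ0, mul_zero, sub_zero]
  rw [hvG, ← lintegral_congr hGe]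
  exact enorm_integral_le_lintegral_enorm _

/-- The integral estimate for a singular integral of a function with mean zero, away from its
support. -/
lemma lintegral_singularIntegral_le {K : Rn n → X} (hK : AEStronglyMeasurable K volume)
    {c : ℝ} (hc : 1 < c) {C : ℝ≥0} (hKC : ∀ (h : Rn n) (R : ℝ), c * ‖h‖ < R →
      ∫⁻ z in {z | 2 * R < ‖z‖}, ‖K (z - h) - K z‖ₑ ≤ C)
    {β : Rn n → ℝ} (hβ : Integrable β volume) (hβ0 : ∫ y, β y = 0) {y₀ : Rn n} {R : ℝ} (hR : 0 < R)
    (hsupp : ∀ y, R ≤ c * ‖y - y₀‖ → β y = 0) {F : Rn n → X}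
    (hF : ∀ᵐ x, IsSingularIntegralValue K β x (F x)) :
    ∫⁻ x in {x | 2 * R < ‖x - y₀‖}, ‖F x‖ₑ ≤ C * ∫⁻ y, ‖β y‖ₑ := by
  have hS : MeasurableSet {x : Rn n | 2 * R < ‖x - y₀‖} :=
    measurableSet_lt measurable_const (by fun_prop)
  have hpt : ∀ᵐ x ∂volume.restrict {x : Rn n | 2 * R < ‖x - y₀‖}, ‖F x‖ₑ ≤
      ∫⁻ y, ‖K (x - y) - K (x - y₀)‖ₑ * ‖β y‖ₑ := by
    filter_upwards [ae_restrict_of_ae hF, ae_restrict_mem hS] with x hx hxS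
    refine hx.enorm_le_lintegral hK hβ hβ0 hR (fun y hy => hsupp y ?_) y₀
    have h1 : 2 * R < ‖x - y₀‖ := hxS
    have h2 : ‖x - y₀‖ ≤ ‖x - y‖ + ‖y - y₀‖ := by simpa using norm_add_le (x - y) (y - y₀)
    nlinarith [norm_nonneg (y - y₀)]
  refine (lintegral_mono_ae hpt).trans ?_
  have hm1 : AEStronglyMeasurable (fun p : Rn n × Rn n => K (p.1 - p.2))
      ((volume.restrict {x : Rn n | 2 * R < ‖x - y₀‖}).prod volume) :=
    (hK.comp_quasiMeasurePreserving (quasiMeasurePreserving_sub_of_right_invariant volume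
      volume)).mono_ac (Measure.AbsolutelyContinuous.prod
        Measure.restrict_le_self.absolutelyContinuous Measure.AbsolutelyContinuous.rfl)
  have hm2 : AEStronglyMeasurable (fun p : Rn n × Rn n => K (p.1 - y₀))
      ((volume.restrict {x : Rn n | 2 * R < ‖x - y₀‖}).prod volume) :=
    ((hK.comp_quasiMeasurePreserving (measurePreserving_sub_right volume
      y₀).quasiMeasurePreserving).mono_ac
        Measure.restrict_le_self.absolutelyContinuous).comp_fst
  have hm3 : AEStronglyMeasurable (fun p : Rn n × Rn n => β p.2)
      ((volume.restrict {x : Rn n | 2 * R < ‖x - y₀‖}).prod volume) :=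
    hβ.aestronglyMeasurable.comp_snd
  -- After Tonelli the inner integral in `x` is, up to translation by `y₀`, the Hörmander integral
  -- with increment `y - y₀`.
  rw [lintegral_lintegral_swap ((hm1.sub hm2).enorm.mul hm3.enorm), ← lintegral_const_mul' _ _
    ENNReal.coe_ne_top]
  refine lintegral_mono fun y => ?_
  by_cases hy : R ≤ c * ‖y - y₀‖
  · simp [hsupp y hy]
  rw [lintegral_mul_const' _ _ enorm_ne_top]
  gcongr
  refine le_trans (le_of_eq ?_) (hKC (y - y₀) R (not_le.1 hy))
  have := (measurePreserving_sub_right volume y₀).setLIntegral_comp_preimage_emb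
    (MeasurableEquiv.subRight y₀).measurableEmbedding
    (fun z => ‖K (z - (y - y₀)) - K z‖ₑ) {z | 2 * R < ‖z‖}
  rw [← this]
  refine lintegral_congr fun x => ?_
  rw [sub_sub_sub_cancel_right]

/-- Data of the Calderón-Zygmund decomposition at height `t`. -/
lemma exists_calderonZygmund_cubes (hn : 1 ≤ n) {g : Rn n → ℝ} (hg : Integrable g volume) {t : ℝ≥0}
    (ht : 0 < t) : ∃ 𝓜 : Set (ℤ × (Fin n → ℤ)), 𝓜.PairwiseDisjoint cube ∧
      (t : ℝ≥0∞) * ∑' Q : 𝓜, volume (cube Q.1) ≤ ∫⁻ y, ‖g y‖ₑ ∧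
      (∀ Q ∈ 𝓜, ∫⁻ y in cube Q, ‖g y‖ₑ ≤ (2 ^ n * t : ℝ≥0) * volume (cube Q)) ∧
      ∀ᵐ x, x ∉ ⋃ Q ∈ 𝓜, cube Q → ‖g x‖ₑ ≤ t := by
  set 𝓕 := {Q : ℤ × (Fin n → ℤ) | t * volume (cube Q) < ∫⁻ y in cube Q, ‖g y‖ₑ}
  have ht0 : (t : ℝ≥0∞) ≠ 0 := by simpa using ht.ne'
  obtain ⟨J, hJ⟩ : ∃ J : ℤ, ∀ Q ∈ 𝓕, Q.1 ≤ J := by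
    obtain ⟨J, hJ⟩ := exists_bound_of_volume_le hn (V := (∫⁻ y, ‖g y‖ₑ) / t)
      (ENNReal.div_ne_top hg.2.ne ht0)
    refine ⟨J, fun Q hQ => hJ Q ?_⟩
    rw [ENNReal.le_div_iff_mul_le (.inl ht0) (.inl ENNReal.coe_ne_top), mul_comm]
    exact hQ.le.trans (setLIntegral_le_lintegral _ _)
  refine ⟨maximalCubes 𝓕, maximalCubes_pairwiseDisjoint 𝓕, ?_, fun Q hQ => ?_, ?_⟩
  · have hU : MeasurableSet (⋃ Q ∈ 𝓕, cube Q) :=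
      MeasurableSet.biUnion (Set.to_countable _) fun Q _ => measurableSet_cube Q
    rw [← measure_biUnion_maximalCubes volume hJ]
    have := measure_biUnion_cube_le (ν := t • volume)
      (ρ := volume.withDensity fun y => ‖g y‖ₑ) hJ fun R hR => by
        rw [withDensity_apply _ (measurableSet_cube R)]
        exact hR.le
    rw [withDensity_apply _ hU] at this
    exact this.trans (setLIntegral_le_lintegral _ _)
  -- By maximality the parent has mean at most `t`; doubling the side costs `2^n`.
  · have hP : parent Q ∉ 𝓕 := fun h => by
      have := congrArg Prod.fst (hQ.2 _ h (by simp [parent]) (cube_subset_parent Q))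
      simp [parent] at this
    refine (lintegral_mono_set (cube_subset_parent Q)).trans ((not_lt.1 hP).trans (le_of_eq ?_))
    rw [volume_parent]; push_cast; ring
  · rw [biUnion_maximalCubes hJ]
    filter_upwards [ae_enorm_le_of_cube_average_le hg.locallyIntegrable] with x hx hxU
    refine hx t 0 fun j _ => ?_
    by_contra hlt
    exact hxU (Set.mem_biUnion (s := 𝓕) (not_le.1 hlt) (mem_cube_cubeAt j x))

lemma IsBoundedCompact.memLp {f : Rn n → ℝ} (hf : IsBoundedCompact f) (p : ℝ≥0∞) :
    MemLp f p volume :=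
  hf.1.mono_exponent_of_measure_support_ne_top (s := tsupport f)
    (fun _ hx => image_eq_zero_of_notMem_tsupport hx) hf.2.isCompact.measure_lt_top.ne le_top

lemma IsBoundedCompact.integrable {f : Rn n → ℝ} (hf : IsBoundedCompact f) :
    Integrable f volume := memLp_one_iff_integrable.1 (hf.memLp 1)

lemma IsBoundedCompact.sub {f g : Rn n → ℝ} (hf : IsBoundedCompact f) (hg : IsBoundedCompact g) :
    IsBoundedCompact (f - g) := ⟨hf.1.sub hg.1, hf.2.sub hg.2⟩

lemma isBoundedCompact_sum {ι : Type*} {s : Finset ι} {f : ι → Rn n → ℝ}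
    (hf : ∀ i ∈ s, IsBoundedCompact (f i)) : IsBoundedCompact (∑ i ∈ s, f i) := by
  classical
  induction s using Finset.induction_on with
  | empty => exact ⟨by simp, by simpa using HasCompactSupport.zero⟩
  | insert i s hi ih =>
    rw [Finset.sum_insert hi]
    have h1 := hf i (Finset.mem_insert_self _ _)
    have h2 := ih fun j hj => hf j (Finset.mem_insert_of_mem hj)
    exact ⟨h1.1.add h2.1, h1.2.add h2.2⟩

lemma isBoundedCompact_indicator {f : Rn n → ℝ} (hf : MemLp f ∞ volume) {S : Set (Rn n)}
    (hS : MeasurableSet S) (hSb : Bornology.IsBounded S) : IsBoundedCompact (S.indicator f) := by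
  refine ⟨hf.indicator hS, HasCompactSupport.of_support_subset_isCompact
    hSb.isCompact_closure (Set.support_indicator_subset.trans subset_closure)⟩

lemma isBounded_cube (Q : ℤ × (Fin n → ℤ)) : Bornology.IsBounded (cube Q) := by
  obtain ⟨x, hx⟩ := cube_nonempty Q
  exact Metric.isBounded_closedBall.subset (cube_subset_closedBall hx)

/-- `g` minus its mean over a cube, restricted to the cube. -/
def cubeAtom (g : Rn n → ℝ) (Q : ℤ × (Fin n → ℤ)) : Rn n → ℝ :=
  (cube Q).indicator fun y => g y - ⨍ z in cube Q, g z

lemma isBoundedCompact_cubeAtom {g : Rn n → ℝ} (hg : IsBoundedCompact g) (Q : ℤ × (Fin n → ℤ)) :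
    IsBoundedCompact (cubeAtom g Q) :=
  isBoundedCompact_indicator (hg.1.sub (memLp_top_const _)) (measurableSet_cube Q)
    (isBounded_cube Q)

lemma integral_cubeAtom {g : Rn n → ℝ} (hg : Integrable g volume) (Q : ℤ × (Fin n → ℤ)) :
    ∫ y, cubeAtom g Q y = 0 := by
  have ht := volume_cube_ne_top Q
  have h0 := (volume_cube_pos Q).ne'
  rw [cubeAtom, integral_indicator (measurableSet_cube Q), integral_sub hg.integrableOn
    (integrableOn_const ht), setIntegral_const, setAverage_eq, smul_eq_mul, smul_eq_mul,
    ← mul_assoc, Measure.real, mul_inv_cancel₀ (ENNReal.toReal_ne_zero.2 ⟨h0, ht⟩), one_mul, sub_self]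

lemma enorm_average_mul_le (g : Rn n → ℝ) (Q : ℤ × (Fin n → ℤ)) :
    ‖⨍ z in cube Q, g z‖ₑ * volume (cube Q) ≤ ∫⁻ y in cube Q, ‖g y‖ₑ := by
  have ht := volume_cube_ne_top Q
  have h0 := (volume_cube_pos Q).ne'
  have h1 : ‖(volume.real (cube Q))⁻¹‖ₑ = (volume (cube Q))⁻¹ := by
    rw [← ofReal_norm, Real.norm_of_nonneg (by positivity), Measure.real,
      ENNReal.ofReal_inv_of_pos (ENNReal.toReal_pos h0 ht), ENNReal.ofReal_toReal ht]
  rw [setAverage_eq, enorm_smul, h1, mul_right_comm, ENNReal.inv_mul_cancel h0 ht, one_mul]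
  exact enorm_integral_le_lintegral_enorm _

lemma lintegral_enorm_cubeAtom_le (g : Rn n → ℝ)
    (Q : ℤ × (Fin n → ℤ)) : ∫⁻ y, ‖cubeAtom g Q y‖ₑ ≤ 2 * ∫⁻ y in cube Q, ‖g y‖ₑ := by
  have h1 : ∀ y, ‖cubeAtom g Q y‖ₑ = (cube Q).indicator
      (fun y => ‖g y - ⨍ z in cube Q, g z‖ₑ) y := fun y => by
    rw [cubeAtom, enorm_indicator_eq_indicator_enorm]
  simp_rw [h1]
  rw [lintegral_indicator (measurableSet_cube Q), two_mul]
  calc _ ≤ ∫⁻ y in cube Q, (‖g y‖ₑ + ‖⨍ z in cube Q, g z‖ₑ) :=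
        lintegral_mono fun y => enorm_sub_le
    _ = (∫⁻ y in cube Q, ‖g y‖ₑ) + ‖⨍ z in cube Q, g z‖ₑ * volume (cube Q) := by
        rw [lintegral_add_right _ measurable_const, setLIntegral_const]
    _ ≤ _ := by gcongr; exact enorm_average_mul_le g Q

lemma sum_setLIntegral_cube_le {𝒮 : Finset (ℤ × (Fin n → ℤ))}
    (h𝒮 : (𝒮 : Set (ℤ × (Fin n → ℤ))).PairwiseDisjoint cube) (g : Rn n → ℝ≥0∞) :
    ∑ Q ∈ 𝒮, ∫⁻ y in cube Q, g y ≤ ∫⁻ y, g y := by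
  rw [← lintegral_biUnion_finset h𝒮 fun Q _ => measurableSet_cube Q]
  exact setLIntegral_le_lintegral _ _

/-- A Calderón-Zygmund decomposition with finitely many atoms. -/
lemma exists_calderonZygmund_decomposition (hn : 1 ≤ n) {g : Rn n → ℝ} (hg : IsBoundedCompact g)
    (hg0 : ∫⁻ y, ‖g y‖ₑ ≠ 0) {t : ℝ≥0} (ht : 0 < t) {p : ℝ} (hp : 1 < p) :
    ∃ 𝒮 : Finset (ℤ × (Fin n → ℤ)), (𝒮 : Set (ℤ × (Fin n → ℤ))).PairwiseDisjoint cube ∧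
      (t : ℝ≥0∞) * ∑ Q ∈ 𝒮, volume (cube Q) ≤ ∫⁻ y, ‖g y‖ₑ ∧
      ∫⁻ y, ‖(g - ∑ Q ∈ 𝒮, cubeAtom g Q) y‖ₑ ^ p ≤
        3 * (2 ^ n * t : ℝ≥0) ^ (p - 1) * ∫⁻ y, ‖g y‖ₑ := by
  classical
  have hgi := hg.integrable
  obtain ⟨𝓜, hdisj, hvol, havg, hoff⟩ := exists_calderonZygmund_cubes hn hgi ht
  have ht0 : (t : ℝ≥0∞) ≠ 0 := by simpa using ht.ne'
  have hsum : ∑' Q : 𝓜, volume (cube Q.1) ≠ ∞ := fun h => by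
    rw [h, ENNReal.mul_top ht0] at hvol
    exact hgi.2.ne (top_le_iff.1 hvol)
  set M : ℝ≥0∞ := eLpNorm g ∞ volume
  have hM : M ≠ ∞ := hg.1.2.ne
  have hgM : ∀ᵐ x, ‖g x‖ₑ ≤ M := by
    simp only [M, eLpNorm_exponent_top]
    exact ae_le_eLpNormEssSup
  set T : ℝ≥0 := 2 ^ n * t
  have htT : t ≤ T := le_mul_of_one_le_left zero_le (one_le_pow₀ one_le_two)
  have hT0 : (T : ℝ≥0∞) ^ (p - 1) ≠ 0 :=
    (ENNReal.rpow_pos (by simpa using ht.trans_le htT) ENNReal.coe_ne_top).ne'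
  have hp1 : 0 ≤ p - 1 := by linarith
  have hMp : M ^ p ≠ ∞ := ENNReal.rpow_ne_top_of_nonneg (by linarith) hM
  -- Only finite sums pass through `T` by linearity of principal values. The discarded cubes are
  -- chosen so small in total volume that `g`, left unchanged there and bounded by `M`, contributes
  -- a harmless amount to the `L^p` norm.
  obtain ⟨𝒮', h𝒮'⟩ : ∃ 𝒮' : Finset 𝓜, M ^ p * ∑' Q : {Q // Q ∉ 𝒮'}, volume (cube Q.1.1) ≤
      (T : ℝ≥0∞) ^ (p - 1) * ∫⁻ y, ‖g y‖ₑ := by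
    have h1 := ENNReal.Tendsto.const_mul (ENNReal.tendsto_tsum_compl_atTop_zero hsum)
      (.inr hMp)
    rw [mul_zero] at h1
    exact (h1.eventually (ge_mem_nhds (pos_iff_ne_zero.2 (mul_ne_zero hT0 hg0)))).exists
  set 𝒮 : Finset (ℤ × (Fin n → ℤ)) := 𝒮'.map (Function.Embedding.subtype _)
  have h𝒮M : ∀ Q ∈ 𝒮, Q ∈ 𝓜 := fun Q hQ => by
    obtain ⟨R, -, rfl⟩ := Finset.mem_map.1 hQ
    exact R.2
  have h𝒮disj : (𝒮 : Set (ℤ × (Fin n → ℤ))).PairwiseDisjoint cube := hdisj.subset h𝒮M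
  have hatom : ∀ Q ∈ 𝒮, ∀ x ∈ cube Q, (g - ∑ R ∈ 𝒮, cubeAtom g R) x = ⨍ z in cube Q, g z := by
    intro Q hQ x hx
    rw [Pi.sub_apply, Finset.sum_apply, Finset.sum_eq_single Q]
    · rw [cubeAtom, Set.indicator_of_mem hx]; ring
    · intro R hR hne
      rw [cubeAtom, Set.indicator_of_notMem]
      exact fun hxR => Set.disjoint_left.1 (h𝒮disj hR hQ hne) hxR hx
    · exact fun h => absurd hQ h
  have hoffatom : ∀ x, (∀ Q ∈ 𝒮, x ∉ cube Q) → (g - ∑ R ∈ 𝒮, cubeAtom g R) x = g x := by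
    intro x hx
    rw [Pi.sub_apply, Finset.sum_apply, Finset.sum_eq_zero, sub_zero]
    exact fun R hR => by rw [cubeAtom, Set.indicator_of_notMem (hx R hR)]
  have hrpow : ∀ a : ℝ≥0∞, a ≤ T → a ^ p ≤ (T : ℝ≥0∞) ^ (p - 1) * a := by
    intro a ha
    calc a ^ p = a ^ (p - 1) * a := by
          conv_rhs => rw [← ENNReal.rpow_one a, ← ENNReal.rpow_mul,
            ← ENNReal.rpow_add_of_nonneg _ _ (by linarith) zero_le_one]
          congr 1; ring
      _ ≤ _ := by gcongr
  set U : Set (Rn n) := ⋃ Q : {Q // Q ∉ 𝒮'}, cube Q.1.1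
  have hU : MeasurableSet U := MeasurableSet.iUnion fun Q => measurableSet_cube _
  -- Three regions: off all cubes the good part is `g`, bounded by `t`; on a chosen cube it is a
  -- mean, bounded by `T`; on a discarded cube it is `g`, bounded by `M`. Each costs at most
  -- `T^(p-1) ‖g‖₁`, hence the constant 3.
  have hpt : ∀ᵐ x, ‖(g - ∑ Q ∈ 𝒮, cubeAtom g Q) x‖ₑ ^ p ≤
      (T : ℝ≥0∞) ^ (p - 1) * (‖g x‖ₑ +
        ∑ Q ∈ 𝒮, (cube Q).indicator (fun _ => ‖⨍ z in cube Q, g z‖ₑ) x) +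
        U.indicator (fun _ => M ^ p) x := by
    filter_upwards [hgM, hoff] with x hxM hxt
    by_cases hx : ∃ Q ∈ 𝒮, x ∈ cube Q
    · obtain ⟨Q, hQ, hxQ⟩ := hx
      rw [hatom Q hQ x hxQ]
      have h1 : ‖⨍ z in cube Q, g z‖ₑ ≤ T := by
        refine (ENNReal.mul_le_mul_iff_left (volume_cube_pos Q).ne' (volume_cube_ne_top Q)).1 ?_
        exact (enorm_average_mul_le g Q).trans (havg Q (h𝒮M Q hQ))
      refine (hrpow _ h1).trans (le_add_right ?_)
      gcongr
      refine le_add_left ?_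
      calc ‖⨍ z in cube Q, g z‖ₑ = (cube Q).indicator (fun _ => ‖⨍ z in cube Q, g z‖ₑ) x := by
            rw [Set.indicator_of_mem hxQ]
        _ ≤ _ := Finset.single_le_sum
            (f := fun Q => (cube Q).indicator (fun _ => ‖⨍ z in cube Q, g z‖ₑ) x)
            (fun _ _ => zero_le) hQ
    · push Not at hx
      rw [hoffatom x hx]
      by_cases hxU : x ∈ U
      · refine le_add_left ?_
        rw [Set.indicator_of_mem hxU]
        gcongr
      · refine le_add_right ?_
        have hxnot : x ∉ ⋃ Q ∈ 𝓜, cube Q := fun h => by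
          obtain ⟨Q, hQ, hxQ⟩ := Set.mem_iUnion₂.1 h
          by_cases hQS : (⟨Q, hQ⟩ : 𝓜) ∈ 𝒮'
          · exact hx Q (Finset.mem_map.2 ⟨⟨Q, hQ⟩, hQS, rfl⟩) hxQ
          · exact hxU (Set.mem_iUnion.2 ⟨⟨⟨Q, hQ⟩, hQS⟩, hxQ⟩)
        refine (hrpow _ ((hxt hxnot).trans (by exact_mod_cast htT))).trans ?_
        gcongr
        exact le_self_add
  refine ⟨𝒮, h𝒮disj, le_trans ?_ hvol, ?_⟩
  · gcongr
    rw [Finset.sum_map]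
    exact ENNReal.sum_le_tsum _
  have hgm : AEMeasurable (fun x => ‖g x‖ₑ) volume := hgi.aestronglyMeasurable.enorm
  have hsm : Measurable fun x => ∑ Q ∈ 𝒮, (cube Q).indicator (fun _ => ‖⨍ z in cube Q, g z‖ₑ) x :=
    Finset.measurable_fun_sum _ fun Q _ => measurable_const.indicator (measurableSet_cube Q)
  calc _ ≤ _ := lintegral_mono_ae hpt
    _ = (T : ℝ≥0∞) ^ (p - 1) * ((∫⁻ y, ‖g y‖ₑ) +
          ∑ Q ∈ 𝒮, ‖⨍ z in cube Q, g z‖ₑ * volume (cube Q)) + M ^ p * volume U := by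
        rw [lintegral_add_right _ (measurable_const.indicator hU),
          lintegral_const_mul' _ _ (ENNReal.rpow_ne_top_of_nonneg hp1 ENNReal.coe_ne_top),
          lintegral_add_right _ hsm, lintegral_finsetSum _ fun Q _ =>
            measurable_const.indicator (measurableSet_cube Q), lintegral_indicator_const hU]
        simp_rw [lintegral_indicator_const (measurableSet_cube _)]
    _ ≤ (T : ℝ≥0∞) ^ (p - 1) * ((∫⁻ y, ‖g y‖ₑ) + ∫⁻ y, ‖g y‖ₑ) +
          (T : ℝ≥0∞) ^ (p - 1) * ∫⁻ y, ‖g y‖ₑ := by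
        refine add_le_add (mul_le_mul_right (add_le_add le_rfl ?_) _)
          ((mul_le_mul_right (measure_iUnion_le _) _).trans h𝒮')
        exact (Finset.sum_le_sum fun Q _ => enorm_average_mul_le g Q).trans
          (sum_setLIntegral_cube_le h𝒮disj _)
    _ = _ := by ring

/-- A singular integral operator is of weak type (1,1). -/
lemma IsSingularIntegralKernel.exists_weak_type (hn : 1 ≤ n) {K : Rn n → X}
    (hK : IsSingularIntegralKernel K) : ∃ C : ℝ≥0, ∀ g : Rn n → ℝ, IsBoundedCompact g →
      ∀ F : Rn n → X, (∀ᵐ x, IsSingularIntegralValue K g x (F x)) → ∀ t : ℝ≥0, 0 < t →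
        t * volume {x | (t : ℝ≥0∞) < ‖F x‖ₑ} ≤ C * ∫⁻ y, ‖g y‖ₑ := by
  obtain ⟨p, hp, C₁, hstrong⟩ := hK.exists_eLpNorm_le
  obtain ⟨c, hc, C₂, hH⟩ := hK.hormander.exists_lintegral_le
  obtain ⟨C₃, hC₃⟩ := exists_volume_closedBall_le_cube n (2 * (c + 1) * (n + 1))
  have hp0 : 0 < p := by linarith
  have hpt : (ENNReal.ofReal p).toReal = p := ENNReal.toReal_ofReal hp0.le
  have hpne : ENNReal.ofReal p ≠ 0 := by simpa using hp0
  set C₄ : ℝ≥0 := C₁ ^ p * 3 * (2 ^ n) ^ (p - 1)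
  suffices hmain : ∀ g : Rn n → ℝ, IsBoundedCompact g →
      ∀ F : Rn n → X, (∀ᵐ x, IsSingularIntegralValue K g x (F x)) → ∀ t : ℝ≥0, 0 < t →
        t * volume {x | ((2 * t : ℝ≥0) : ℝ≥0∞) < ‖F x‖ₑ} ≤
          (C₄ + C₃ + 2 * C₂ : ℝ≥0) * ∫⁻ y, ‖g y‖ₑ by
    refine ⟨2 * (C₄ + C₃ + 2 * C₂), fun g hg F hF t ht => ?_⟩
    have := hmain g hg F hF (t / 2) (by positivity)
    rw [mul_div_cancel₀ _ two_ne_zero] at this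
    calc (t : ℝ≥0∞) * volume {x | (t : ℝ≥0∞) < ‖F x‖ₑ} =
        2 * ((t / 2 : ℝ≥0) * volume {x | (t : ℝ≥0∞) < ‖F x‖ₑ}) := by
          rw [← mul_assoc]
          congr 1
          rw [← ENNReal.coe_ofNat, ← ENNReal.coe_mul, mul_div_cancel₀ _ two_ne_zero]
      _ ≤ _ := by
          rw [ENNReal.coe_mul, mul_assoc]
          exact mul_le_mul_right this _
  intro g hg F hF t ht
  by_cases hg0 : ∫⁻ y, ‖g y‖ₑ = 0
  · have h1 := (hstrong g (hg.memLp _) hg.2).2 F hF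
    have h2 : g =ᵐ[volume] 0 := by
      have := (lintegral_eq_zero_iff' hg.integrable.aestronglyMeasurable.enorm).1 hg0
      filter_upwards [this] with x hx
      simpa using hx
    rw [eLpNorm_congr_ae h2, eLpNorm_zero, mul_zero] at h1
    have h3 : F =ᵐ[volume] 0 := (eLpNorm_eq_zero_iff h1.1.1 hpne).1 (le_antisymm h1.2 zero_le)
    have h4 : volume {x | ((2 * t : ℝ≥0) : ℝ≥0∞) < ‖F x‖ₑ} = 0 := by
      refine measure_mono_null ?_ (ae_iff.1 h3)
      intro x hx h
      simp [h] at hx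
    rw [h4, mul_zero]; exact zero_le
  obtain ⟨𝒮, hdisj, hvol, hgood⟩ := exists_calderonZygmund_decomposition hn hg hg0 ht hp
  have hgi := hg.integrable
  have hβ : ∀ Q, IsBoundedCompact (cubeAtom g Q) := isBoundedCompact_cubeAtom hg
  have hh : IsBoundedCompact (g - ∑ Q ∈ 𝒮, cubeAtom g Q) := hg.sub (isBoundedCompact_sum fun Q _ => hβ Q)
  choose G hG using fun Q => (hstrong (cubeAtom g Q) ((hβ Q).memLp _) (hβ Q).2).1
  obtain ⟨⟨H, hH'⟩, hHle⟩ := hstrong _ (hh.memLp _) hh.2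
  obtain ⟨hHm, hHle⟩ := hHle H hH'
  have hFae : ∀ᵐ x, F x = H x + ∑ Q ∈ 𝒮, G Q x := by
    filter_upwards [hF, hH', ae_all_iff.2 hG] with x hxF hxH hxG
    have := hxH.add (IsSingularIntegralValue.sum (s := 𝒮) fun Q _ => hxG Q)
    rw [sub_add_cancel] at this
    exact hxF.unique this
  choose y hy using fun Q : ℤ × (Fin n → ℤ) => cube_nonempty Q
  -- More than `c` times the diameter of `Q`, so the Hörmander estimate holds off the ball of radius
  -- `2 R Q`, while that ball is still comparable with `Q`.
  set R : ℤ × (Fin n → ℤ) → ℝ := fun Q => (c + 1) * (n + 1) * 2 ^ Q.1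
  have hR : ∀ Q, 0 < R Q := fun Q => by simp only [R]; positivity
  have hGint : ∀ Q, ∫⁻ x in {x | 2 * R Q < ‖x - y Q‖}, ‖G Q x‖ₑ ≤
      C₂ * (2 * ∫⁻ z in cube Q, ‖g z‖ₑ) := fun Q => by
    refine (lintegral_singularIntegral_le hK.aestronglyMeasurable hc hH (hβ Q).integrable
      (integral_cubeAtom hgi Q) (hR Q) (fun z hz => ?_) (hG Q)).trans ?_
    · rw [cubeAtom, Set.indicator_of_notMem]
      intro hzQ
      have h1 := norm_sub_le_of_mem_cube hzQ (hy Q)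
      have h2 : (0 : ℝ) < 2 ^ Q.1 := by positivity
      have h3 : c * ‖z - y Q‖ ≤ c * (n * 2 ^ Q.1) := by gcongr
      have h4 : c * (n * 2 ^ Q.1) < (c + 1) * (n + 1) * 2 ^ Q.1 := by
        have h5 : c * n < (c + 1) * (n + 1) := by
          nlinarith [(Nat.cast_nonneg n : (0 : ℝ) ≤ n)]
        nlinarith
      simp only [R] at hz
      linarith
    · gcongr; exact lintegral_enorm_cubeAtom_le g Q
  set S : Set (Rn n) := ⋃ Q ∈ 𝒮, Metric.closedBall (y Q) (2 * R Q)
  have hS : MeasurableSet S := Finset.measurableSet_biUnion _ fun Q _ => measurableSet_closedBall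
  set Z : Rn n → X := fun x => ∑ Q ∈ 𝒮, G Q x
  have hGm : ∀ Q, AEStronglyMeasurable (G Q) volume := fun Q =>
    ((hstrong _ ((hβ Q).memLp _) (hβ Q).2).2 _ (hG Q)).1.1
  have hZm : AEStronglyMeasurable Z volume := Finset.aestronglyMeasurable_fun_sum _ fun Q _ => hGm Q
  have hcov : volume {x | ((2 * t : ℝ≥0) : ℝ≥0∞) < ‖F x‖ₑ} ≤
      volume {x | (t : ℝ≥0∞) ≤ ‖H x‖ₑ} + (volume S + volume (Sᶜ ∩ {x | (t : ℝ≥0∞) ≤ ‖Z x‖ₑ})) := by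
    refine (measure_mono_ae ?_).trans ((measure_union_le _ _).trans
      (add_le_add_right (measure_union_le _ _) _))
    filter_upwards [hFae] with x hx hxt
    by_contra hcon
    have h1 : ¬ (t : ℝ≥0∞) ≤ ‖H x‖ₑ := fun h => hcon (.inl h)
    have h2 : x ∉ S := fun h => hcon (.inr (.inl h))
    have h3 : ¬ (t : ℝ≥0∞) ≤ ‖Z x‖ₑ := fun h => hcon (.inr (.inr ⟨h2, h⟩))
    have h4 : ((2 * t : ℝ≥0) : ℝ≥0∞) < ‖F x‖ₑ := hxt
    rw [hx] at h4
    refine absurd h4 (not_lt.2 ((enorm_add_le _ _).trans ?_))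
    rw [two_mul, ENNReal.coe_add]
    exact add_le_add (not_le.1 h1).le (not_le.1 h3).le
  have ht0 : (t : ℝ≥0∞) ≠ 0 := by simpa using ht.ne'
  have hbound₁ : t * volume {x | (t : ℝ≥0∞) ≤ ‖H x‖ₑ} ≤ C₄ * ∫⁻ y, ‖g y‖ₑ := by
    have h1 := meas_ge_le_mul_pow_eLpNorm_enorm volume hpne ENNReal.ofReal_ne_top hHm.1 ht0
      (fun h => absurd h ENNReal.coe_ne_top)
    rw [hpt] at h1
    have h2 : eLpNorm H (ENNReal.ofReal p) volume ^ p ≤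
        C₁ ^ p * (3 * (2 ^ n * t : ℝ≥0) ^ (p - 1) * ∫⁻ y, ‖g y‖ₑ) := by
      calc _ ≤ _ := ENNReal.rpow_le_rpow hHle hp0.le
        _ = C₁ ^ p * ∫⁻ y, ‖(g - ∑ Q ∈ 𝒮, cubeAtom g Q) y‖ₑ ^ p := by
          rw [ENNReal.mul_rpow_of_nonneg _ _ hp0.le,
            eLpNorm_eq_lintegral_rpow_enorm_toReal hpne ENNReal.ofReal_ne_top, hpt,
            ← ENNReal.rpow_mul, one_div_mul_cancel hp0.ne', ENNReal.rpow_one]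
        _ ≤ _ := by gcongr
    -- Chebyshev's `t^{-p}` meets the `t^{p-1}` of the good part, which leaves the weak type
    -- scaling.
    have h3 : (t : ℝ≥0∞) * ((t : ℝ≥0∞)⁻¹ ^ p * (t : ℝ≥0∞) ^ (p - 1)) = 1 := by
      rw [mul_left_comm, ENNReal.inv_rpow]
      have : (t : ℝ≥0∞) ^ p = t * t ^ (p - 1) := by
        conv_lhs => rw [show p = 1 + (p - 1) by ring, ENNReal.rpow_add _ _ ht0 ENNReal.coe_ne_top,
          ENNReal.rpow_one]
      rw [← this]
      exact ENNReal.inv_mul_cancel (ENNReal.rpow_pos ht0.bot_lt ENNReal.coe_ne_top).ne'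
        (ENNReal.rpow_ne_top_of_nonneg hp0.le ENNReal.coe_ne_top)
    calc _ ≤ t * ((t : ℝ≥0∞)⁻¹ ^ p *
          (C₁ ^ p * (3 * (2 ^ n * t : ℝ≥0) ^ (p - 1) * ∫⁻ y, ‖g y‖ₑ))) :=
          mul_le_mul_right (h1.trans (mul_le_mul_right h2 _)) _
      _ = t * ((t : ℝ≥0∞)⁻¹ ^ p * (t : ℝ≥0∞) ^ (p - 1)) * (C₁ ^ p * 3 * (2 ^ n : ℝ≥0) ^ (p - 1)) *
            ∫⁻ y, ‖g y‖ₑ := by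
          rw [ENNReal.coe_mul, ENNReal.mul_rpow_of_nonneg _ _ (by linarith : 0 ≤ p - 1)]; ring
      _ = _ := by
          rw [h3, one_mul]
          congr 1
          simp only [C₄, ENNReal.coe_mul]
          rw [ENNReal.coe_rpow_of_nonneg _ hp0.le, ENNReal.coe_rpow_of_nonneg _ (by linarith)]
          rfl
  have hbound₂ : t * volume S ≤ C₃ * ∫⁻ y, ‖g y‖ₑ := by
    calc t * volume S ≤ t * ∑ Q ∈ 𝒮, C₃ * volume (cube Q) := by
          gcongr
          refine (measure_biUnion_finset_le _ _).trans (Finset.sum_le_sum fun Q _ => hC₃ Q _ _ ?_)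
          simp only [R]; exact le_of_eq (by ring)
      _ = C₃ * (t * ∑ Q ∈ 𝒮, volume (cube Q)) := by rw [← Finset.mul_sum]; ring
      _ ≤ _ := by gcongr
  have hbound₃ : t * volume (Sᶜ ∩ {x | (t : ℝ≥0∞) ≤ ‖Z x‖ₑ}) ≤ (2 * C₂ : ℝ≥0) * ∫⁻ y, ‖g y‖ₑ := by
    have h1 := mul_meas_ge_le_lintegral₀ (μ := volume.restrict Sᶜ) hZm.enorm.restrict (t : ℝ≥0∞)
    rw [Measure.restrict_apply₀' hS.compl.nullMeasurableSet, Set.inter_comm] at h1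
    calc _ ≤ _ := h1
      _ ≤ ∫⁻ x in Sᶜ, ∑ Q ∈ 𝒮, ‖G Q x‖ₑ := lintegral_mono fun x => enorm_sum_le _ _
      _ = ∑ Q ∈ 𝒮, ∫⁻ x in Sᶜ, ‖G Q x‖ₑ :=
          lintegral_finsetSum' _ fun Q _ => (hGm Q).enorm.restrict
      _ ≤ ∑ Q ∈ 𝒮, C₂ * (2 * ∫⁻ z in cube Q, ‖g z‖ₑ) := by
          refine Finset.sum_le_sum fun Q hQ => le_trans (lintegral_mono_set fun x hx => ?_) (hGint Q)
          by_contra hcon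
          refine hx (Set.mem_biUnion (s := (𝒮 : Set (ℤ × (Fin n → ℤ)))) hQ ?_)
          rw [Metric.mem_closedBall, dist_eq_norm]
          exact not_lt.1 hcon
      _ = (2 * C₂ : ℝ≥0) * ∑ Q ∈ 𝒮, ∫⁻ z in cube Q, ‖g z‖ₑ := by
          rw [Finset.mul_sum]
          refine Finset.sum_congr rfl fun Q _ => ?_
          push_cast; ring
      _ ≤ _ := by gcongr; exact sum_setLIntegral_cube_le hdisj _
  calc _ ≤ t * (volume {x | (t : ℝ≥0∞) ≤ ‖H x‖ₑ} + (volume S +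
        volume (Sᶜ ∩ {x | (t : ℝ≥0∞) ≤ ‖Z x‖ₑ}))) := by gcongr
    _ = t * volume {x | (t : ℝ≥0∞) ≤ ‖H x‖ₑ} + (t * volume S +
        t * volume (Sᶜ ∩ {x | (t : ℝ≥0∞) ≤ ‖Z x‖ₑ})) := by ring
    _ ≤ _ := add_le_add hbound₁ (add_le_add hbound₂ hbound₃)
    _ = _ := by push_cast; ring

end WeakType

/-! ### Oscillation of commutators -/

section Oscillation

variable {n : ℕ} {X : Type*} [NormedAddCommGroup X] [NormedSpace ℝ X] [MonotoneSequenceSpace X]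

/-- An element realizing a finite `seqNorm`, with nonnegative coordinates. -/
lemma exists_of_seqNorm_le {s : ℤ → ℝ≥0∞} {C : ℝ≥0} (h : seqNorm X s ≤ C) :
    ∃ v : X, (∀ l, 0 ≤ coord v l ∧ ENNReal.ofReal (coord v l) = s l) ∧ ‖v‖ ≤ C + 1 := by
  have h1 : seqNorm X s < (C + 1 : ℝ≥0) := lt_of_le_of_lt h (by exact_mod_cast lt_add_one C)
  simp only [seqNorm, iInf_lt_iff] at h1
  obtain ⟨v, hv, hlt⟩ := h1
  obtain ⟨u, hu, hle⟩ := MonotoneSequenceSpace.solid v (fun l => |coord v l|) fun l => by simp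
  refine ⟨u, fun l => ?_, hle.trans ?_⟩
  · rw [hu, ← hv l]
    exact ⟨abs_nonneg _, (Real.enorm_eq_ofReal_abs _).symm⟩
  · rw [← ofReal_norm, ← ENNReal.ofReal_coe_nnreal] at hlt
    have := (ENNReal.ofReal_lt_ofReal_iff (by positivity)).1 hlt
    simpa using this.le

lemma setLIntegral_ball_sub_left (g : Rn n → ℝ≥0∞) (x : Rn n) (r : ℝ) :
    ∫⁻ z in Metric.ball 0 r, g (x - z) = ∫⁻ y in Metric.ball x r, g y := by
  have h := (Measure.measurePreserving_sub_left (volume : Measure (Rn n)) x).setLIntegral_comp_preimage_emb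
    (MeasurableEquiv.subLeft x).measurableEmbedding g (Metric.ball x r)
  rw [← h]
  congr 2
  ext z
  simp [dist_eq_norm]

/-- Means of a function with bounded mean oscillation over dyadic dilates of a ball. -/
lemma exists_dilate_constants {b : Rn n → ℝ} (hb : UnitOscillation b) {x : Rn n} {R : ℝ} (hR : 0 < R)
    {L : ℝ≥0} (hL : 1 ≤ L) {c : ℝ} (hc : ∫⁻ y in Metric.ball x (2 * R), ‖b y - c‖ₑ ≤ L * volume (Metric.ball x (2 * R))) :
    ∃ e : ℕ → ℝ, ∀ m, |e m - c| ≤ L * (1 + 2 ^ n) * m ∧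
      (m ≠ 0 → ∫⁻ y in Metric.ball x (2 * (2 ^ m * R)), ‖b y - e m‖ₑ ≤
        volume (Metric.ball x (2 * (2 ^ m * R)))) := by
  choose d hd using fun m : ℕ => hb.2 x (2 * (2 ^ m * R)) (by positivity)
  -- The value at 0 is the prescribed constant, whose oscillation is controlled only up to `L`; the
  -- sequence then starts at `c` and drifts by a bounded amount per doubling.
  set e : ℕ → ℝ := fun m => if m = 0 then c else d m
  have he : ∀ m, ∫⁻ y in Metric.ball x (2 * (2 ^ m * R)), ‖b y - e m‖ₑ ≤
      L * volume (Metric.ball x (2 * (2 ^ m * R))) := fun m => by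
    by_cases hm : m = 0
    · simpa [e, hm] using hc
    · simp only [e, if_neg hm]
      exact (hd m).trans (le_mul_of_one_le_left (zero_le) (by exact_mod_cast hL))
  have hstep : ∀ m, |e (m + 1) - e m| ≤ L * (1 + 2 ^ n) := fun m => by
    set S := Metric.ball x (2 * (2 ^ m * R))
    set S' := Metric.ball x (2 * (2 ^ (m + 1) * R))
    have hSS' : S ⊆ S' := Metric.ball_subset_ball (by
      rw [pow_succ]
      nlinarith [mul_pos (pow_pos (two_pos (α := ℝ)) m) hR])
    have hvol : volume S' = 2 ^ n * volume S := by
      have h1 := Measure.addHaar_ball_of_pos (volume : Measure (Rn n)) x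
        (show 0 < 2 * (2 ^ m * R) by positivity)
      have h2 := Measure.addHaar_ball_of_pos (volume : Measure (Rn n)) x
        (show 0 < 2 * (2 ^ (m + 1) * R) by positivity)
      rw [h1, h2, finrank_euclideanSpace_fin,
        show 2 * (2 ^ (m + 1) * R) = 2 * (2 * (2 ^ m * R)) by ring, mul_pow 2 (2 * (2 ^ m * R)),
        ENNReal.ofReal_mul (by positivity), ENNReal.ofReal_pow (by norm_num) n, mul_assoc]
      simp
    have h0 : volume S ≠ 0 := (Metric.measure_ball_pos _ _ (by positivity)).ne'
    have h1 : ‖e (m + 1) - e m‖ₑ ≤ ENNReal.ofReal (L * (1 + 2 ^ n)) := by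
      refine (ENNReal.mul_le_mul_iff_left h0 measure_ball_lt_top.ne).1 ?_
      calc _ ≤ _ := enorm_sub_mul_volume_le hb.1.aestronglyMeasurable _ _ S
        _ ≤ L * volume S' + L * volume S := add_le_add ((lintegral_mono_set hSS').trans (he (m + 1))) (he m)
        _ = _ := by
            rw [hvol, ENNReal.ofReal_mul (by positivity), ENNReal.ofReal_add zero_le_one (by positivity), ENNReal.ofReal_pow (by norm_num)]
            simp; ring
    rwa [← ofReal_norm, ENNReal.ofReal_le_ofReal_iff (by positivity)] at h1
  refine ⟨e, fun m => ⟨?_, fun hm => by simpa only [e, if_neg hm] using hd m⟩⟩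
  induction m with
  | zero => simp [e]
  | succ m ih =>
    have := abs_sub_le (e (m + 1)) (e m) c
    push_cast
    linarith [hstep m]

/-- Adding 1 to the base makes it at least 1, so the exponent may be raised from `j` to `k`; then
the larger of the two summands dominates. The power of `m` goes to the condition on `A`, that of `a
β` to exponential integrability. -/
lemma pow_le_of_le {k j : ℕ} (hjk : j ≤ k) {D β m t a : ℝ} (hD : 0 ≤ D) (hm : 1 ≤ m)
    (hβ : 0 ≤ β) (ha : 0 < a) (ht0 : 0 ≤ t) (ht : t ≤ β + D * m) :
    t ^ j ≤ 2 ^ k * ((1 + D) ^ k * m ^ k + (a⁻¹) ^ k * (a * β) ^ k) := by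
  have h1 : t ^ j ≤ (1 + D * m + β) ^ k := by
    calc t ^ j ≤ (1 + D * m + β) ^ j := pow_le_pow_left₀ ht0 (by linarith) j
      _ ≤ _ := pow_le_pow_right₀ (by nlinarith [mul_nonneg hD (by linarith : 0 ≤ m)]) hjk
  have h2 : 1 + D * m ≤ (1 + D) * m := by nlinarith
  refine h1.trans ?_
  rw [← mul_pow, ← mul_pow, ← mul_assoc, inv_mul_cancel₀ ha.ne', one_mul]
  have h3 : 0 ≤ D * m := by positivity
  rcases le_total ((1 + D) * m) β with h | h
  · calc (1 + D * m + β) ^ k ≤ (2 * β) ^ k := pow_le_pow_left₀ (by linarith) (by linarith) k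
      _ = 2 ^ k * β ^ k := mul_pow _ _ _
      _ ≤ _ := by
          gcongr
          exact le_add_of_nonneg_left (by positivity)
  · calc (1 + D * m + β) ^ k ≤ (2 * ((1 + D) * m)) ^ k :=
          pow_le_pow_left₀ (by linarith) (by linarith) k
      _ = 2 ^ k * ((1 + D) * m) ^ k := mul_pow _ _ _
      _ ≤ _ := by
          gcongr
          exact le_add_of_nonneg_right (by positivity)

/-- The contribution of one annulus. -/
lemma lintegral_annulus_commutator_le {k j : ℕ} (hjk : j ≤ k) {A B : ℝ≥0 → ℝ≥0} (hB : IsYoung B)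
    (hAB : ∀ t : ℝ≥0, 1 ≤ t → youngInv (complYoung A) t * youngInv (toGauge B) t *
        ENNReal.ofReal (Real.log t ^ k) ≤ t) {a : ℝ} (ha : 0 < a) {C : ℝ≥0} {D : ℝ} (hD : 0 ≤ D)
    {s : ℝ} (hs : 0 < s) {g : Rn n → ℝ≥0} (hg : AEMeasurable g volume) {f b : Rn n → ℝ}
    (hf : AEStronglyMeasurable f volume) (hb : AEStronglyMeasurable b volume)
    {μ : ℝ≥0} (hμ : 0 < μ) {c e : ℝ} {m : ℕ} (hm : 1 ≤ m) (hce : |e - c| ≤ D * m)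
    (hexp : ∫⁻ z in Metric.ball 0 (2 * s), ENNReal.ofReal (Real.exp (a * |b z - e|)) ≤
      C * volume (Metric.ball (0 : Rn n) (2 * s)))
    (hfμ : ∫⁻ z in Metric.ball 0 (2 * s), complYoung A (‖f z‖₊ / μ) ≤
      volume (Metric.ball (0 : Rn n) (2 * s))) :
    ∫⁻ z in {z | s < ‖z‖ ∧ ‖z‖ ≤ 2 * s}, g z * (ENNReal.ofReal (|b z - c| ^ j) * ‖f z‖ₑ) ≤
      ENNReal.ofReal (2 ^ k) * μ * volume (Metric.ball (0 : Rn n) (2 * s)) *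
        (ENNReal.ofReal ((1 + D) ^ k) * 2 * ((m : ℝ≥0∞) ^ k * luxAnnulus (toGauge A) s g) +
          ENNReal.ofReal ((a⁻¹) ^ k) * (2 + C) * luxAnnulus (toGauge B) s g) := by
  set u : Rn n → ℝ≥0 := fun z => ‖f z‖₊ / μ
  have hu : ∀ z, ‖f z‖ₑ = μ * u z := fun z => by
    rw [enorm_eq_nnnorm, ← ENNReal.coe_mul, mul_div_cancel₀ _ hμ.ne']
  set q : Rn n → ℝ := fun z => a * |b z - e|
  have hum : AEMeasurable u volume := hf.nnnorm.aemeasurable.div_const μ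
  have hAm : AEMeasurable (fun z => complYoung A (u z)) volume :=
    (complYoung_mono A).measurable.comp_aemeasurable hum
  have hbm : AEMeasurable b volume := hb.aemeasurable
  have hqm : AEMeasurable q volume :=
    ((continuous_abs.measurable.comp_aemeasurable (hbm.sub_const e)).const_mul a)
  have hem : AEMeasurable (fun z => ENNReal.ofReal (Real.exp (q z))) volume :=
    (Real.measurable_exp.comp_aemeasurable hqm).ennreal_ofReal
  -- The `m^k` part: ordinary Young duality between `A` and `Ā`.
  have h1 := lintegral_annulus_le (Φ := toGauge A) hs (g := g) (ψ := fun z => u z)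
    (G := fun z => complYoung A (u z)) (C := 1) hAm
    (fun v z => by
      have := young_inequality A (u z) v
      rwa [mul_comm, ENNReal.coe_mul] at this) (by simpa using hfμ)
  -- The oscillating part: the three-function inequality with `B`, `Ā` and the exponential.
  have h2 := lintegral_annulus_le (Φ := toGauge B) hs (g := g)
    (ψ := fun z => u z * ENNReal.ofReal (q z ^ k))
    (G := fun z => complYoung A (u z) + ENNReal.ofReal (Real.exp (q z))) (C := 1 + C)
    (hAm.add hem)
    (fun v z => by
      have := mul_mul_pow_le hB hAB (u z) v (q := q z) (by positivity)
      rw [mul_assoc, mul_left_comm] at this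
      exact this)
    (by
      rw [lintegral_add_left' hAm.restrict, ENNReal.coe_add, add_mul, ENNReal.coe_one, one_mul]
      exact add_le_add hfμ hexp)
  set S : Set (Rn n) := {z | s < ‖z‖ ∧ ‖z‖ ≤ 2 * s}
  set V := volume (Metric.ball (0 : Rn n) (2 * s))
  have hpt : ∀ z, (g z : ℝ≥0∞) * (ENNReal.ofReal (|b z - c| ^ j) * ‖f z‖ₑ) ≤
      ENNReal.ofReal (2 ^ k) * μ * (ENNReal.ofReal ((1 + D) ^ k) * (m : ℝ≥0∞) ^ k * (g z * u z) +
        ENNReal.ofReal ((a⁻¹) ^ k) * (g z * (u z * ENNReal.ofReal (q z ^ k)))) := fun z => by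
    have hle : |b z - c| ≤ |b z - e| + D * m := by
      have := abs_sub_le (b z) e c
      linarith
    have := ENNReal.ofReal_le_ofReal (pow_le_of_le hjk hD (by exact_mod_cast hm : (1 : ℝ) ≤ m)
      (abs_nonneg (b z - e)) ha (abs_nonneg _) hle)
    rw [ENNReal.ofReal_mul (by positivity), ENNReal.ofReal_add (by positivity) (by positivity),
      ENNReal.ofReal_mul (by positivity), ENNReal.ofReal_mul (by positivity)] at this
    rw [hu]
    calc _ ≤ (g z : ℝ≥0∞) * (ENNReal.ofReal (2 ^ k) * (ENNReal.ofReal ((1 + D) ^ k) *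
          ENNReal.ofReal ((m : ℝ) ^ k) + ENNReal.ofReal ((a⁻¹) ^ k) *
          ENNReal.ofReal ((a * |b z - e|) ^ k)) * (μ * u z)) := by gcongr
      _ = _ := by
        rw [ENNReal.ofReal_pow (Nat.cast_nonneg m) k, ENNReal.ofReal_natCast]; ring
  have hgu : AEMeasurable (fun z => (g z : ℝ≥0∞) * u z) volume :=
    hg.coe_nnreal_ennreal.mul hum.coe_nnreal_ennreal
  have hgq : AEMeasurable (fun z => (g z : ℝ≥0∞) * (u z * ENNReal.ofReal (q z ^ k))) volume :=
    hg.coe_nnreal_ennreal.mul (hum.coe_nnreal_ennreal.mul (hqm.pow_const k).ennreal_ofReal)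
  calc _ ≤ _ := lintegral_mono hpt
    _ = ENNReal.ofReal (2 ^ k) * μ * (ENNReal.ofReal ((1 + D) ^ k) * (m : ℝ≥0∞) ^ k *
          (∫⁻ z in S, g z * u z) + ENNReal.ofReal ((a⁻¹) ^ k) *
          ∫⁻ z in S, g z * (u z * ENNReal.ofReal (q z ^ k))) := by
        rw [lintegral_const_mul' _ _ (by finiteness), lintegral_add_left' ((hgu.const_mul _).restrict),
          lintegral_const_mul' _ _ (by finiteness), lintegral_const_mul' _ _ (by finiteness)]
    _ ≤ ENNReal.ofReal (2 ^ k) * μ * (ENNReal.ofReal ((1 + D) ^ k) * (m : ℝ≥0∞) ^ k *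
          ((1 + (1 : ℝ≥0)) * V * luxAnnulus (toGauge A) s g) + ENNReal.ofReal ((a⁻¹) ^ k) *
          ((1 + (1 + C : ℝ≥0)) * V * luxAnnulus (toGauge B) s g)) := by gcongr
    _ = _ := by
        push_cast
        rw [← add_assoc, one_add_one_eq_two]; ring

/-- Smoothness estimate for the part of the commutator coming from far away. -/
lemma exists_far_le {k : ℕ} {A B : ℝ≥0 → ℝ≥0} (hB : IsYoung B)
    (hAB : ∀ t : ℝ≥0, 1 ≤ t → youngInv (complYoung A) t * youngInv (toGauge B) t *
        ENNReal.ofReal (Real.log t ^ k) ≤ t) {K : Rn n → X} (hK : AEStronglyMeasurable K volume)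
    (hKB : HormanderDagger (toGauge B) 0 K) (hKA : HormanderDagger (toGauge A) k K)
    {L : ℝ≥0} (hL : 1 ≤ L) :
    ∃ c : ℝ, 1 < c ∧ ∃ C : ℝ≥0, ∀ b : Rn n → ℝ, UnitOscillation b → ∀ f : Rn n → ℝ,
      AEStronglyMeasurable f volume → ∀ μ : ℝ≥0, 0 < μ → ∀ (x₀ : Rn n) (R : ℝ), 0 < R →
      (∀ r, R ≤ r → ∫⁻ y in Metric.ball x₀ r, complYoung A (‖f y‖₊ / μ) ≤
        volume (Metric.ball x₀ r)) → ∀ d : ℝ,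
      (∫⁻ y in Metric.ball x₀ (2 * R), ‖b y - d‖ₑ ≤ L * volume (Metric.ball x₀ (2 * R))) →
      ∀ j ≤ k, ∀ g : Rn n → ℝ, (∀ y, ‖g y‖ₑ ≤ ENNReal.ofReal (|b y - d| ^ j) * ‖f y‖ₑ) →
      (∀ y, ‖x₀ - y‖ ≤ 2 * R → g y = 0) → ∀ x : Rn n, c * ‖x₀ - x‖ < R → ∀ v v₀ : X,
      IsSingularIntegralValue K g x v → IsSingularIntegralValue K g x₀ v₀ → ‖v - v₀‖ ≤ C * μ := by
  obtain ⟨a, ha, CJ, hJN⟩ := exists_lintegral_ball_exp_le n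
  obtain ⟨cB, hcB, CB, hCB⟩ := hKB
  obtain ⟨cA, hcA, CA, hCA⟩ := hKA
  set V := volume (Metric.ball (0 : Rn n) 1)
  have hV : V ≠ ∞ := measure_ball_lt_top.ne
  set D : ℝ := L * (1 + 2 ^ n)
  set E : ℝ≥0∞ := ENNReal.ofReal (2 ^ k) * (2 ^ n * V)
  set EA : ℝ≥0∞ := E * (ENNReal.ofReal ((1 + D) ^ k) * 2)
  set EB : ℝ≥0∞ := E * (ENNReal.ofReal ((a⁻¹) ^ k) * (2 + CJ))
  have hEA : EA ≠ ∞ := by simp only [EA, E]; finiteness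
  have hEB : EB ≠ ∞ := by simp only [EB, E]; finiteness
  refine ⟨max cA cB, lt_max_of_lt_left hcA, EA.toNNReal * (CA + 1) + EB.toNNReal * (CB + 1), ?_⟩
  intro b hb f hf μ hμ x₀ R hR hfμ d hd j hjk g hgle hg0 x hx v v₀ hv hv₀
  set h := x₀ - x
  have hhA : cA * ‖h‖ < R := lt_of_le_of_lt (by gcongr; exact le_max_left _ _) hx
  have hhB : cB * ‖h‖ < R := lt_of_le_of_lt (by gcongr; exact le_max_right _ _) hx
  have hhR : ‖h‖ < R := lt_of_le_of_lt (by nlinarith [norm_nonneg h]) hhA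
  obtain ⟨vA, hvA, hvAn⟩ := exists_of_seqNorm_le (hCA h R hhA)
  obtain ⟨vB, hvB, hvBn⟩ := exists_of_seqNorm_le (hCB h R hhB)
  obtain ⟨e, he⟩ := exists_dilate_constants hb hR hL hd
  -- In each coordinate the sum over annuli reproduces exactly the sequences in the two dagger
  -- conditions, here realized by elements `vA`, `vB` of `X`.
  have hkey : ∀ l, ‖coord (v - v₀) l‖ₑ ≤ μ * (EA * ENNReal.ofReal (coord vA l) +
      EB * ENNReal.ofReal (coord vB l)) := by
    intro l
    obtain ⟨ℓ, hℓ⟩ := exists_coord_continuousLinearMap X l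
    obtain ⟨hi, heq⟩ := (hv l).integrable_and_eq hR fun y hy => by
      rw [hg0 y, mul_zero]
      have h1 : ‖x₀ - y‖ ≤ ‖x₀ - x‖ + ‖x - y‖ := by simpa using norm_add_le (x₀ - x) (x - y)
      linarith
    obtain ⟨hi₀, heq₀⟩ := (hv₀ l).integrable_and_eq hR fun y hy => by
      rw [hg0 y (by linarith), mul_zero]
    have h1 : coord (v - v₀) l = ∫ y, (coord (K (x - y)) l - coord (K (x₀ - y)) l) * g y := by
      rw [map_sub, Pi.sub_apply, heq, heq₀, ← integral_sub hi hi₀]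
      simp_rw [sub_mul]
    set G : Rn n → ℝ≥0 := fun z => ‖coord (K (z - h)) l - coord (K z) l‖₊
    have hGm : AEMeasurable G volume := by
      have hc : AEStronglyMeasurable (fun z => coord (K z) l) volume := by
        simp_rw [← hℓ]; exact ℓ.continuous.comp_aestronglyMeasurable hK
      exact ((hc.comp_quasiMeasurePreserving (measurePreserving_sub_right volume
        h).quasiMeasurePreserving).sub hc).nnnorm.aemeasurable
    have hsub := (Measure.measurePreserving_sub_left (volume : Measure (Rn n))
      x₀).quasiMeasurePreserving
    have hfm : AEStronglyMeasurable (fun z => f (x₀ - z)) volume :=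
      hf.comp_quasiMeasurePreserving hsub
    have hbm : AEStronglyMeasurable (fun z => b (x₀ - z)) volume :=
      hb.1.aestronglyMeasurable.comp_quasiMeasurePreserving hsub
    have h2 : ‖coord (v - v₀) l‖ₑ ≤ ∫⁻ z in {z | 2 * R < ‖z‖}, G z *
        (ENNReal.ofReal (|b (x₀ - z) - d| ^ j) * ‖f (x₀ - z)‖ₑ) := by
      rw [h1]
      calc _ ≤ ∫⁻ y, ‖(coord (K (x - y)) l - coord (K (x₀ - y)) l) * g y‖ₑ :=
            enorm_integral_le_lintegral_enorm _
        _ = ∫⁻ z, G z * ‖g (x₀ - z)‖ₑ := by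
            rw [← lintegral_sub_left_eq_self _ x₀]
            refine lintegral_congr fun z => ?_
            rw [enorm_mul, enorm_eq_nnnorm (coord _ l - _), show x - (x₀ - z) = z - h by
              simp only [h]; abel, sub_sub_cancel]
        _ = ∫⁻ z in {z | 2 * R < ‖z‖}, G z * ‖g (x₀ - z)‖ₑ := by
            refine (setLIntegral_eq_of_support_subset ?_).symm
            intro z hz
            by_contra hcon
            refine hz ?_
            simp only
            rw [hg0 (x₀ - z) (by rw [sub_sub_cancel]; exact not_lt.1 hcon), enorm_zero, mul_zero]
        _ ≤ _ := lintegral_mono fun z => by gcongr; exact hgle _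
    refine h2.trans ((lintegral_far_le hR _).trans ?_)
    rw [(hvA l).2, (hvB l).2, ← ENNReal.tsum_mul_left, ← ENNReal.tsum_mul_left, ← ENNReal.tsum_add,
      ← ENNReal.tsum_mul_left]
    refine ENNReal.tsum_le_tsum fun m => ?_
    have hs : 0 < 2 ^ (m : ℕ) * R := by positivity
    have h2m : (1 : ℝ) ≤ 2 ^ (m : ℕ) := one_le_pow₀ one_le_two
    have hvolx : volume (Metric.ball x₀ (2 * (2 ^ (m : ℕ) * R))) =
        volume (Metric.ball (0 : Rn n) (2 * (2 ^ (m : ℕ) * R))) :=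
      Measure.addHaar_ball_center _ _ _
    have hann := lintegral_annulus_commutator_le hjk hB hAB ha (C := CJ) (D := D) (by positivity) hs
      hGm hfm hbm hμ (c := d) (e := e m) (m := m) m.pos (he m).1 (by
        rw [setLIntegral_ball_sub_left fun y => ENNReal.ofReal (Real.exp (a * |b y - e m|)), ← hvolx]
        exact hJN b hb x₀ _ (by positivity) _ ((he m).2 m.pos.ne')) (by
        rw [setLIntegral_ball_sub_left fun y => complYoung A (‖f y‖₊ / μ), ← hvolx]
        exact hfμ _ (by nlinarith))
    refine hann.trans (le_of_eq ?_)
    rw [volume_ball_two_mul hs]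
    simp only [EA, EB, E, pow_zero, mul_one]
    ring
  -- A majorant in `X` of all coordinates at once; solidity turns the coordinatewise bound into a
  -- norm bound.
  set w : X := (μ : ℝ) • ((EA.toNNReal : ℝ) • vA + (EB.toNNReal : ℝ) • vB)
  have hw : ∀ l, |coord (v - v₀) l| ≤ |coord w l| := by
    intro l
    have h1 := hkey l
    obtain ⟨hA0, -⟩ := hvA l
    obtain ⟨hB0, -⟩ := hvB l
    have h2 : (μ : ℝ≥0∞) * (EA * ENNReal.ofReal (coord vA l) + EB * ENNReal.ofReal (coord vB l)) =
        ENNReal.ofReal (coord w l) := by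
      have h3 : coord w l = μ * (EA.toNNReal * coord vA l + EB.toNNReal * coord vB l) := by
        simp only [w, map_smul, map_add, Pi.smul_apply, Pi.add_apply, smul_eq_mul]
      rw [h3, ENNReal.ofReal_mul (by positivity), ENNReal.ofReal_add (by positivity) (by positivity),
        ENNReal.ofReal_mul (by positivity), ENNReal.ofReal_mul (by positivity),
        ENNReal.ofReal_coe_nnreal, ENNReal.ofReal_coe_nnreal, ENNReal.ofReal_coe_nnreal,
        ENNReal.coe_toNNReal hEA, ENNReal.coe_toNNReal hEB]
    have hw0 : 0 ≤ coord w l := by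
      simp only [w, map_smul, map_add, Pi.smul_apply, Pi.add_apply, smul_eq_mul]; positivity
    rw [h2, ← ofReal_norm, ENNReal.ofReal_le_ofReal_iff hw0] at h1
    exact h1.trans (le_abs_self _)
  obtain ⟨u, hu, hun⟩ := MonotoneSequenceSpace.solid w (coord (v - v₀)) hw
  rw [← MonotoneSequenceSpace.coord_injective hu]
  refine hun.trans ?_
  calc ‖w‖ ≤ μ * (EA.toNNReal * (CA + 1) + EB.toNNReal * (CB + 1)) := by
        simp only [w]
        rw [norm_smul, Real.norm_of_nonneg (NNReal.coe_nonneg _)]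
        gcongr
        refine (norm_add_le _ _).trans ?_
        rw [norm_smul, norm_smul, Real.norm_of_nonneg (NNReal.coe_nonneg _),
          Real.norm_of_nonneg (NNReal.coe_nonneg _)]
        gcongr
    _ = _ := by push_cast; ring

end Oscillation

/-! ### Oscillation of commutators on dyadic cubes -/

section CommutatorOscillation

variable {n : ℕ} {X : Type*} [NormedAddCommGroup X] [NormedSpace ℝ X] [MonotoneSequenceSpace X]

/-- The three-function inequality with `v` frozen at a point where `B v ≤ 1`, combined with
John-Nirenberg. It bounds the `L¹` norm of the near part before the weak type inequality is applied.
-/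
lemma exists_lintegral_local_le (n : ℕ) {k : ℕ} {A B : ℝ≥0 → ℝ≥0} (hB : IsYoung B)
    (hAB : ∀ t : ℝ≥0, 1 ≤ t → youngInv (complYoung A) t * youngInv (toGauge B) t *
        ENNReal.ofReal (Real.log t ^ k) ≤ t) :
    ∃ C : ℝ≥0, ∀ b : Rn n → ℝ, UnitOscillation b → ∀ f : Rn n → ℝ, AEStronglyMeasurable f volume →
      ∀ μ : ℝ≥0, 0 < μ → ∀ (x : Rn n) (r : ℝ), 0 < r →
      (∫⁻ y in Metric.ball x r, complYoung A (‖f y‖₊ / μ) ≤ volume (Metric.ball x r)) → ∀ d : ℝ,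
      (∫⁻ y in Metric.ball x r, ‖b y - d‖ₑ ≤ volume (Metric.ball x r)) → ∀ j ≤ k,
      ∫⁻ y in Metric.ball x r, ENNReal.ofReal (|b y - d| ^ j) * ‖f y‖ₑ ≤
        C * μ * volume (Metric.ball x r) := by
  obtain ⟨a, ha, CJ, hJN⟩ := exists_lintegral_ball_exp_le n
  obtain ⟨v, hv, hBv⟩ := hB.exists_pos_le_one
  refine ⟨2 ^ k * ((A 1 + 1) + (a⁻¹ ^ k).toNNReal * v⁻¹ * (1 + (1 + CJ))), ?_⟩
  intro b hb f hf μ hμ x r hr hfμ d hd j hjk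
  set S := Metric.ball x r
  set u : Rn n → ℝ≥0 := fun z => ‖f z‖₊ / μ
  have hu : ∀ z, ‖f z‖ₑ = μ * u z := fun z => by
    rw [enorm_eq_nnnorm, ← ENNReal.coe_mul, mul_div_cancel₀ _ hμ.ne']
  set q : Rn n → ℝ := fun z => a * |b z - d|
  have hum : AEMeasurable u volume := hf.nnnorm.aemeasurable.div_const μ
  have hAm : AEMeasurable (fun z => complYoung A (u z)) volume :=
    (complYoung_mono A).measurable.comp_aemeasurable hum
  have hbm : AEMeasurable b volume := hb.1.aestronglyMeasurable.aemeasurable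
  have hqm : AEMeasurable q volume :=
    ((continuous_abs.measurable.comp_aemeasurable (hbm.sub_const d)).const_mul a)
  have hem : AEMeasurable (fun z => ENNReal.ofReal (Real.exp (q z))) volume :=
    (Real.measurable_exp.comp_aemeasurable hqm).ennreal_ofReal
  have hm : AEMeasurable (fun z => A 1 + complYoung A (u z)) volume :=
    aemeasurable_const.add hAm
  have hv' : (v : ℝ≥0∞) ≠ 0 := by simpa using hv.ne'
  have hpt : ∀ z, ENNReal.ofReal (|b z - d| ^ j) * ‖f z‖ₑ ≤
      2 ^ k * μ * ((A 1 + complYoung A (u z)) + ENNReal.ofReal (a⁻¹ ^ k) * (v : ℝ≥0∞)⁻¹ *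
        (1 + (complYoung A (u z) + ENNReal.ofReal (Real.exp (q z))))) := fun z => by
    have h1 := ENNReal.ofReal_le_ofReal (pow_le_of_le hjk le_rfl (le_refl (1 : ℝ))
      (abs_nonneg (b z - d)) ha (abs_nonneg _) (by simp : |b z - d| ≤ |b z - d| + 0 * 1))
    rw [ENNReal.ofReal_mul (by positivity), ENNReal.ofReal_add (by positivity) (by positivity),
      ENNReal.ofReal_mul (by positivity), ENNReal.ofReal_mul (by positivity)] at h1
    have h2 : (u z : ℝ≥0∞) ≤ A 1 + complYoung A (u z) := by
      simpa using young_inequality A (u z) 1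
    have h3 : ENNReal.ofReal (q z ^ k) * u z ≤ (v : ℝ≥0∞)⁻¹ *
        (1 + (complYoung A (u z) + ENNReal.ofReal (Real.exp (q z)))) := by
      rw [mul_comm (v : ℝ≥0∞)⁻¹, ← div_eq_mul_inv, ENNReal.le_div_iff_mul_le (.inl hv') (.inl (by simp))]
      have := mul_mul_pow_le hB hAB (u z) v (q := q z) (by positivity)
      calc _ = (u z : ℝ≥0∞) * v * ENNReal.ofReal (q z ^ k) := by ring
        _ ≤ _ := this.trans (by gcongr; exact_mod_cast hBv)
    rw [hu]
    calc _ ≤ _ := mul_le_mul_left h1 _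
      _ = 2 ^ k * μ * (u z + ENNReal.ofReal (a⁻¹ ^ k) * (ENNReal.ofReal (q z ^ k) * u z)) := by
          simp only [q]
          rw [ENNReal.ofReal_pow zero_le_two]
          simp
          ring
      _ ≤ _ := by
          rw [mul_assoc (ENNReal.ofReal _)]
          gcongr
  calc _ ≤ _ := lintegral_mono hpt
    _ = 2 ^ k * μ * ((A 1 * volume S + ∫⁻ z in S, complYoung A (u z)) +
          ENNReal.ofReal (a⁻¹ ^ k) * (v : ℝ≥0∞)⁻¹ *
          (volume S + ((∫⁻ z in S, complYoung A (u z)) +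
            ∫⁻ z in S, ENNReal.ofReal (Real.exp (q z))))) := by
        rw [lintegral_const_mul' _ _ (by finiteness), lintegral_add_left'
          hm.restrict, lintegral_add_left' aemeasurable_const, lintegral_const_mul' _ _ (by finiteness),
          lintegral_add_left' aemeasurable_const, lintegral_add_left' hAm.restrict, setLIntegral_const,
          setLIntegral_one]
    _ ≤ 2 ^ k * μ * ((A 1 * volume S + volume S) + ENNReal.ofReal (a⁻¹ ^ k) * (v : ℝ≥0∞)⁻¹ *
          (volume S + (volume S + CJ * volume S))) :=
        mul_le_mul_right (add_le_add (add_le_add le_rfl hfμ) (mul_le_mul_right (add_le_add le_rfl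
          (add_le_add hfμ (hJN b hb x r hr d hd))) _)) _
    _ = _ := by
        push_cast
        rw [ENNReal.coe_inv hv.ne', ENNReal.ofReal]
        ring

lemma IsBoundedCompact.bounded_mul {f h : Rn n → ℝ} (hf : IsBoundedCompact f)
    (hh : AEStronglyMeasurable h volume) {N : ℝ} (hN : ∀ y, ‖h y‖ ≤ N) :
    IsBoundedCompact fun y => h y * f y :=
  ⟨hf.1.mul (memLp_top_of_bound hh N (.of_forall hN)), hf.2.mul_left⟩

/-- The function `y ↦ (d - b y) ^ j * f y` in terms of commutators. -/
lemma isSingularIntegralValue_of_commutators {K : Rn n → X} {b f : Rn n → ℝ} {j : ℕ} (d : ℝ)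
    {x : Rn n} {v : ℕ → X} (hv : ∀ i ≤ j, IsCommutatorValue K b i f x (v i)) :
    IsSingularIntegralValue K (fun y => (d - b y) ^ j * f y) x
      (∑ i ∈ Finset.range (j + 1), ((d - b x) ^ (j - i) * (j.choose i : ℝ)) • v i) := fun l => by
  have h := HasPV.sum (s := Finset.range (j + 1)) fun i hi =>
    (hv i (Finset.mem_range_succ_iff.1 hi) l).const_mul ((d - b x) ^ (j - i) * (j.choose i : ℝ))
  simp only [map_sum, map_smul, Finset.sum_apply, Pi.smul_apply, smul_eq_mul]
  convert h using 2 with y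
  rw [show d - b y = (b x - b y) + (d - b x) by ring, add_pow, Finset.sum_mul, Finset.mul_sum]
  refine Finset.sum_congr rfl fun i _ => ?_
  ring

/-- Commutators in terms of the functions `b ^ i * f`. -/
lemma isCommutatorValue_of_powers {K : Rn n → X} {b f : Rn n → ℝ} {j : ℕ}
    {x : Rn n} {v : ℕ → X}
    (hv : ∀ i ≤ j, IsSingularIntegralValue K (fun y => b y ^ i * f y) x (v i)) :
    IsCommutatorValue K b j f x
      (∑ i ∈ Finset.range (j + 1), ((-1) ^ i * b x ^ (j - i) * (j.choose i : ℝ)) • v i) :=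
      fun l => by
  have h := HasPV.sum (s := Finset.range (j + 1)) fun i hi =>
    (hv i (Finset.mem_range_succ_iff.1 hi) l).const_mul
      ((-1) ^ i * b x ^ (j - i) * (j.choose i : ℝ))
  simp only [map_sum, map_smul, Finset.sum_apply, Pi.smul_apply, smul_eq_mul]
  convert h using 2 with y
  rw [show b x - b y = -b y + b x by ring, add_pow, Finset.sum_mul, Finset.sum_mul]
  refine Finset.sum_congr rfl fun i _ => ?_
  rw [neg_pow]
  ring

lemma IsCommutatorValue.unique {K : Rn n → X} {b f : Rn n → ℝ} {j : ℕ} {x : Rn n} {v v' : X}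
    (hv : IsCommutatorValue K b j f x v) (hv' : IsCommutatorValue K b j f x v') : v = v' :=
  MonotoneSequenceSpace.coord_injective (funext fun l => (hv l).unique (hv' l))

/-- The commutator of order `j` oscillates little on a dyadic cube if the commutators of lower order
and the maximal function are small there. -/
lemma exists_oscillation_le [CompleteSpace X] (hn : 1 ≤ n) {k : ℕ} {A B : ℝ≥0 → ℝ≥0} (hB : IsYoung B)
    (hAB : ∀ t : ℝ≥0, 1 ≤ t → youngInv (complYoung A) t * youngInv (toGauge B) t *
        ENNReal.ofReal (Real.log t ^ k) ≤ t) {K : Rn n → X} (hK : IsSingularIntegralKernel K)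
    (hKB : HormanderDagger (toGauge B) 0 K) (hKA : HormanderDagger (toGauge A) k K)
    {s' : ℝ≥0} (hs' : 0 < s') :
    ∃ κ s'' : ℝ≥0, 0 < s'' ∧ ∀ b : Rn n → ℝ, UnitOscillation b → ∀ N : ℝ, (∀ y, ‖b y‖ ≤ N) →
      ∀ f : Rn n → ℝ, IsBoundedCompact f → ∀ F : ℕ → Rn n → X,
      (∀ j ≤ k, ∀ᵐ x, IsCommutatorValue K b j f x (F j x)) → ∀ μ : ℝ≥0, 0 < μ → ∀ j ≤ k,
      ∀ P, ∀ x₀ ∈ cube P, youngMaximal (complYoung A) f x₀ < μ →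
      (∀ i < j, volume (cube P ∩ {x | (μ : ℝ) < ‖F i x‖}) ≤ s'' * volume (cube P)) →
      ∃ c, volume (cube P ∩ {x | (κ * μ : ℝ) < ‖F j x - c‖}) ≤ s' * volume (cube P) := by
  obtain ⟨Cw, hCw⟩ := hK.exists_weak_type hn
  -- `L = 2^n` because the constant `d` belongs to a ball of radius `3 R` but is used on one of
  -- radius `2 R`, and `3/2 ≤ 2`.
  obtain ⟨c, hc, Cf, hCf⟩ := exists_far_le hB hAB hK.aestronglyMeasurable hKB hKA
    (L := 2 ^ n) (one_le_pow₀ one_le_two)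
  obtain ⟨Cl, hCl⟩ := exists_lintegral_local_le n hB hAB
  obtain ⟨C₄, hC₄⟩ := exists_volume_closedBall_le_cube n (3 * (c * (n + 1)))
  -- `Λ` and `τ` give the near part (weak type) and the set of large `|b - d|` (Chebyshev) at most
  -- `s'/4` each; the lower commutators, fewer than `k + 1` in number, share `s'/2` through `s''`.
  set Λ : ℝ≥0 := 4 * (Cw * Cl * C₄) / s' + 1
  set τ : ℝ≥0 := 4 * C₄ / s' + 1
  refine ⟨Λ + Cf + (1 + τ) ^ k, s' / (2 * (k + 1)), by positivity, ?_⟩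
  intro b hb N hN f hf F hF μ hμ j hjk P x₀ hx₀ hMx hlow
  set R : ℝ := c * (n + 1) * 2 ^ P.1
  have hR : 0 < R := by positivity
  have hdiam : ∀ x ∈ cube P, ∀ y ∈ cube P, c * ‖x - y‖ < R := fun x hx y hy => by
    have h1 := norm_sub_le_of_mem_cube hx hy
    have h2 : (0 : ℝ) < 2 ^ P.1 := by positivity
    calc c * ‖x - y‖ ≤ c * (n * 2 ^ P.1) := by gcongr
      _ < R := by simp only [R]; nlinarith
  have hdist : ∀ x ∈ cube P, ∀ y ∈ cube P, ‖x - y‖ < R := fun x hx y hy =>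
    lt_of_le_of_lt (by nlinarith [norm_nonneg (x - y)]) (hdiam x hx y hy)
  set S := Metric.ball x₀ (3 * R)
  have hfμ : ∀ x ∈ cube P, ∀ r, R ≤ r → ∫⁻ y in Metric.ball x r, complYoung A (‖f y‖₊ / μ) ≤
      volume (Metric.ball x r) := fun x hx r hr =>
    lintegral_le_of_youngMaximal_lt (complYoung_mono A) hMx (by
      rw [Metric.mem_ball, dist_eq_norm]; exact (hdist _ hx₀ _ hx).trans_le hr)
  have hSP : volume S ≤ C₄ * volume (cube P) :=
    (measure_mono Metric.ball_subset_closedBall).trans (hC₄ P x₀ _ (by simp only [R]; linarith))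
  have hPS : cube P ⊆ S := fun y hy => by
    rw [Metric.mem_ball, dist_eq_norm]; linarith [hdist y hy x₀ hx₀]
  obtain ⟨d, hd⟩ := hb.2 x₀ (3 * R) (by positivity)
  have hdN : ∀ y, ‖(d - b y) ^ j‖ ≤ (|d| + N) ^ j := fun y => by
    rw [norm_pow]
    exact pow_le_pow_left₀ (norm_nonneg _) ((norm_sub_le _ _).trans (add_le_add le_rfl (hN y))) j
  have hbm := hb.1.aestronglyMeasurable
  have hg : IsBoundedCompact fun y => (d - b y) ^ j * f y :=
    hf.bounded_mul ((aestronglyMeasurable_const.sub hbm).pow j) hdN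
  set g : Rn n → ℝ := fun y => (d - b y) ^ j * f y
  set g₁ := S.indicator g
  have hg₁ : IsBoundedCompact g₁ :=
    isBoundedCompact_indicator hg.1 measurableSet_ball Metric.isBounded_ball
  have hgle : ∀ y, ‖g y‖ₑ = ENNReal.ofReal (|b y - d| ^ j) * ‖f y‖ₑ := fun y => by
    simp only [g]
    rw [enorm_mul, enorm_pow, Real.enorm_eq_ofReal_abs (d - b y), abs_sub_comm,
      ENNReal.ofReal_pow (abs_nonneg _)]
  obtain ⟨p, hp, Cp, hstrong⟩ := hK.exists_eLpNorm_le
  obtain ⟨G₁, hG₁⟩ := (hstrong g₁ (hg₁.memLp _) hg₁.2).1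
  have hFall : ∀ᵐ x, ∀ i ≤ j, IsCommutatorValue K b i f x (F i x) := by
    rw [ae_all_iff]; intro i
    rw [ae_all_iff]; exact fun hi => hF i (hi.trans hjk)
  -- `G` is `T((d - b)^j f)` in terms of commutators; its term `i = j` is `F j` with coefficient 1.
  -- So `F j` is the far part `G - G₁`, plus the near part `G₁`, minus lower orders.
  set G : Rn n → X := fun x =>
    ∑ i ∈ Finset.range (j + 1), ((d - b x) ^ (j - i) * (j.choose i : ℝ)) • F i x
  have hG : ∀ᵐ x, IsSingularIntegralValue K (g - g₁) x (G x - G₁ x) := by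
    filter_upwards [hFall, hG₁] with x h1 h2
    exact (isSingularIntegralValue_of_commutators d h1).sub h2
  -- The principal values may fail to exist at `x₀`, so the reference vector is taken at another
  -- point of the cube.
  obtain ⟨x₁, hx₁, hGx₁⟩ : ∃ x₁ ∈ cube P, IsSingularIntegralValue K (g - g₁) x₁ (G x₁ - G₁ x₁) := by
    by_contra! hcon
    exact (volume_cube_pos P).ne' (measure_mono_null (fun x hx => hcon x hx) (ae_iff.1 hG))
  have hfar : ∀ x ∈ cube P, IsSingularIntegralValue K (g - g₁) x (G x - G₁ x) →
      ‖(G x - G₁ x) - (G x₁ - G₁ x₁)‖ ≤ Cf * μ := fun x hx hGx => by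
    refine hCf b hb f hf.1.1 μ hμ x₁ R hR (hfμ x₁ hx₁) d ?_ j hjk (g - g₁) (fun y => ?_)
      (fun y hy => ?_) x (hdiam x₁ hx₁ x hx) _ _ hGx hGx₁
    · refine (lintegral_mono_set (Metric.ball_subset_ball' ?_)).trans (hd.trans ?_)
      · rw [dist_eq_norm]; linarith [hdist x₁ hx₁ x₀ hx₀]
      · rw [Measure.addHaar_ball_of_pos _ x₀ (by positivity : 0 < 3 * R),
          Measure.addHaar_ball_of_pos _ x₁ (by positivity : 0 < 2 * R), finrank_euclideanSpace_fin,
          ← mul_assoc ((2 ^ n : ℝ≥0) : ℝ≥0∞)]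
        refine mul_le_mul' ?_ le_rfl
        rw [ENNReal.coe_pow, ENNReal.coe_ofNat, ← ENNReal.ofReal_ofNat, ← ENNReal.ofReal_pow
          zero_le_two, ← ENNReal.ofReal_mul (by positivity), ← mul_pow]
        exact ENNReal.ofReal_le_ofReal (pow_le_pow_left₀ (by positivity) (by linarith) n)
    · rw [← hgle]
      by_cases hy : y ∈ S
      · simp [g₁, Set.indicator_of_mem hy]
      · simp [g₁, Set.indicator_of_notMem hy]
    · have hyS : y ∈ S := by
        rw [Metric.mem_ball, dist_comm, dist_eq_norm]
        have h1 : ‖x₀ - y‖ ≤ ‖x₀ - x₁‖ + ‖x₁ - y‖ := by simpa using norm_add_le (x₀ - x₁) (x₁ - y)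
        linarith [hdist x₀ hx₀ x₁ hx₁]
      simp [g₁, Set.indicator_of_mem hyS]
  refine ⟨G x₁ - G₁ x₁, ?_⟩
  set Z : Set (Rn n) := {x | ¬ ((∀ i ≤ j, IsCommutatorValue K b i f x (F i x)) ∧
    IsSingularIntegralValue K (g - g₁) x (G x - G₁ x))}
  have hZ : volume Z = 0 := ae_iff.1 (hFall.and hG)
  have hcover : cube P ∩ {x | ((Λ + Cf + (1 + τ) ^ k : ℝ≥0) * μ : ℝ) <
      ‖F j x - (G x₁ - G₁ x₁)‖} ⊆ ({x | ((Λ * μ : ℝ≥0) : ℝ≥0∞) < ‖G₁ x‖ₑ} ∪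
        (S ∩ {x | (τ : ℝ≥0∞) ≤ ‖b x - d‖ₑ})) ∪
        ((⋃ i ∈ Finset.range j, cube P ∩ {x | (μ : ℝ) < ‖F i x‖}) ∪ Z) := by
    rintro x ⟨hxP, hx⟩
    by_contra hcon
    have h1 : ‖G₁ x‖ ≤ Λ * μ := by
      by_contra hlt
      refine hcon (.inl (.inl ?_))
      rw [Set.mem_ofPred_eq, ← ofReal_norm, ← ENNReal.ofReal_coe_nnreal]
      exact (ENNReal.ofReal_lt_ofReal_iff_of_nonneg (by positivity)).2 (by
        rw [NNReal.coe_mul]; exact not_le.1 hlt)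
    have h2 : |d - b x| ≤ τ := by
      by_contra hlt
      refine hcon (.inl (.inr ⟨hPS hxP, ?_⟩))
      rw [Set.mem_ofPred_eq, ← ofReal_norm, ← ENNReal.ofReal_coe_nnreal, Real.norm_eq_abs, abs_sub_comm]
      exact ENNReal.ofReal_le_ofReal (not_le.1 hlt).le
    have h3 : ∀ i < j, ‖F i x‖ ≤ μ := fun i hi => by
      by_contra hlt
      exact hcon (.inr (.inl (Set.mem_biUnion (Finset.mem_coe.2 (Finset.mem_range.2 hi))
        ⟨hxP, not_le.1 hlt⟩)))
    have h4 : IsSingularIntegralValue K (g - g₁) x (G x - G₁ x) := by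
      by_contra hne
      exact hcon (.inr (.inr fun h => hne h.2))
    have h5 : F j x - (G x₁ - G₁ x₁) = ((G x - G₁ x) - (G x₁ - G₁ x₁)) + G₁ x -
        ∑ i ∈ Finset.range j, ((d - b x) ^ (j - i) * (j.choose i : ℝ)) • F i x := by
      have : G x = (∑ i ∈ Finset.range j, ((d - b x) ^ (j - i) * (j.choose i : ℝ)) • F i x) +
          F j x := by simp [G, Finset.sum_range_succ]
      rw [this]; abel
    have h6 : ‖∑ i ∈ Finset.range j, ((d - b x) ^ (j - i) * (j.choose i : ℝ)) • F i x‖ ≤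
        (1 + τ) ^ k * μ := by
      calc _ ≤ ∑ i ∈ Finset.range j, 1 ^ i * (τ : ℝ) ^ (j - i) * (j.choose i : ℝ) * μ := by
            refine norm_sum_le_of_le _ fun i hi => ?_
            rw [norm_smul, norm_mul, norm_pow, Real.norm_natCast, Real.norm_eq_abs, one_pow, one_mul]
            gcongr
            exact h3 i (Finset.mem_range.1 hi)
        _ = (∑ i ∈ Finset.range j, 1 ^ i * (τ : ℝ) ^ (j - i) * (j.choose i : ℝ)) * μ :=
            (Finset.sum_mul _ _ _).symm
        _ ≤ (1 + τ) ^ j * μ := by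
            rw [add_pow]
            gcongr
            exact Nat.le_succ j
        _ ≤ _ := by
            gcongr
            exact le_add_of_nonneg_right τ.2
    rw [Set.mem_ofPred_eq] at hx
    refine hx.not_ge ?_
    rw [h5]
    calc _ ≤ (‖(G x - G₁ x) - (G x₁ - G₁ x₁)‖ + ‖G₁ x‖) + _ :=
          (norm_sub_le _ _).trans (add_le_add (norm_add_le _ _) h6)
      _ ≤ (Cf * μ + Λ * μ) + (1 + τ) ^ k * μ :=
          add_le_add (add_le_add (hfar x hxP h4) h1) le_rfl
      _ = _ := by push_cast; ring
  have hm₁ : volume {x | ((Λ * μ : ℝ≥0) : ℝ≥0∞) < ‖G₁ x‖ₑ} ≤ (s' / 4 : ℝ≥0) * volume (cube P) := by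
    have hint : ∫⁻ y, ‖g₁ y‖ₑ ≤ Cl * μ * volume S := by
      simp only [g₁, enorm_indicator_eq_indicator_enorm]
      rw [lintegral_indicator measurableSet_ball]
      simp_rw [hgle]
      exact hCl b hb f hf.1.1 μ hμ x₀ _ (by positivity) (hfμ x₀ hx₀ _ (by linarith)) d hd j hjk
    have h0 : ((Λ * μ : ℝ≥0) : ℝ≥0∞) ≠ 0 := by simp [Λ, hμ.ne']
    refine (ENNReal.mul_le_mul_iff_right h0 ENNReal.coe_ne_top).1 ?_
    calc _ ≤ _ := hCw g₁ hg₁ G₁ hG₁ (Λ * μ) (by positivity)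
      _ ≤ Cw * (Cl * μ * (C₄ * volume (cube P))) := by gcongr; exact hint.trans (by gcongr)
      _ = ((Cw * Cl * C₄ * μ : ℝ≥0) : ℝ≥0∞) * volume (cube P) := by push_cast; ring
      _ ≤ ((Λ * μ * (s' / 4) : ℝ≥0) : ℝ≥0∞) * volume (cube P) := by
          refine mul_le_mul' (ENNReal.coe_le_coe.2 ?_) le_rfl
          calc Cw * Cl * C₄ * μ ≤ (Cw * Cl * C₄ + s' / 4) * μ := by gcongr; exact le_self_add
            _ = Λ * μ * (s' / 4) := by simp only [Λ]; field_simp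
      _ = _ := by push_cast; ring
  have hm₂ : volume (S ∩ {x | (τ : ℝ≥0∞) ≤ ‖b x - d‖ₑ}) ≤ (s' / 4 : ℝ≥0) * volume (cube P) := by
    have h0 : (τ : ℝ≥0∞) ≠ 0 := by simp [τ]
    refine (ENNReal.mul_le_mul_iff_right h0 ENNReal.coe_ne_top).1 ?_
    rw [Set.inter_comm]
    calc _ ≤ τ * (volume.restrict S) {x | (τ : ℝ≥0∞) ≤ ‖b x - d‖ₑ} :=
          mul_le_mul_right (Measure.le_restrict_apply _ _) _
      _ ≤ ∫⁻ y in S, ‖b y - d‖ₑ :=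
          mul_meas_ge_le_lintegral₀ (hbm.sub aestronglyMeasurable_const).enorm.restrict _
      _ ≤ C₄ * volume (cube P) := hd.trans hSP
      _ ≤ ((τ * (s' / 4) : ℝ≥0) : ℝ≥0∞) * volume (cube P) := by
          refine mul_le_mul' (ENNReal.coe_le_coe.2 ?_) le_rfl
          calc C₄ ≤ C₄ + s' / 4 := le_self_add
            _ = τ * (s' / 4) := by simp only [τ]; field_simp
      _ = _ := by push_cast; ring
  have hm₃ : volume (⋃ i ∈ Finset.range j, cube P ∩ {x | (μ : ℝ) < ‖F i x‖}) ≤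
      (s' / 2 : ℝ≥0) * volume (cube P) := by
    calc _ ≤ ∑ i ∈ Finset.range j, volume (cube P ∩ {x | (μ : ℝ) < ‖F i x‖}) :=
          measure_biUnion_finset_le _ _
      _ ≤ ∑ _i ∈ Finset.range j, (s' / (2 * (k + 1)) : ℝ≥0) * volume (cube P) :=
          Finset.sum_le_sum fun i hi => hlow i (Finset.mem_range.1 hi)
      _ = ((j * (s' / (2 * (k + 1))) : ℝ≥0) : ℝ≥0∞) * volume (cube P) := by
          rw [Finset.sum_const, Finset.card_range, nsmul_eq_mul, ENNReal.coe_mul, mul_assoc]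
          simp
      _ ≤ _ := by
          refine mul_le_mul' (ENNReal.coe_le_coe.2 ?_) le_rfl
          calc j * (s' / (2 * (k + 1))) ≤ (k + 1) * (s' / (2 * (k + 1))) := by
                gcongr
                exact_mod_cast hjk.trans (Nat.le_succ k)
            _ = s' / 2 := by field_simp
  calc _ ≤ _ := measure_mono hcover
    _ ≤ ((s' / 4 : ℝ≥0) * volume (cube P) + (s' / 4 : ℝ≥0) * volume (cube P)) +
        ((s' / 2 : ℝ≥0) * volume (cube P) + 0) :=
        (measure_union_le _ _).trans (add_le_add ((measure_union_le _ _).trans (add_le_add hm₁ hm₂))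
          ((measure_union_le _ _).trans (add_le_add hm₃ hZ.le)))
    _ = ((s' / 4 + s' / 4 + s' / 2 : ℝ≥0) : ℝ≥0∞) * volume (cube P) := by push_cast; ring
    _ = _ := by
        congr 2
        rw [← NNReal.coe_inj]; push_cast; ring

end CommutatorOscillation

/-! ### The good-`λ` argument for commutators -/

section GoodLambda

variable {n : ℕ} {X : Type*} [NormedAddCommGroup X] [NormedSpace ℝ X] [MonotoneSequenceSpace X]

/-- `T` is bounded on `L^p`, for every version of `T f`. -/
def StrongType (K : Rn n → X) (p : ℝ) (C : ℝ≥0) : Prop :=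
  ∀ f : Rn n → ℝ, MemLp f (ENNReal.ofReal p) volume → HasCompactSupport f →
    (∃ F : Rn n → X, ∀ᵐ x, IsSingularIntegralValue K f x (F x)) ∧
      ∀ F : Rn n → X, (∀ᵐ x, IsSingularIntegralValue K f x (F x)) →
        MemLp F (ENNReal.ofReal p) volume ∧
        eLpNorm F (ENNReal.ofReal p) volume ≤ C * eLpNorm f (ENNReal.ofReal p) volume

/-- For bounded `b` the commutator is a finite combination of `b^{j-i} T(b^i f)` with bounded
coefficients. This a priori integrability serves only to make the remainder of the iteration vanish.
-/
lemma StrongType.memLp_commutator {K : Rn n → X} {p : ℝ} {C : ℝ≥0} (hT : StrongType K p C)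
    {b : Rn n → ℝ} (hb : AEStronglyMeasurable b volume) {N : ℝ} (hN : ∀ y, ‖b y‖ ≤ N)
    {f : Rn n → ℝ} (hf : IsBoundedCompact f) {j : ℕ} {F : Rn n → X}
    (hF : ∀ᵐ x, IsCommutatorValue K b j f x (F x)) : MemLp F (ENNReal.ofReal p) volume := by
  have hbp : ∀ i y, ‖b y ^ i‖ ≤ N ^ i := fun i y => by
    rw [norm_pow]; exact pow_le_pow_left₀ (norm_nonneg _) (hN y) i
  have hg : ∀ i, IsBoundedCompact fun y => b y ^ i * f y := fun i =>
    hf.bounded_mul (hb.pow i) (hbp i)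
  choose V hV using fun i => (hT _ ((hg i).memLp _) (hg i).2).1
  have hVp := fun i => ((hT _ ((hg i).memLp _) (hg i).2).2 (V i) (hV i)).1
  have hsum : MemLp (fun x => ∑ i ∈ Finset.range (j + 1),
      ((-1) ^ i * b x ^ (j - i) * (j.choose i : ℝ)) • V i x) (ENNReal.ofReal p) volume := by
    refine memLp_finsetSum _ fun i _ => ?_
    refine MemLp.of_le_mul (c := N ^ (j - i) * j.choose i) (hVp i)
      (AEStronglyMeasurable.smul (by fun_prop) (hVp i).1) (.of_forall fun x => ?_)
    rw [norm_smul, norm_mul, norm_mul, norm_pow, norm_neg, norm_one, one_pow, one_mul,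
      Real.norm_natCast]
    gcongr
    exact hbp _ _
  refine hsum.ae_eq ?_
  have hall : ∀ᵐ x, ∀ i, IsSingularIntegralValue K (fun y => b y ^ i * f y) x (V i x) :=
    ae_all_iff.2 hV
  filter_upwards [hall, hF] with x h1 h2
  exact (isCommutatorValue_of_powers fun i _ => h1 i).unique h2

lemma mul_volume_heavySet_le (hn : 1 ≤ n) {E : Set (Rn n)} {s : ℝ≥0∞} (hs : s ≠ 0)
    (hE : volume E ≠ ∞) : s * volume (heavySet E s) ≤ volume E := by
  obtain ⟨J, hJ⟩ := heavyCubes_bounded hn hs hE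
  exact (mul_volume_biUnion_le hJ subset_rfl).trans (measure_mono Set.inter_subset_right)

lemma heavySet_antitone (E : Set (Rn n)) {s s' : ℝ≥0∞} (h : s ≤ s') : heavySet E s' ⊆ heavySet E s :=
  Set.biUnion_subset_biUnion_left fun _ hQ => lt_of_le_of_lt (mul_le_mul_left h _) hQ

lemma volume_lt_norm_le {Y : Type*} [NormedAddCommGroup Y] {F : Rn n → Y} {p : ℝ} (hp : 0 < p)
    (hF : MemLp F (ENNReal.ofReal p) volume) {t : ℝ} (ht : 0 < t) : volume {x | t < ‖F x‖} ≤
      (ENNReal.ofReal t)⁻¹ ^ p * eLpNorm F (ENNReal.ofReal p) volume ^ p := by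
  have h := meas_ge_le_mul_pow_eLpNorm_enorm (volume : Measure (Rn n)) (by simpa using hp)
    ENNReal.ofReal_ne_top hF.1 (ε := ENNReal.ofReal t) (by simpa using ht) (by simp)
  rw [ENNReal.toReal_ofReal hp.le] at h
  refine (measure_mono fun x hx => ?_).trans h
  rw [Set.mem_ofPred_eq, ← ofReal_norm]
  exact ENNReal.ofReal_le_ofReal hx.le

/-- Iterating the dilation inequality until `τ^{-m} < a`; the constant `q^m` is the same for every
`H`. -/
lemma exists_le_mul_of_dilation {q : ℝ≥0} {τ : ℝ} (hτ : 1 < τ) {a : ℝ} (ha : 0 < a) :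
    ∃ C : ℝ≥0, ∀ H : ℝ → ℝ≥0∞, (∀ t t', 0 < t → t ≤ t' → H t' ≤ H t) →
      (∀ t, 0 < t → H (t / τ) ≤ q * H t) → ∀ t, 0 < t → H (a * t) ≤ C * H t := by
  obtain ⟨m, hm⟩ := exists_pow_lt_of_lt_one ha (inv_lt_one_of_one_lt₀ hτ)
  refine ⟨q ^ m, fun H hanti hq t ht => ?_⟩
  have hpow : ∀ i : ℕ, H (t / τ ^ i) ≤ (q : ℝ≥0∞) ^ i * H t := fun i => by
    induction i with
    | zero => simp
    | succ i ih =>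
      have := hq (t / τ ^ i) (by positivity)
      rw [div_div, ← pow_succ] at this
      calc _ ≤ q * ((q : ℝ≥0∞) ^ i * H t) := this.trans (by gcongr)
        _ = _ := by ring
  rw [ENNReal.coe_pow]
  refine (hanti _ _ (by positivity) ?_).trans (hpow m)
  rw [div_eq_inv_mul, ← inv_pow]
  exact mul_le_mul_of_nonneg_right hm.le ht.le

/-- Strong induction on the order: the exceptional set of the good-λ step is a level set of `M_Ā f`
together with the heavy sets of the lower commutators, all bounded by `H`. The constant is
independent of the bound `L` on `ν` and of the bound `N` on `b`, so both truncations can be removed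
afterwards. -/
lemma exists_measure_heavySet_commutator_le [CompleteSpace X] (hn : 1 ≤ n) {k : ℕ} {A B : ℝ≥0 → ℝ≥0}
    (hB : IsYoung B)
    (hAB : ∀ t : ℝ≥0, 1 ≤ t → youngInv (complYoung A) t * youngInv (toGauge B) t *
        ENNReal.ofReal (Real.log t ^ k) ≤ t) {K : Rn n → X} (hK : IsSingularIntegralKernel K)
    (hKB : HormanderDagger (toGauge B) 0 K) (hKA : HormanderDagger (toGauge A) k K)
    {p : ℝ} (hp : 1 < p) {Cp : ℝ≥0} (hT : StrongType K p Cp) {ρ q : ℝ≥0} {τ : ℝ} (hτ : 1 < τ)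
    (hρq : ρ * q < 1) (hρτ : ρ * τ ^ p < 1) (j : ℕ) : j ≤ k → ∀ s : ℝ≥0, 0 < s → ∃ C : ℝ≥0,
      ∀ ν : Measure (Rn n), SmallSubsets ν ρ → ∀ L : ℝ≥0, (∀ E, ν E ≤ L * volume E) →
      ∀ b : Rn n → ℝ, UnitOscillation b → ∀ N : ℝ, (∀ y, ‖b y‖ ≤ N) →
      ∀ f : Rn n → ℝ, IsBoundedCompact f → ∀ F : ℕ → Rn n → X,
      (∀ j ≤ k, ∀ᵐ x, IsCommutatorValue K b j f x (F j x)) →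
      ∀ H : ℝ → ℝ≥0∞, (∀ t t', 0 < t → t ≤ t' → H t' ≤ H t) →
      (∀ t, 0 < t → H (t / τ) ≤ q * H t) →
      (∀ t, 0 < t → ν {x | ENNReal.ofReal t < youngMaximal (complYoung A) f x} ≤ H t) →
      ∀ t, 0 < t → ν (heavySet {x | t < ‖F j x‖} s) ≤ C * H t := by
  induction j using Nat.strong_induction_on with
  | _ j ih =>
  intro hjk s hs
  set s₀ : ℝ≥0 := min s (1 / 2)
  have hs₀ : 0 < s₀ := lt_min hs (by norm_num)
  set s' : ℝ≥0 := s₀ / (2 * 2 ^ n)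
  have hs' : 0 < s' := by positivity
  obtain ⟨κ₀, s'', hs'', hosc⟩ := exists_oscillation_le hn hB hAB hK hKB hKA hs'
  choose! C hC using fun (i : ℕ) (hi : i < j) => ih i hi (hi.le.trans hjk) s'' hs''
  -- Chosen so that `1 + 2 κ = τ`; then `γ` makes the oscillation bound at level `μ = γ t'` at most
  -- `κ t'`.
  set κ : ℝ := (τ - 1) / 2
  have hκ : 0 < κ := by simp only [κ]; linarith
  set γ : ℝ := κ / (κ₀ + 1)
  have hγ : 0 < γ := by positivity
  obtain ⟨D₁, hD₁⟩ := exists_le_mul_of_dilation (q := q) hτ hγ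
  obtain ⟨D₂, hD₂⟩ := exists_le_mul_of_dilation (q := q) hτ (half_pos hγ)
  set E : ℝ≥0 := q * (D₂ + (∑ i ∈ Finset.range j, C i) * D₁)
  refine ⟨E * (1 - ρ * q)⁻¹, ?_⟩
  intro ν hν L hL b hb N hN f hf F hF H hanti hq hM t ht
  have hFp := hT.memLp_commutator hb.1.aestronglyMeasurable hN hf (hF j hjk)
  have hvolle := fun t ht => volume_lt_norm_le (by linarith) hFp (t := t) ht
  have hvol : ∀ t, 0 < t → volume {x | t < ‖F j x‖} ≠ ∞ := fun t ht =>
    ((hvolle t ht).trans_lt (ENNReal.mul_lt_top (ENNReal.rpow_lt_top_of_nonneg (by linarith)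
      (by simpa using ht)) (ENNReal.rpow_lt_top_of_nonneg (by linarith) hFp.2.ne))).ne
  refine (measure_mono (heavySet_antitone _ (ENNReal.coe_le_coe.2 (min_le_left s (1 / 2))))).trans ?_
  have key := le_mul_of_good_lambda (u := fun t => ν (heavySet {x | t < ‖F j x‖} s₀)) (H := H)
    (ρ := ρ) (q := q) (C := E) hτ.le hq ?_ ?_ ht
  · refine key.trans (le_of_eq ?_)
    rw [ENNReal.coe_mul E, ENNReal.coe_inv (tsub_pos_of_lt hρq).ne', ENNReal.coe_sub,
      ENNReal.coe_mul ρ, ENNReal.coe_one]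
  · intro t ht
    set t' := t / τ
    have ht' : 0 < t' := by positivity
    have hs'2 : 2 * (2 ^ n * s') = s₀ := by simp only [s']; field_simp
    have hsum : s₀ + s' < 1 := by
      have h1 : s₀ ≤ 1 / 2 := min_le_right _ _
      have h2 : s' ≤ s₀ / 2 := by
        rw [← hs'2, mul_div_cancel_left₀ _ two_ne_zero]
        exact le_mul_of_one_le_left zero_le (one_le_pow₀ one_le_two)
      calc s₀ + s' ≤ 1 / 2 + 1 / 2 / 2 := add_le_add h1 (h2.trans (by gcongr))
        _ < 1 := by rw [← NNReal.coe_lt_coe]; push_cast; norm_num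
    -- Half of `γ` in the first set, because off it the maximal function must be strictly below `γ
    -- t'`.
    set S : Set (Rn n) := {x | ENNReal.ofReal (γ / 2 * t') < youngMaximal (complYoung A) f x} ∪
      ⋃ i ∈ Finset.range j, heavySet {x | γ * t' < ‖F i x‖} s''
    have hgood := measure_heavySet_le_of_oscillation hn hν (F := F j) (s := s₀) (s' := s')
      (by simpa using hs₀.ne') (by exact_mod_cast hsum) (by exact_mod_cast hs'2.le) (κ := κ) (t := t')
      hκ.le ht'.le (hvol t' ht') (S := S) fun P hP => by
        obtain ⟨x₀, hx₀, hxS⟩ := Set.not_subset.1 hP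
        simp only [S, Set.mem_union, Set.mem_iUnion, not_or, not_exists] at hxS
        obtain ⟨hM₀, hlow⟩ := hxS
        have hμ : ((γ * t').toNNReal : ℝ) = γ * t' := Real.coe_toNNReal _ (by positivity)
        obtain ⟨c, hc⟩ := hosc b hb N hN f hf F hF (γ * t').toNNReal
          (Real.toNNReal_pos.2 (by positivity)) j hjk P x₀ hx₀
          (lt_of_le_of_lt (not_lt.1 hM₀) (by
            refine (ENNReal.ofReal_lt_ofReal_iff (by positivity)).2 ?_
            nlinarith [mul_pos hγ ht'])) (fun i hi => by
            rw [hμ]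
            exact measure_inter_le_of_notMem_heavySet hx₀ (hlow i (Finset.mem_range.2 hi)))
        refine ⟨c, (measure_mono (Set.inter_subset_inter_right _ fun x hx => ?_)).trans hc⟩
        rw [Set.mem_ofPred_eq] at hx ⊢
        refine lt_of_le_of_lt ?_ hx
        rw [hμ, ← mul_assoc]
        refine mul_le_mul_of_nonneg_right ?_ ht'.le
        simp only [γ]
        rw [mul_div_assoc', div_le_iff₀ (by positivity)]
        nlinarith
    have hτt : (1 + 2 * κ) * t' = t := by simp only [κ, t']; field_simp; ring
    have hνS : ν S ≤ E * H t := by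
      calc ν S ≤ H (γ / 2 * t') + ∑ i ∈ Finset.range j, C i * H (γ * t') := by
            refine (measure_union_le _ _).trans (add_le_add (hM _ (by positivity))
              ((measure_biUnion_finset_le _ _).trans (Finset.sum_le_sum fun i hi => ?_)))
            exact hC i (Finset.mem_range.1 hi) ν hν L hL b hb N hN f hf F hF H hanti hq hM _
              (by positivity)
        _ ≤ D₂ * H t' + ∑ i ∈ Finset.range j, C i * (D₁ * H t') := by
            gcongr
            · exact hD₂ H hanti hq t' ht'
            · exact hD₁ H hanti hq t' ht'
        _ = (D₂ + (∑ i ∈ Finset.range j, (C i : ℝ≥0∞)) * D₁) * H t' := by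
            rw [add_mul, mul_assoc, Finset.sum_mul]
        _ ≤ (D₂ + (∑ i ∈ Finset.range j, (C i : ℝ≥0∞)) * D₁) * (q * H t) := by
            gcongr; exact hq t ht
        _ = _ := by simp only [E]; push_cast; ring
    rw [hτt] at hgood
    exact hgood.trans (add_le_add le_rfl hνS)
  -- The remainder: `ν` is at most `L` times Lebesgue measure, and Chebyshev in `L^p` costs
  -- `τ^{mp}`, which is beaten by `ρ^m`.
  · intro t ht
    set V := (ENNReal.ofReal t)⁻¹ ^ p * eLpNorm (F j) (ENNReal.ofReal p) volume ^ p
    have hV : V ≠ ∞ := (ENNReal.mul_lt_top (ENNReal.rpow_lt_top_of_nonneg (by linarith)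
      (by simpa using ht)) (ENNReal.rpow_lt_top_of_nonneg (by linarith) hFp.2.ne)).ne
    have hs₀' : (s₀ : ℝ≥0∞) ≠ 0 := by simpa using hs₀.ne'
    have hlt : ρ * ENNReal.ofReal τ ^ p < 1 := by
      rw [ENNReal.ofReal_rpow_of_pos (by linarith), ← ENNReal.ofReal_coe_nnreal,
        ← ENNReal.ofReal_mul (by positivity), ENNReal.ofReal_lt_one]
      exact hρτ
    have hlim := ENNReal.Tendsto.const_mul (ENNReal.tendsto_pow_atTop_nhds_zero_of_lt_one hlt)
      (a := L * ((s₀ : ℝ≥0∞)⁻¹ * V)) (.inr (by finiteness))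
    rw [mul_zero] at hlim
    refine tendsto_of_tendsto_of_tendsto_of_le_of_le tendsto_const_nhds hlim (fun _ => zero_le)
      fun m => ?_
    have htm : 0 < t / τ ^ m := by positivity
    have h1 : volume (heavySet {x | t / τ ^ m < ‖F j x‖} s₀) ≤ (s₀ : ℝ≥0∞)⁻¹ *
        volume {x | t / τ ^ m < ‖F j x‖} := by
      rw [← ENNReal.mul_le_iff_le_inv hs₀' ENNReal.coe_ne_top]
      exact mul_volume_heavySet_le hn hs₀' (hvol _ htm)
    have h2 : (ENNReal.ofReal (t / τ ^ m))⁻¹ ^ p = (ENNReal.ofReal t)⁻¹ ^ p *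
        (ENNReal.ofReal τ ^ p) ^ m := by
      rw [ENNReal.ofReal_div_of_pos (by positivity), ENNReal.inv_div (.inl (by finiteness))
        (.inl (by simpa using pow_pos (by linarith : 0 < τ) m)), div_eq_mul_inv,
        ENNReal.mul_rpow_of_nonneg _ _ (by linarith), mul_comm, ENNReal.ofReal_pow (by linarith),
        ← ENNReal.rpow_natCast, ← ENNReal.rpow_natCast, ← ENNReal.rpow_mul, ← ENNReal.rpow_mul,
        mul_comm p]
    calc _ ≤ (ρ : ℝ≥0∞) ^ m * (L * ((s₀ : ℝ≥0∞)⁻¹ * ((ENNReal.ofReal (t / τ ^ m))⁻¹ ^ p *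
          eLpNorm (F j) (ENNReal.ofReal p) volume ^ p))) :=
          mul_le_mul_right ((hL _).trans (mul_le_mul_right (h1.trans (mul_le_mul_right
            (hvolle _ htm) _)) _)) _
      _ = _ := by rw [h2, mul_pow]; simp only [V]; ring

end GoodLambda

/-! ### Truncation of the symbol -/

section Truncation

variable {n : ℕ}

/-- The truncation of a real number at height `N`. -/
def truncate (N : ℕ) (x : ℝ) : ℝ := max (-N) (min x N)

lemma abs_truncate_le (N : ℕ) (x : ℝ) : |truncate N x| ≤ N := by
  have h : (0 : ℝ) ≤ N := N.cast_nonneg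
  exact abs_le.2 ⟨le_max_left _ _, max_le (by linarith) (min_le_right _ _)⟩

lemma truncate_eq_self {N : ℕ} {x : ℝ} (h : |x| ≤ N) : truncate N x = x := by
  rw [truncate, min_eq_left (abs_le.1 h).2, max_eq_right (abs_le.1 h).1]

lemma abs_truncate_sub_le (N : ℕ) (x y : ℝ) : |truncate N x - truncate N y| ≤ |x - y| :=
  (abs_max_sub_max_le_max _ _ _ _).trans (max_le (by simp) ((abs_min_sub_min_le_max _ _ _ _).trans
    (max_le le_rfl (by simp))))

lemma abs_truncate_le_abs (N : ℕ) (x : ℝ) : |truncate N x| ≤ |x| := by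
  have h : truncate N 0 = 0 := truncate_eq_self (by simp)
  simpa [h] using abs_truncate_sub_le N x 0

lemma continuous_truncate (N : ℕ) : Continuous (truncate N) :=
  continuous_const.max (continuous_id.min continuous_const)

lemma tendsto_truncate (x : ℝ) : Tendsto (fun N : ℕ => truncate N x) atTop (𝓝 x) := by
  refine tendsto_const_nhds.congr' ?_
  filter_upwards [eventually_ge_atTop ⌈|x|⌉₊] with N hN
  exact (truncate_eq_self ((Nat.le_ceil _).trans (by exact_mod_cast hN))).symm

/-- Only `|x| > N` matters, and there a factor `|x| / N > 1` can be inserted: one more power of `x`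
buys the decay `1 / N`. -/
lemma abs_truncate_pow_sub_le {N : ℕ} (hN : 0 < N) (i : ℕ) (x : ℝ) :
    |truncate N x ^ i - x ^ i| ≤ 2 / N * |x ^ (i + 1)| := by
  have hN' : (0 : ℝ) < N := by exact_mod_cast hN
  rcases le_or_gt |x| N with h | h
  · rw [truncate_eq_self h, sub_self, abs_zero]; positivity
  · calc |truncate N x ^ i - x ^ i| ≤ |truncate N x ^ i| + |x ^ i| := abs_sub _ _
      _ ≤ |x| ^ i + |x| ^ i := by
          rw [abs_pow, abs_pow]
          exact add_le_add (pow_le_pow_left₀ (abs_nonneg _) (abs_truncate_le_abs N x) i) le_rfl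
      _ = 2 * |x| ^ i * 1 := by ring
      _ ≤ 2 * |x| ^ i * (|x| / N) := by gcongr; exact (one_le_div hN').2 h.le
      _ = _ := by rw [abs_pow, pow_succ]; ring

/-- Truncation is 1-Lipschitz, so it does not increase oscillation about the truncated constant. -/
lemma UnitOscillation.truncate {b : Rn n → ℝ} (hb : UnitOscillation b) (N : ℕ) :
    UnitOscillation fun y => truncate N (b y) := by
  refine ⟨hb.1.mono ((continuous_truncate N).comp_aestronglyMeasurable hb.1.aestronglyMeasurable)
    (.of_forall fun y => abs_truncate_le_abs N (b y)), fun x r hr => ?_⟩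
  obtain ⟨c, hc⟩ := hb.2 x r hr
  refine ⟨_root_.truncate N c, (lintegral_mono fun y => ?_).trans hc⟩
  rw [Real.enorm_eq_ofReal_abs, Real.enorm_eq_ofReal_abs]
  exact ENNReal.ofReal_le_ofReal (abs_truncate_sub_le N _ _)

/-- Powers of a function with bounded mean oscillation are locally in `L^p`. -/
lemma UnitOscillation.memLp_pow_mul {b : Rn n → ℝ} (hb : UnitOscillation b) {f : Rn n → ℝ}
    (hf : IsBoundedCompact f) {p : ℝ} (hp : 0 < p) (i : ℕ) :
    MemLp (fun y => b y ^ i * f y) (ENNReal.ofReal p) volume := by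
  obtain ⟨a, ha, C, hJN⟩ := exists_lintegral_ball_exp_le n
  obtain ⟨r, hr⟩ := hf.2.isCompact.isBounded.subset_ball_lt 0 (0 : Rn n)
  obtain ⟨c, hc⟩ := hb.2 0 r hr.1
  set S := Metric.ball (0 : Rn n) r
  have hint := hJN b hb 0 r hr.1 c hc
  have hbm := hb.1.aestronglyMeasurable
  set M := ⌈p⌉₊
  -- From `y^m / m! ≤ e^y` with `m = i M` and `M ≥ p`: powers of `b` are absorbed by the exponential
  -- integrability.
  set D : ℝ := a⁻¹ ^ (i * M) * (i * M).factorial * Real.exp (a * |c|)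
  have hpt : ∀ y, ‖b y ^ i‖ₑ ^ p ≤ 1 + ENNReal.ofReal D * ENNReal.ofReal (Real.exp (a * |b y - c|)) := by
    intro y
    have h1 : (|b y| ^ i) ^ p ≤ 1 + |b y| ^ (i * M) := by
      have h0 : 0 ≤ |b y| ^ i := by positivity
      rw [pow_mul]
      rcases le_total (|b y| ^ i) 1 with h | h
      · exact (Real.rpow_le_one h0 h hp.le).trans (le_add_of_nonneg_right (by positivity))
      · refine le_trans ?_ (le_add_of_nonneg_left zero_le_one)
        rw [← Real.rpow_natCast (|b y| ^ i) M]
        exact Real.rpow_le_rpow_of_exponent_le h (Nat.le_ceil p)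
    have h2 : |b y| ^ (i * M) ≤ D * Real.exp (a * |b y - c|) := by
      have h3 := Real.pow_div_factorial_le_exp (a * |b y|) (by positivity) (i * M)
      rw [div_le_iff₀ (by positivity), mul_pow] at h3
      have h4 : Real.exp (a * |b y|) ≤ Real.exp (a * |c|) * Real.exp (a * |b y - c|) := by
        rw [← Real.exp_add, Real.exp_le_exp, ← mul_add]
        gcongr
        have := abs_add_le c (b y - c)
        simpa using this
      calc |b y| ^ (i * M) = a⁻¹ ^ (i * M) * (a ^ (i * M) * |b y| ^ (i * M)) := by
            rw [← mul_assoc, ← mul_pow, inv_mul_cancel₀ ha.ne', one_pow, one_mul]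
        _ ≤ a⁻¹ ^ (i * M) * ((Real.exp (a * |c|) * Real.exp (a * |b y - c|)) *
            (i * M).factorial) := by
            exact mul_le_mul_of_nonneg_left (h3.trans (mul_le_mul_of_nonneg_right h4
              (by positivity))) (by positivity)
        _ = _ := by simp only [D]; ring
    rw [← ofReal_norm, norm_pow, Real.norm_eq_abs, ENNReal.ofReal_rpow_of_nonneg (by positivity) hp.le,
      ← ENNReal.ofReal_mul (by positivity), ← ENNReal.ofReal_one,
      ← ENNReal.ofReal_add zero_le_one (by positivity)]
    exact ENNReal.ofReal_le_ofReal (h1.trans (by gcongr))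
  have hS : MemLp (S.indicator fun y => b y ^ i) (ENNReal.ofReal p) volume := by
    rw [memLp_indicator_iff_restrict measurableSet_ball]
    refine ⟨(hbm.pow i).restrict, ?_⟩
    rw [eLpNorm_lt_top_iff_lintegral_rpow_enorm_lt_top (by simpa using hp) ENNReal.ofReal_ne_top,
      ENNReal.toReal_ofReal hp.le]
    calc _ ≤ _ := lintegral_mono hpt
      _ = volume S + ENNReal.ofReal D * ∫⁻ y in S, ENNReal.ofReal (Real.exp (a * |b y - c|)) := by
          rw [lintegral_add_left measurable_const, lintegral_const_mul' _ _ ENNReal.ofReal_ne_top,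
            setLIntegral_one]
      _ ≤ volume S + ENNReal.ofReal D * (C * volume S) := by gcongr
      _ < ∞ := by
          have : volume S ≠ ∞ := measure_ball_lt_top.ne
          finiteness
  have := hf.1.mul hS (r := ENNReal.ofReal p)
  refine this.ae_eq (.of_forall fun y => ?_)
  by_cases hy : y ∈ S
  · simp [Set.indicator_of_mem hy, mul_comm]
  · have : f y = 0 := image_eq_zero_of_notMem_tsupport fun h => hy (hr.2 h)
    simp [this]

end Truncation

/-! ### Approximation of commutators by commutators with bounded symbols -/

section Approximation

variable {n : ℕ} {X : Type*} [NormedAddCommGroup X] [NormedSpace ℝ X] [MonotoneSequenceSpace X]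

lemma StrongType.exists_powers {K : Rn n → X} {p : ℝ} (hp : 1 < p) {C : ℝ≥0}
    (hT : StrongType K p C) {b : Rn n → ℝ} (hb : UnitOscillation b) {f : Rn n → ℝ}
    (hf : IsBoundedCompact f) (i : ℕ) :
    ∃ V : Rn n → X, MemLp V (ENNReal.ofReal p) volume ∧
      ∀ᵐ x, IsSingularIntegralValue K (fun y => b y ^ i * f y) x (V x) := by
  obtain ⟨⟨V, hV⟩, h⟩ := hT _ (hb.memLp_pow_mul hf (by linarith) i) hf.2.mul_left
  exact ⟨V, (h V hV).1, hV⟩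

lemma StrongType.exists_commutator {K : Rn n → X} {p : ℝ} (hp : 1 < p) {C : ℝ≥0}
    (hT : StrongType K p C) {b : Rn n → ℝ} (hb : UnitOscillation b) {f : Rn n → ℝ}
    (hf : IsBoundedCompact f) (j : ℕ) :
    ∃ F : Rn n → X, AEStronglyMeasurable F volume ∧ ∀ᵐ x, IsCommutatorValue K b j f x (F x) := by
  choose V hVp hV using hT.exists_powers hp hb hf
  have hbm := hb.1.aestronglyMeasurable
  refine ⟨fun x => ∑ i ∈ Finset.range (j + 1),
    ((-1) ^ i * b x ^ (j - i) * (j.choose i : ℝ)) • V i x, ?_, ?_⟩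
  · exact Finset.aestronglyMeasurable_fun_sum _ fun i _ =>
      AEStronglyMeasurable.smul (by fun_prop) (hVp i).1
  · filter_upwards [ae_all_iff.2 hV] with x hx
    exact isCommutatorValue_of_powers fun i _ => hx i

/-- Commutators with truncated symbols converge almost everywhere along a subsequence. -/
lemma StrongType.exists_tendsto_commutator {K : Rn n → X} {p : ℝ} (hp : 1 < p) {C : ℝ≥0}
    (hT : StrongType K p C) {b : Rn n → ℝ} (hb : UnitOscillation b) {f : Rn n → ℝ}
    (hf : IsBoundedCompact f) (k : ℕ) {F : Rn n → X} (hF : ∀ᵐ x, IsCommutatorValue K b k f x (F x))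
    {G : ℕ → Rn n → X} (hG : ∀ N, ∀ᵐ x, IsCommutatorValue K (fun y => truncate N (b y)) k f x (G N x)) :
    ∃ ns : ℕ → ℕ, StrictMono ns ∧ ∀ᵐ x, Tendsto (fun m => G (ns m) x) atTop (𝓝 (F x)) := by
  choose V hVp hV using hT.exists_powers hp hb hf
  choose U hUp hU using fun N => hT.exists_powers hp (hb.truncate N) hf
  have hp' : ENNReal.ofReal p ≠ 0 := by simpa using by linarith
  have hp1 : 1 ≤ ENNReal.ofReal p := by simpa using hp.le
  -- `T` is bounded on `L^p`, and truncating the `i`-th power costs `2/N` times the next power,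
  -- which is still in `L^p` against `f`.
  have hle : ∀ i N, 0 < N → eLpNorm (U N i - V i) (ENNReal.ofReal p) volume ≤
      C * (ENNReal.ofReal (2 / N) *
        eLpNorm (fun y => b y ^ (i + 1) * f y) (ENNReal.ofReal p) volume) := fun i N hN => by
    have h1 : MemLp ((fun y => truncate N (b y) ^ i * f y) - fun y => b y ^ i * f y)
        (ENNReal.ofReal p) volume :=
      ((hb.truncate N).memLp_pow_mul hf (by linarith) i).sub (hb.memLp_pow_mul hf (by linarith) i)
    have h2 : HasCompactSupport ((fun y => truncate N (b y) ^ i * f y) - fun y => b y ^ i * f y) :=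
      hf.2.mul_left.sub hf.2.mul_left
    refine ((hT _ h1 h2).2 (U N i - V i) ?_).2.trans (mul_le_mul_right ?_ _)
    · filter_upwards [hU N i, hV i] with x h3 h4 using h3.sub h4
    · refine eLpNorm_le_mul_eLpNorm_of_ae_le_mul (.of_forall fun y => ?_) _
      rw [Pi.sub_apply, ← sub_mul, norm_mul, norm_mul, ← mul_assoc]
      exact mul_le_mul_of_nonneg_right (abs_truncate_pow_sub_le hN i (b y)) (norm_nonneg _)
  have hlim : ∀ i, Tendsto (fun N => eLpNorm (U N i - V i) (ENNReal.ofReal p) volume) atTop (𝓝 0) := by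
    intro i
    have h2N : Tendsto (fun N : ℕ => ENNReal.ofReal (2 / N)) atTop (𝓝 0) := by
      rw [← ENNReal.ofReal_zero]
      exact ENNReal.tendsto_ofReal (tendsto_const_div_atTop_nhds_zero_nat 2)
    have h3 := ENNReal.Tendsto.const_mul (a := C) (ENNReal.Tendsto.mul_const h2N
      (b := eLpNorm (fun y => b y ^ (i + 1) * f y) (ENNReal.ofReal p) volume)
      (.inr (hb.memLp_pow_mul hf (by linarith) (i + 1)).2.ne)) (.inr ENNReal.coe_ne_top)
    rw [zero_mul, mul_zero] at h3
    refine tendsto_of_tendsto_of_tendsto_of_le_of_le' tendsto_const_nhds h3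
      (.of_forall fun _ => zero_le) ?_
    filter_upwards [eventually_gt_atTop 0] with N hN using hle i N hN
  -- Summing over `i` yields a single subsequence good for all powers at once.
  set D : ℕ → Rn n → ℝ := fun N x => ∑ i ∈ Finset.range (k + 1), ‖U N i x - V i x‖
  have hDm : ∀ N, AEStronglyMeasurable (D N) volume := fun N =>
    Finset.aestronglyMeasurable_fun_sum _ fun i _ => ((hUp N i).1.sub (hVp i).1).norm
  have hD : Tendsto (fun N => eLpNorm (D N - 0) (ENNReal.ofReal p) volume) atTop (𝓝 0) := by
    have h := tendsto_finsetSum (Finset.range (k + 1)) fun i _ => hlim i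
    rw [Finset.sum_const_zero] at h
    refine tendsto_of_tendsto_of_tendsto_of_le_of_le tendsto_const_nhds h (fun _ => zero_le) fun N => ?_
    rw [sub_zero]
    have : D N = ∑ i ∈ Finset.range (k + 1), fun x => ‖(U N i - V i) x‖ := by
      ext x; simp [D]
    rw [this]
    refine (eLpNorm_sum_le (fun i _ => ((hUp N i).1.sub (hVp i).1).norm) hp1).trans (le_of_eq ?_)
    exact Finset.sum_congr rfl fun i _ => eLpNorm_norm _
  obtain ⟨ns, hns, hconv⟩ := (tendstoInMeasure_of_tendsto_eLpNorm hp' hDm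
    aestronglyMeasurable_zero hD).exists_seq_tendsto_ae
  refine ⟨ns, hns, ?_⟩
  filter_upwards [hconv, hF, ae_all_iff.2 hG, ae_all_iff.2 hV,
    ae_all_iff.2 fun N => ae_all_iff.2 (hU N)] with x hx hFx hGx hVx hUx
  have hGeq : ∀ N, G N x = ∑ i ∈ Finset.range (k + 1),
      ((-1) ^ i * truncate N (b x) ^ (k - i) * (k.choose i : ℝ)) • U N i x := fun N =>
    (hGx N).unique (isCommutatorValue_of_powers (b := fun y => truncate N (b y)) fun i _ => hUx N i)
  rw [hFx.unique (isCommutatorValue_of_powers fun i _ => hVx i)]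
  simp_rw [hGeq]
  refine tendsto_finsetSum _ fun i hi => Tendsto.smul ?_ ?_
  · exact ((((tendsto_truncate (b x)).comp hns.tendsto_atTop).pow _).const_mul _).mul_const _
  · rw [tendsto_iff_norm_sub_tendsto_zero]
    refine squeeze_zero (fun _ => norm_nonneg _) (fun m => ?_) hx
    exact Finset.single_le_sum (f := fun i => ‖U (ns m) i x - V i x‖) (fun _ _ => norm_nonneg _) hi

end Approximation

/-! ### The distribution function of the commutator -/

section Distribution

variable {n : ℕ} {X : Type*} [NormedAddCommGroup X] [NormedSpace ℝ X] [MonotoneSequenceSpace X]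

/-- The weighted sum `∑ q^{-i} ν {g > t τ^{-i}}`. -/
def levelSum (ν : Measure (Rn n)) (q : ℝ≥0) (τ : ℝ) (g : Rn n → ℝ≥0∞) (t : ℝ) : ℝ≥0∞ :=
  ∑' i : ℕ, (q : ℝ≥0∞)⁻¹ ^ i * ν {x | ENNReal.ofReal (t / τ ^ i) < g x}

lemma levelSum_antitone (ν : Measure (Rn n)) (q : ℝ≥0) {τ : ℝ} (hτ : 0 < τ) (g : Rn n → ℝ≥0∞)
    {t t' : ℝ} (h : t ≤ t') : levelSum ν q τ g t' ≤ levelSum ν q τ g t :=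
  ENNReal.tsum_le_tsum fun i => mul_le_mul_right (measure_mono fun _ hx =>
    lt_of_le_of_lt (ENNReal.ofReal_le_ofReal (by gcongr)) hx) _

lemma le_levelSum (ν : Measure (Rn n)) (q : ℝ≥0) (τ : ℝ) (g : Rn n → ℝ≥0∞) (t : ℝ) :
    ν {x | ENNReal.ofReal t < g x} ≤ levelSum ν q τ g t := by
  refine le_trans ?_ (ENNReal.le_tsum 0)
  simp

/-- Dividing `t` by `τ` shifts the series by one term. The geometric weights exist for this: they
embed the distribution function in one with controlled growth. -/
lemma levelSum_div_le (ν : Measure (Rn n)) {q : ℝ≥0} (hq : 0 < q) (τ : ℝ) (g : Rn n → ℝ≥0∞) (t : ℝ) :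
    levelSum ν q τ g (t / τ) ≤ q * levelSum ν q τ g t := by
  have hq0 : (q : ℝ≥0∞) ≠ 0 := by simpa using hq.ne'
  have h : levelSum ν q τ g t = ν {x | ENNReal.ofReal t < g x} +
      (q : ℝ≥0∞)⁻¹ * levelSum ν q τ g (t / τ) := by
    rw [levelSum, tsum_eq_zero_add' ENNReal.summable, levelSum, ← ENNReal.tsum_mul_left]
    congr 1
    · simp
    · refine tsum_congr fun i => ?_
      rw [pow_succ', mul_assoc, div_div, pow_succ']
  rw [h, mul_add, ← mul_assoc, ENNReal.mul_inv_cancel hq0 ENNReal.coe_ne_top, one_mul]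
  exact le_add_self

lemma withDensity_le_of_min_le {w : Rn n → ℝ≥0∞} (hw : AEMeasurable w volume) {E : Set (Rn n)}
    {T : ℝ≥0∞} (h : ∀ N : ℕ, (volume.withDensity fun x => min (w x) N) E ≤ T) :
    volume.withDensity w E ≤ T := by
  have hsup : ∀ x, w x = ⨆ N : ℕ, min (w x) N := fun x => by
    refine le_antisymm ?_ (iSup_le fun N => min_le_left _ _)
    rw [← inf_iSup_eq, ENNReal.iSup_natCast, inf_top_eq]
  rw [withDensity_apply', lintegral_congr hsup, lintegral_iSup' (fun N =>
    (hw.min aemeasurable_const).restrict) (.of_forall fun x N M hNM =>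
      min_le_min le_rfl (by exact_mod_cast hNM))]
  refine iSup_le fun N => ?_
  rw [← withDensity_apply']
  exact h N

/-- If `T_b^k f` is bounded in distribution along a sequence converging almost everywhere, then so is
the limit. -/
lemma measure_lt_norm_le_of_tendsto {Y : Type*} [NormedAddCommGroup Y]
    {ν : Measure (Rn n)} (hν : ν ≪ volume) {F : Rn n → Y}
    {G : ℕ → Rn n → Y} (h : ∀ᵐ x, Tendsto (fun m => G m x) atTop (𝓝 (F x))) {t : ℝ} {T : ℝ≥0∞}
    (hG : ∀ m, ν {x | t < ‖G m x‖} ≤ T) : ν {x | t < ‖F x‖} ≤ T := by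
  -- Where `G m x → F x` and `‖F x‖ > t`, the point eventually lies in these increasing sets, so
  -- continuity from below passes to the limit.
  set S : ℕ → Set (Rn n) := fun M => {x | ∀ m ≥ M, t < ‖G m x‖}
  have hS : Monotone S := fun M M' hM x hx m hm => hx m (hM.trans hm)
  have hsub : {x | t < ‖F x‖} ⊆ (⋃ M, S M) ∪ {x | ¬ Tendsto (fun m => G m x) atTop (𝓝 (F x))} := by
    intro x hx
    by_cases hc : Tendsto (fun m => G m x) atTop (𝓝 (F x))
    · obtain ⟨M, hM⟩ := eventually_atTop.1 (hc.norm.eventually (lt_mem_nhds hx))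
      exact .inl (Set.mem_iUnion.2 ⟨M, hM⟩)
    · exact .inr hc
  calc ν {x | t < ‖F x‖} ≤ ν (⋃ M, S M) + 0 :=
        (measure_mono hsub).trans ((measure_union_le _ _).trans
          (add_le_add le_rfl (hν (ae_iff.1 h)).le))
    _ ≤ T := by
        rw [add_zero, hS.measure_iUnion]
        exact iSup_le fun M => (measure_mono fun x (hx : x ∈ S M) => hx M le_rfl).trans (hG M)

lemma IsAInfty.aemeasurable {w : Rn n → ℝ} (hw : IsAInfty w) : AEMeasurable w volume := by
  obtain ⟨p, -, -, hloc, -⟩ := hw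
  exact hloc.aestronglyMeasurable.aemeasurable

/-- The distribution function of the commutator is controlled by that of the maximal function. -/
lemma exists_measure_commutator_le [CompleteSpace X] (hn : 1 ≤ n) {k : ℕ} {A B : ℝ≥0 → ℝ≥0}
    (hB : IsYoung B)
    (hAB : ∀ t : ℝ≥0, 1 ≤ t → youngInv (complYoung A) t * youngInv (toGauge B) t *
        ENNReal.ofReal (Real.log t ^ k) ≤ t) {K : Rn n → X} (hK : IsSingularIntegralKernel K)
    (hKB : HormanderDagger (toGauge B) 0 K) (hKA : HormanderDagger (toGauge A) k K)
    {w : Rn n → ℝ} (hw : IsAInfty w) :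
    ∃ q : ℝ≥0, 1 < q ∧ ∀ τ₀ : ℝ, 1 < τ₀ → ∃ τ : ℝ, 1 < τ ∧ τ ≤ τ₀ ∧ ∃ C : ℝ≥0,
      ∀ b : Rn n → ℝ, UnitOscillation b → ∀ f : Rn n → ℝ, IsBoundedCompact f →
      ∀ F : Rn n → X, (∀ᵐ x, IsCommutatorValue K b k f x (F x)) → ∀ t, 0 < t →
      volume.withDensity (fun x => ENNReal.ofReal (w x)) {x | t < ‖F x‖} ≤
        C * levelSum (volume.withDensity fun x => ENNReal.ofReal (w x)) q τ
          (youngMaximal (complYoung A) f) t := by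
  obtain ⟨ρ, hρ, hsmall⟩ := hw.exists_smallSubsets
  obtain ⟨p, hp, Cp, hT⟩ : ∃ p : ℝ, 1 < p ∧ ∃ C : ℝ≥0, StrongType K p C := hK.exists_eLpNorm_le
  -- `q` depends on the weight alone and is fixed before `τ`, since the applications need `τ` close
  -- to 1 in terms of `q`.
  obtain ⟨q, hq, hρq⟩ : ∃ q : ℝ≥0, 1 < q ∧ ρ * q < 1 := by
    have hc : Tendsto (fun q : ℝ≥0 => ρ * q) (𝓝[>] 1) (𝓝 (ρ * 1)) :=
      ((continuous_const.mul continuous_id).tendsto 1).mono_left nhdsWithin_le_nhds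
    rw [mul_one] at hc
    obtain ⟨q, h1, h2⟩ := ((hc.eventually (gt_mem_nhds hρ)).and self_mem_nhdsWithin).exists
    exact ⟨q, h2, h1⟩
  refine ⟨q, hq, fun τ₀ hτ₀ => ?_⟩
  obtain ⟨τ, hτ, hττ₀, hρτ⟩ : ∃ τ : ℝ, 1 < τ ∧ τ ≤ τ₀ ∧ ρ * τ ^ p < 1 := by
    have hc : Tendsto (fun τ : ℝ => ρ * τ ^ p) (𝓝[>] 1) (𝓝 (ρ * 1 ^ p)) :=
      ((continuous_const.mul (Real.continuous_rpow_const (by linarith))).tendsto 1).mono_left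
        nhdsWithin_le_nhds
    rw [Real.one_rpow, mul_one] at hc
    obtain ⟨τ, h1, h2, h3⟩ := ((hc.eventually (gt_mem_nhds (by exact_mod_cast hρ : (ρ : ℝ) < 1))).and
      (Ioc_mem_nhdsGT hτ₀)).exists
    exact ⟨τ, h2, h3, h1⟩
  obtain ⟨C, hC⟩ := exists_measure_heavySet_commutator_le hn hB hAB hK hKB hKA hp hT hτ hρq hρτ k le_rfl
    (1 / 2) (by norm_num)
  refine ⟨τ, hτ, hττ₀, C, fun b hb f hf F hF t ht => ?_⟩
  have hτ0 : 0 < τ := by linarith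
  refine withDensity_le_of_min_le hw.aemeasurable.ennreal_ofReal fun N => ?_
  set W := volume.withDensity fun x => ENNReal.ofReal (w x)
  set ν := volume.withDensity fun x => min (ENNReal.ofReal (w x)) (N : ℝ≥0∞)
  have hνvol : ν ≪ volume := withDensity_absolutelyContinuous _ _
  have hνW : ν ≤ W := withDensity_mono (.of_forall fun x => min_le_left _ _)
  have hνN : ∀ E, ν E ≤ (N : ℝ≥0) * volume E := fun E => by
    rw [withDensity_apply']
    calc _ ≤ ∫⁻ _ in E, (N : ℝ≥0∞) := lintegral_mono fun x => min_le_right _ _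
      _ = _ := by rw [setLIntegral_const]; simp
  choose G hGm hG using fun (m j : ℕ) => hT.exists_commutator hp (hb.truncate m) hf j
  obtain ⟨ns, -, hlim⟩ := hT.exists_tendsto_commutator hp hb hf k hF (G := fun m => G m k)
    fun m => hG m k
  refine measure_lt_norm_le_of_tendsto hνvol hlim fun m => ?_
  have hheavy := hC ν (hsmall N) N hνN _ (hb.truncate (ns m)) (ns m)
    (fun y => abs_truncate_le _ _) f hf (G (ns m)) (fun j _ => hG (ns m) j)
    (levelSum W q τ (youngMaximal (complYoung A) f)) (fun t t' _ h => levelSum_antitone _ _ hτ0 _ h)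
    (fun t _ => levelSum_div_le _ (by positivity) _ _ _)
    (fun t _ => (hνW _).trans (le_levelSum _ _ _ _ _)) t ht
  have hnull : NullMeasurableSet {x | t < ‖G (ns m) k x‖} volume :=
    nullMeasurableSet_lt aemeasurable_const (hGm (ns m) k).norm.aemeasurable
  have hdiff := measure_diff_heavySet hnull (s := ((1 / 2 : ℝ≥0) : ℝ≥0∞))
    (by exact_mod_cast (by norm_num : (1 / 2 : ℝ≥0) < 1))
  calc ν {x | t < ‖G (ns m) k x‖} ≤ ν (heavySet {x | t < ‖G (ns m) k x‖} (1 / 2 : ℝ≥0)) +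
        ν ({x | t < ‖G (ns m) k x‖} \ heavySet {x | t < ‖G (ns m) k x‖} (1 / 2 : ℝ≥0)) :=
        (measure_mono (by rw [Set.union_sdiff_self]; exact Set.subset_union_right)).trans
          (measure_union_le _ _)
    _ ≤ _ := by rw [hνvol hdiff, add_zero]; exact hheavy

end Distribution

/-! ### Normalization of the symbol -/

section Normalization

variable {n : ℕ} {X : Type*} [NormedAddCommGroup X] [NormedSpace ℝ X] [MonotoneSequenceSpace X]

/-- A ball has positive measure, so it contains a point where the sharp function is at most its
essential supremum; the bound thus holds for every ball. -/
lemma lintegral_ball_le_bmoNorm (b : Rn n → ℝ) (x : Rn n) {r : ℝ} (hr : 0 < r) :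
    ∫⁻ y in Metric.ball x r, ‖b y - ⨍ z in Metric.ball x r, b z‖ₑ ≤
      bmoNorm b * volume (Metric.ball x r) := by
  have h0 : volume (Metric.ball x r) ≠ 0 := (Metric.measure_ball_pos _ _ hr).ne'
  obtain ⟨z, hz, hle⟩ : ∃ z ∈ Metric.ball x r, sharpMaximal b z ≤ bmoNorm b := by
    by_contra! hcon
    exact h0 (measure_mono_null (fun z hz => not_le.2 (hcon z hz)) (ae_iff.1 ae_le_essSup))
  have h1 : avg (Metric.ball x r) (fun y => ‖b y - ⨍ z in Metric.ball x r, b z‖ₑ) ≤ bmoNorm b :=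
    by
    refine le_trans ?_ hle
    refine le_iSup_of_le x (le_iSup_of_le r ?_)
    exact le_iSup (fun _ : z ∈ Metric.ball x r => _) hz
  rw [avg, mul_comm, ← div_eq_mul_inv] at h1
  exact (ENNReal.div_le_iff h0 measure_ball_lt_top.ne).1 h1

lemma IsBMO.unitOscillation {b : Rn n → ℝ} (hb : IsBMO b) {β : ℝ≥0} (hβ : 0 < β)
    (hle : bmoNorm b ≤ β) : UnitOscillation fun y => (β : ℝ)⁻¹ * b y := by
  refine ⟨hb.1.smul (β : ℝ)⁻¹, fun x r hr => ⟨(β : ℝ)⁻¹ * ⨍ z in Metric.ball x r, b z, ?_⟩⟩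
  have hβ' : (β : ℝ≥0∞) ≠ 0 := by simpa using hβ.ne'
  have h1 : ‖(β : ℝ)⁻¹‖ₑ = (β : ℝ≥0∞)⁻¹ := by
    rw [enorm_inv (by exact_mod_cast hβ.ne'), Real.enorm_of_nonneg β.coe_nonneg,
      ENNReal.ofReal_coe_nnreal]
  simp_rw [← mul_sub, enorm_mul, h1]
  rw [lintegral_const_mul' _ _ (ENNReal.inv_ne_top.2 hβ')]
  calc _ ≤ (β : ℝ≥0∞)⁻¹ * (β * volume (Metric.ball x r)) :=
        mul_le_mul_right ((lintegral_ball_le_bmoNorm b x hr).trans (mul_le_mul_left hle _)) _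
    _ = _ := by rw [← mul_assoc, ENNReal.inv_mul_cancel hβ' ENNReal.coe_ne_top, one_mul]

lemma commutatorNorm_eq {K : Rn n → X} {b f : Rn n → ℝ} {k : ℕ} {x : Rn n} {v : X}
    (hv : IsCommutatorValue K b k f x v) : commutatorNorm K b k f x = ‖v‖ₑ :=
  le_antisymm (iInf₂_le v hv) (le_iInf₂ fun v' hv' => by rw [hv'.unique hv])

lemma commutatorNorm_eq_of_inv_mul {K : Rn n → X} {b f : Rn n → ℝ} {k : ℕ} {x : Rn n} {β : ℝ≥0}
    (hβ : 0 < β) {v : X} (hv : IsCommutatorValue K (fun y => (β : ℝ)⁻¹ * b y) k f x v) :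
    commutatorNorm K b k f x = (β : ℝ≥0∞) ^ k * ‖v‖ₑ := by
  have h : IsCommutatorValue K b k f x ((β : ℝ) ^ k • v) := fun l => by
    have := (hv l).const_mul ((β : ℝ) ^ k)
    simp only [← mul_sub, ← mul_assoc, mul_pow] at this
    have hβ' : (β : ℝ) ^ k * (β : ℝ)⁻¹ ^ k = 1 := by
      rw [← mul_pow, mul_inv_cancel₀ (by exact_mod_cast hβ.ne'), one_pow]
    simpa only [hβ', one_mul, map_smul, Pi.smul_apply, smul_eq_mul] using this
  rw [commutatorNorm_eq h, enorm_smul, enorm_pow, Real.enorm_of_nonneg β.coe_nonneg,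
    ENNReal.ofReal_coe_nnreal]

/-- A symbol of vanishing norm is constant. -/
lemma ae_ae_eq_of_bmoNorm_eq_zero {b : Rn n → ℝ} (hb : IsBMO b) (h : bmoNorm b = 0) :
    ∀ᵐ x, ∀ᵐ y, b y = b x := by
  have h1 : ∀ᵐ y, ∀ m : ℕ, y ∈ Metric.ball (0 : Rn n) (m + 1) →
      b y = ⨍ z in Metric.ball (0 : Rn n) (m + 1), b z := by
    refine ae_all_iff.2 fun m => (ae_restrict_iff' measurableSet_ball).1 ?_
    have h2 := lintegral_ball_le_bmoNorm b 0 (by positivity : (0 : ℝ) < m + 1)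
    have hm : AEMeasurable (fun y => ‖b y - ⨍ z in Metric.ball (0 : Rn n) (m + 1), b z‖ₑ) volume :=
      (hb.1.aestronglyMeasurable.sub aestronglyMeasurable_const).enorm
    rw [h, zero_mul, nonpos_iff_eq_zero, lintegral_eq_zero_iff' hm.restrict] at h2
    filter_upwards [h2] with y hy
    exact sub_eq_zero.1 (enorm_eq_zero.1 hy)
  filter_upwards [h1] with x hx
  filter_upwards [h1] with y hy
  obtain ⟨m, hm⟩ := exists_nat_gt (max ‖x‖ ‖y‖)
  rw [hx m (by simpa using ((le_max_left _ _).trans_lt hm).trans (lt_add_one _)),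
    hy m (by simpa using ((le_max_right _ _).trans_lt hm).trans (lt_add_one _))]

/-- Dividing by the norm is impossible here, but `b` is almost everywhere constant and the factor
`(b x - b y)^k` vanishes. -/
lemma commutatorNorm_ae_eq_zero {K : Rn n → X} {b f : Rn n → ℝ} {k : ℕ} (hk : k ≠ 0) (hb : IsBMO b)
    (h : bmoNorm b = 0) : ∀ᵐ x, commutatorNorm K b k f x = 0 := by
  filter_upwards [ae_ae_eq_of_bmoNorm_eq_zero hb h] with x hx
  have h0 : IsCommutatorValue K b k f x 0 := fun l => by
    have hae : (fun y => (b x - b y) ^ k * coord (K (x - y)) l * f y) =ᵐ[volume] fun _ => 0 := by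
      filter_upwards [hx] with y hy
      simp [hy, hk]
    obtain ⟨h1, h2⟩ := hasPV_zero x
    rw [map_zero]
    refine ⟨fun ε hε => (h1 ε hε).congr (ae_restrict_of_ae hae.symm), h2.congr fun ε => ?_⟩
    exact integral_congr_ae (ae_restrict_of_ae hae.symm)
  rw [commutatorNorm_eq h0, enorm_zero]

end Normalization

/-! ### From distribution functions to norms -/

section Norms

variable {n : ℕ}

/-- The layer cake formula turns the `i`-th level into the `p`-th moment of `τ^i g`, giving a
geometric series of ratio `τ^p / q`. -/
lemma lintegral_rpow_le_of_levelSum {X : Type*} [NormedAddCommGroup X] {W : Measure (Rn n)} {F : Rn n → X}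
    (hF : AEStronglyMeasurable F W) {g : Rn n → ℝ≥0∞} (hg : Measurable g) (hgt : ∀ x, g x ≠ ∞)
    {q C : ℝ≥0} {τ : ℝ} (hτ : 0 < τ) {p : ℝ} (hp : 0 < p)
    (h : ∀ t, 0 < t → W {x | t < ‖F x‖} ≤ C * levelSum W q τ g t) :
    ∫⁻ x, ‖F x‖ₑ ^ p ∂W ≤ C * (1 - (q : ℝ≥0∞)⁻¹ * ENNReal.ofReal (τ ^ p))⁻¹ * ∫⁻ x, g x ^ p ∂W := by
  have hterm : ∀ i : ℕ, ENNReal.ofReal p * ∫⁻ t in Set.Ioi (0 : ℝ),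
      W {x | ENNReal.ofReal (t / τ ^ i) < g x} * ENNReal.ofReal (t ^ (p - 1)) =
      ENNReal.ofReal (τ ^ p) ^ i * ∫⁻ x, g x ^ p ∂W := fun i => by
    have h1 := lintegral_rpow_eq_lintegral_meas_lt_mul W (f := fun x => τ ^ i * (g x).toReal)
      (.of_forall fun x => by positivity) (hg.ennreal_toReal.const_mul _).aemeasurable hp
    have hset : ∀ t ∈ Set.Ioi (0 : ℝ), {x | ENNReal.ofReal (t / τ ^ i) < g x} =
        {x | t < τ ^ i * (g x).toReal} := fun t ht => by
      ext x
      rw [Set.mem_ofPred_eq, Set.mem_ofPred_eq, ENNReal.ofReal_lt_iff_lt_toReal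
        (div_nonneg (le_of_lt ht) (by positivity)) (hgt x), div_lt_iff₀ (by positivity), mul_comm]
    rw [setLIntegral_congr_fun measurableSet_Ioi fun t ht => by rw [hset t ht], ← h1,
      ← lintegral_const_mul' _ _ (by finiteness)]
    refine lintegral_congr fun x => ?_
    rw [← ENNReal.ofReal_pow (by positivity), Real.mul_rpow (by positivity) (by positivity),
      ENNReal.ofReal_mul (by positivity), ← ENNReal.ofReal_rpow_of_nonneg ENNReal.toReal_nonneg hp.le,
      ENNReal.ofReal_toReal (hgt x), ← Real.rpow_natCast, ← Real.rpow_natCast,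
      ← Real.rpow_mul hτ.le, ← Real.rpow_mul hτ.le, mul_comm p]
  have hm : ∀ i : ℕ, Measurable fun t : ℝ => W {x | ENNReal.ofReal (t / τ ^ i) < g x} := fun i =>
    Antitone.measurable fun t t' htt' => measure_mono fun x hx =>
      lt_of_le_of_lt (ENNReal.ofReal_le_ofReal (by gcongr)) hx
  have hmp : ∀ i : ℕ, Measurable fun t : ℝ =>
      W {x | ENNReal.ofReal (t / τ ^ i) < g x} * ENNReal.ofReal (t ^ (p - 1)) := fun i =>
    (hm i).mul (measurable_id.pow_const _).ennreal_ofReal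
  calc ∫⁻ x, ‖F x‖ₑ ^ p ∂W = ∫⁻ x, ENNReal.ofReal (‖F x‖ ^ p) ∂W := by
        refine lintegral_congr fun x => ?_
        rw [← ofReal_norm, ENNReal.ofReal_rpow_of_nonneg (norm_nonneg _) hp.le]
    _ = ENNReal.ofReal p * ∫⁻ t in Set.Ioi (0 : ℝ), W {x | t < ‖F x‖} * ENNReal.ofReal (t ^ (p - 1)) :=
        lintegral_rpow_eq_lintegral_meas_lt_mul W (.of_forall fun x => norm_nonneg _)
          hF.norm.aemeasurable hp
    _ ≤ ENNReal.ofReal p * ∫⁻ t in Set.Ioi (0 : ℝ), C * ∑' i : ℕ, (q : ℝ≥0∞)⁻¹ ^ i *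
          (W {x | ENNReal.ofReal (t / τ ^ i) < g x} * ENNReal.ofReal (t ^ (p - 1))) := by
        refine mul_le_mul_right (setLIntegral_mono' measurableSet_Ioi fun t ht => ?_) _
        simp_rw [← mul_assoc]
        rw [ENNReal.tsum_mul_right, ← mul_assoc]
        exact mul_le_mul_left (h t ht) _
    _ = C * ∑' i : ℕ, (q : ℝ≥0∞)⁻¹ ^ i * (ENNReal.ofReal p * ∫⁻ t in Set.Ioi (0 : ℝ),
          W {x | ENNReal.ofReal (t / τ ^ i) < g x} * ENNReal.ofReal (t ^ (p - 1))) := by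
        rw [lintegral_const_mul' _ _ ENNReal.coe_ne_top, lintegral_tsum fun i =>
          ((hmp i).const_mul _).aemeasurable, mul_left_comm, ← ENNReal.tsum_mul_left]
        congr 1
        refine tsum_congr fun i => ?_
        rw [lintegral_const_mul _ (hmp i), mul_left_comm]
    _ = _ := by
        simp_rw [hterm, ← mul_assoc, ← mul_pow]
        rw [ENNReal.tsum_mul_right, ENNReal.tsum_geometric, mul_assoc]

end Norms

/-! ### Norm inequalities for commutators -/

section Main

variable {n : ℕ} {X : Type*} [NormedAddCommGroup X] [NormedSpace ℝ X] [MonotoneSequenceSpace X]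

lemma IsBoundedCompact.exists_nnnorm_le {f : Rn n → ℝ} (hf : IsBoundedCompact f) :
    ∃ M : ℝ≥0, 0 < M ∧ ∀ᵐ x, ‖f x‖₊ ≤ M := by
  have h : eLpNormEssSup f volume < ∞ := by simpa using hf.1.2
  refine ⟨(eLpNormEssSup f volume).toNNReal + 1, by positivity, ?_⟩
  filter_upwards [ae_le_eLpNormEssSup (f := f) (μ := volume)] with x hx
  refine le_trans ?_ (le_add_of_nonneg_right zero_le_one)
  rw [← ENNReal.coe_le_coe, ENNReal.coe_toNNReal h.ne]
  exact hx

lemma IsYoung.youngMaximal_complYoung_ne_top {A : ℝ≥0 → ℝ≥0} (hA : IsYoung A) {f : Rn n → ℝ}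
    (hf : IsBoundedCompact f) (x : Rn n) : youngMaximal (complYoung A) f x ≠ ∞ := by
  obtain ⟨ε, hε, h1⟩ := hA.exists_complYoung_le_one
  obtain ⟨M, hM, hfM⟩ := hf.exists_nnnorm_le
  exact ((youngMaximal_le (complYoung_mono A) hε h1 hM hfM x).trans_lt ENNReal.coe_lt_top).ne

lemma lintegral_complYoung_ne_top {A : ℝ≥0 → ℝ≥0} (hfin : ∀ s, complYoung A s < ∞) {f : Rn n → ℝ}
    (hf : IsBoundedCompact f) (t : ℝ≥0) : ∫⁻ x, complYoung A (‖f x‖₊ / t) ≠ ∞ := by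
  obtain ⟨M, -, hfM⟩ := hf.exists_nnnorm_le
  have hsupp : Function.support (fun x => complYoung A (‖f x‖₊ / t)) ⊆ tsupport f := fun x hx => by
    by_contra hcon
    exact hx (by simp [image_eq_zero_of_notMem_tsupport hcon, complYoung_zero])
  rw [← setLIntegral_eq_of_support_subset hsupp]
  have hvol : volume (tsupport f) ≠ ∞ := hf.2.isCompact.measure_lt_top.ne
  refine ne_top_of_le_ne_top (ENNReal.mul_ne_top (hfin (M / t)).ne hvol) ?_
  calc _ ≤ ∫⁻ _ in tsupport f, complYoung A (M / t) :=
        lintegral_mono_ae (ae_restrict_of_ae (hfM.mono fun x hx => complYoung_mono A (by gcongr)))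
    _ = _ := setLIntegral_const _ _

/-- The commutator with a symbol in BMO, in terms of that with a normalized symbol. -/
lemma IsSingularIntegralKernel.exists_normalized_commutator {K : Rn n → X}
    (hK : IsSingularIntegralKernel K) {b : Rn n → ℝ} (hb : IsBMO b) {β : ℝ≥0} (hβ : 0 < β)
    (hle : bmoNorm b ≤ β) {f : Rn n → ℝ} (hf : IsBoundedCompact f) (k : ℕ) :
    ∃ F : Rn n → X, AEStronglyMeasurable F volume ∧
      (∀ᵐ x, IsCommutatorValue K (fun y => (β : ℝ)⁻¹ * b y) k f x (F x)) ∧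
      ∀ᵐ x, commutatorNorm K b k f x = (β : ℝ≥0∞) ^ k * ‖F x‖ₑ := by
  obtain ⟨p, hp, Cp, hT⟩ : ∃ p : ℝ, 1 < p ∧ ∃ C : ℝ≥0, StrongType K p C := hK.exists_eLpNorm_le
  obtain ⟨F, hFm, hF⟩ := hT.exists_commutator hp (hb.unitOscillation hβ hle) hf k
  exact ⟨F, hFm, hF, hF.mono fun x hx => commutatorNorm_eq_of_inv_mul hβ hx⟩

variable [CompleteSpace X] {k : ℕ} {A B : ℝ≥0 → ℝ≥0} {K : Rn n → X}

/-- The parameter `τ` is taken with `τ^p < q`, so that the geometric series of the layer cake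
estimate converges. -/
lemma exists_lintegral_commutatorNorm_le (hn : 1 ≤ n) (hA : IsYoung A) (hB : IsYoung B)
    (hAB : ∀ t : ℝ≥0, 1 ≤ t → youngInv (complYoung A) t * youngInv (toGauge B) t *
        ENNReal.ofReal (Real.log t ^ k) ≤ t) (hK : IsSingularIntegralKernel K)
    (hKB : HormanderDagger (toGauge B) 0 K) (hKA : HormanderDagger (toGauge A) k K)
    {b : Rn n → ℝ} (hb : IsBMO b) {p : ℝ} (hp : 0 < p) {w : Rn n → ℝ} (hw : IsAInfty w) :
    ∃ C : ℝ≥0, ∀ f : Rn n → ℝ, IsBoundedCompact f →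
      ∫⁻ x, commutatorNorm K b k f x ^ p * ENNReal.ofReal (w x) ≤
        C * ∫⁻ x, youngMaximal (complYoung A) f x ^ p * ENNReal.ofReal (w x) := by
  obtain ⟨q, hq, hdist⟩ := exists_measure_commutator_le hn hB hAB hK hKB hKA hw
  obtain ⟨τ₀, hτ₀, hτ₀q⟩ : ∃ τ₀ : ℝ, 1 < τ₀ ∧ τ₀ ^ p < q := by
    have hc : Tendsto (fun τ : ℝ => τ ^ p) (𝓝[>] 1) (𝓝 (1 ^ p)) :=
      ((Real.continuous_rpow_const hp.le).tendsto 1).mono_left nhdsWithin_le_nhds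
    rw [Real.one_rpow] at hc
    obtain ⟨τ, h1, h2⟩ := ((hc.eventually (gt_mem_nhds (by exact_mod_cast hq : (1 : ℝ) < q))).and
      self_mem_nhdsWithin).exists
    exact ⟨τ, h2, h1⟩
  obtain ⟨τ, hτ, hττ₀, C, hC⟩ := hdist τ₀ hτ₀
  have hτ0 : 0 < τ := by linarith
  -- The constant may depend on `b`, so adding 1 avoids a separate case of vanishing norm.
  set β : ℝ≥0 := (bmoNorm b).toNNReal + 1
  have hβ : 0 < β := by positivity
  have hbβ : bmoNorm b ≤ β := by
    rw [← ENNReal.coe_toNNReal hb.2.ne]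
    exact ENNReal.coe_le_coe.2 le_self_add
  have hq0 : (q : ℝ≥0∞) ≠ 0 := by simpa using (zero_lt_one.trans hq).ne'
  have hr : (q : ℝ≥0∞)⁻¹ * ENNReal.ofReal (τ ^ p) < 1 := by
    rw [mul_comm, ← div_eq_mul_inv, ENNReal.div_lt_iff (.inl hq0) (.inl ENNReal.coe_ne_top), one_mul,
      ENNReal.ofReal_lt_coe_iff (by positivity)]
    exact (Real.rpow_le_rpow hτ0.le hττ₀ hp.le).trans_lt hτ₀q
  set D : ℝ≥0∞ := ((β : ℝ≥0∞) ^ k) ^ p * (C * (1 - (q : ℝ≥0∞)⁻¹ * ENNReal.ofReal (τ ^ p))⁻¹)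
  have hD : D ≠ ∞ := ENNReal.mul_ne_top (ENNReal.rpow_ne_top_of_nonneg hp.le (by finiteness))
    (ENNReal.mul_ne_top ENNReal.coe_ne_top (ENNReal.inv_ne_top.2 (tsub_pos_of_lt hr).ne'))
  refine ⟨D.toNNReal, fun f hf => ?_⟩
  obtain ⟨F, hFm, hF, hnorm⟩ := hK.exists_normalized_commutator hb hβ hbβ hf k
  have hwm := hw.aemeasurable.ennreal_ofReal
  set W := volume.withDensity fun x => ENNReal.ofReal (w x)
  have hmain := lintegral_rpow_le_of_levelSum (W := W)
    (hFm.mono_ac (withDensity_absolutelyContinuous _ _)) (measurable_youngMaximal (complYoung A) f)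
    (hA.youngMaximal_complYoung_ne_top hf) hτ0 hp
    (hC _ (hb.unitOscillation hβ hbβ) f hf F hF)
  have hconv : ∀ g : Rn n → ℝ≥0∞, AEMeasurable g volume →
      ∫⁻ x, g x ∂W = ∫⁻ x, g x * ENNReal.ofReal (w x) := fun g hg => by
    rw [lintegral_withDensity_eq_lintegral_mul₀ hwm hg]
    exact lintegral_congr fun x => mul_comm _ _
  rw [hconv _ (hFm.enorm.pow_const p), hconv _ ((measurable_youngMaximal _ f).pow_const p).aemeasurable]
    at hmain
  rw [ENNReal.coe_toNNReal hD]
  calc _ = ∫⁻ x, ((β : ℝ≥0∞) ^ k) ^ p * (‖F x‖ₑ ^ p * ENNReal.ofReal (w x)) := by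
        refine lintegral_congr_ae (hnorm.mono fun x hx => ?_)
        simp only
        rw [hx, ENNReal.mul_rpow_of_nonneg _ _ hp.le, mul_assoc]
    _ = ((β : ℝ≥0∞) ^ k) ^ p * ∫⁻ x, ‖F x‖ₑ ^ p * ENNReal.ofReal (w x) :=
        lintegral_const_mul' _ _ (ENNReal.rpow_ne_top_of_nonneg hp.le (by finiteness))
    _ ≤ _ := by
        simp only [D]
        rw [mul_assoc]
        exact mul_le_mul_right hmain _

/-- The weak type inequality at height `t τ^{-i}` produces `Ā(τ^i s)`, at most `q₁^i Ā(s)`, while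
the weight of that level is `q^{-i}`. With `q₁ < q` the sum converges. -/
lemma exists_withDensity_commutatorNorm_le (hn : 1 ≤ n) (hk : 1 ≤ k) (hB : IsYoung B)
    (hAB : ∀ t : ℝ≥0, 1 ≤ t → youngInv (complYoung A) t * youngInv (toGauge B) t *
        ENNReal.ofReal (Real.log t ^ k) ≤ t) (hK : IsSingularIntegralKernel K)
    (hKB : HormanderDagger (toGauge B) 0 K) (hKA : HormanderDagger (toGauge A) k K)
    (hfin : ∀ s, complYoung A s < ∞) (hsub : Submultiplicative (complYoung A))
    {w : Rn n → ℝ} (hw : IsAInfty w) :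
    ∃ c : ℝ≥0, ∀ b : Rn n → ℝ, IsBMO b → ∀ f : Rn n → ℝ, IsBoundedCompact f → ∀ r : ℝ≥0, 0 < r →
      volume.withDensity (fun x => ENNReal.ofReal (w x)) {x | (r : ℝ≥0∞) < commutatorNorm K b k f x} ≤
        c * ∫⁻ x, complYoung A ((bmoNorm b).toNNReal ^ k * ‖f x‖₊ / r) * hlMaximal w x := by
  obtain ⟨q, hq, hdist⟩ := exists_measure_commutator_le hn hB hAB hK hKB hKA hw
  obtain ⟨q₁, hq₁, hq₁q⟩ := exists_between hq
  obtain ⟨θ, hθ, hdil⟩ := hsub.exists_dilation_le hfin hq₁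
  obtain ⟨τ, hτ, hττ₀, C, hC⟩ := hdist (1 + θ) (by simpa using hθ)
  lift τ to ℝ≥0 using by linarith
  have hτ0 : 0 < τ := by have : (0 : ℝ) < τ := by linarith
                         exact_mod_cast this
  have hpow : ∀ (i : ℕ) s, complYoung A (τ ^ i * s) ≤ (q₁ : ℝ≥0∞) ^ i * complYoung A s := by
    intro i s
    induction i with
    | zero => simp
    | succ i ih =>
      rw [pow_succ', mul_assoc]
      refine (hdil τ (by exact_mod_cast hττ₀) _).trans ((mul_le_mul_right ih _).trans (le_of_eq ?_))
      ring
  have hq0 : (q : ℝ≥0∞) ≠ 0 := by simpa using (zero_lt_one.trans hq).ne'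
  have hr : (q : ℝ≥0∞)⁻¹ * q₁ < 1 := by
    rw [mul_comm, ← div_eq_mul_inv, ENNReal.div_lt_iff (.inl hq0) (.inl ENNReal.coe_ne_top), one_mul]
    exact_mod_cast hq₁q
  set D : ℝ≥0∞ := C * ((1 - (q : ℝ≥0∞)⁻¹ * q₁)⁻¹ * 5 ^ n)
  have hD : D ≠ ∞ := ENNReal.mul_ne_top ENNReal.coe_ne_top
    (ENNReal.mul_ne_top (ENNReal.inv_ne_top.2 (tsub_pos_of_lt hr).ne') (by finiteness))
  refine ⟨D.toNNReal, fun b hb f hf r hr0 => ?_⟩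
  rw [ENNReal.coe_toNNReal hD]
  set W := volume.withDensity fun x => ENNReal.ofReal (w x)
  have hW : W ≪ volume := withDensity_absolutelyContinuous _ _
  -- The constant must not depend on `b`, so the normalization uses the exact norm and norm 0 is
  -- treated apart.
  rcases eq_or_ne (bmoNorm b) 0 with h0 | h0
  · refine le_trans (le_of_eq (hW ?_)) zero_le
    have := commutatorNorm_ae_eq_zero (K := K) (f := f) (by omega : k ≠ 0) hb h0
    exact measure_mono_null (fun x hx => (lt_of_le_of_lt zero_le hx).ne') (ae_iff.1 this)
  set β := (bmoNorm b).toNNReal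
  have hβ : 0 < β := ENNReal.toNNReal_pos h0 hb.2.ne
  have hbβ : bmoNorm b ≤ β := (ENNReal.coe_toNNReal hb.2.ne).ge
  obtain ⟨F, hFm, hF, hnorm⟩ := hK.exists_normalized_commutator hb hβ hbβ hf k
  set t : ℝ≥0 := r / β ^ k
  have ht : 0 < t := by positivity
  have hset : W {x | (r : ℝ≥0∞) < commutatorNorm K b k f x} ≤ W {x | (t : ℝ) < ‖F x‖} := by
    refine measure_mono_ae ?_
    filter_upwards [hW.ae_le hnorm] with x hx hxr
    have hxr' : (r : ℝ≥0∞) < commutatorNorm K b k f x := hxr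
    rw [hx, enorm_eq_nnnorm, ← ENNReal.coe_pow, ← ENNReal.coe_mul, ENNReal.coe_lt_coe] at hxr'
    have : t < ‖F x‖₊ := by
      rw [div_lt_iff₀ (by positivity), mul_comm]; exact hxr'
    exact_mod_cast this
  have hlevel : ∀ i : ℕ, W {x | ENNReal.ofReal (t / τ ^ i) < youngMaximal (complYoung A) f x} ≤
      5 ^ n * ((q₁ : ℝ≥0∞) ^ i *
        ∫⁻ x, complYoung A (β ^ k * ‖f x‖₊ / r) * hlMaximal w x) := fun i => by
    have h1 : ENNReal.ofReal ((t : ℝ) / τ ^ i) = ((t / τ ^ i : ℝ≥0) : ℝ≥0∞) := by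
      rw [← ENNReal.ofReal_coe_nnreal]; push_cast; rfl
    rw [h1, ← lintegral_const_mul' _ _ (by finiteness)]
    refine (withDensity_youngMaximal_le hn _ w f (by positivity)
      (lintegral_complYoung_ne_top hfin hf _)).trans (mul_le_mul_right (lintegral_mono fun x => ?_) _)
    rw [← mul_assoc]
    refine mul_le_mul_left ?_ _
    have h2 : ‖f x‖₊ / (t / τ ^ i) = τ ^ i * (β ^ k * ‖f x‖₊ / r) := by
      simp only [t]; field_simp
    rw [h2]
    exact hpow i _
  calc _ ≤ _ := hset.trans (hC _ (hb.unitOscillation hβ hbβ) f hf F hF t (by exact_mod_cast ht))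
    _ ≤ C * ∑' i : ℕ, (q : ℝ≥0∞)⁻¹ ^ i * (5 ^ n * ((q₁ : ℝ≥0∞) ^ i *
        ∫⁻ x, complYoung A (β ^ k * ‖f x‖₊ / r) * hlMaximal w x)) :=
        mul_le_mul_right (ENNReal.tsum_le_tsum fun i => mul_le_mul_right (hlevel i) _) _
    _ = _ := by
        have : ∀ i : ℕ, (q : ℝ≥0∞)⁻¹ ^ i * (5 ^ n * ((q₁ : ℝ≥0∞) ^ i *
            ∫⁻ x, complYoung A (β ^ k * ‖f x‖₊ / r) * hlMaximal w x)) =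
            ((q : ℝ≥0∞)⁻¹ * q₁) ^ i * (5 ^ n *
            ∫⁻ x, complYoung A (β ^ k * ‖f x‖₊ / r) * hlMaximal w x) := fun i => by
          rw [mul_pow]; ring
        simp_rw [this]
        rw [ENNReal.tsum_mul_right, ENNReal.tsum_geometric]
        simp only [D]
        ring

end Main

end

theorem mainTheorem2 {n : ℕ} (hn : 1 ≤ n)
    {X : Type*} [NormedAddCommGroup X] [NormedSpace ℝ X] [CompleteSpace X]
    [MonotoneSequenceSpace X]
    (k : ℕ) (hk : 1 ≤ k)
    (A B : ℝ≥0 → ℝ≥0) (hA : IsYoung A) (hB : IsYoung B)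
    (hAB : ∀ t : ℝ≥0, 1 ≤ t →
      youngInv (complYoung A) t * youngInv (toGauge B) t *
        ENNReal.ofReal (Real.log t ^ k) ≤ t)
    (K : Rn n → X) (hK : IsSingularIntegralKernel K)
    (hKB : HormanderDagger (toGauge B) 0 K) (hKA : HormanderDagger (toGauge A) k K) :
    (∀ b : Rn n → ℝ, IsBMO b → ∀ p : ℝ, 0 < p → ∀ w : Rn n → ℝ, IsAInfty w →
      ∃ C : ℝ≥0, ∀ f : Rn n → ℝ, IsBoundedCompact f →
        ∫⁻ x, commutatorNorm K b k f x ^ p * ENNReal.ofReal (w x) < ∞ →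
        ∫⁻ x, commutatorNorm K b k f x ^ p * ENNReal.ofReal (w x) ≤
          C * ∫⁻ x, youngMaximal (complYoung A) f x ^ p * ENNReal.ofReal (w x)) ∧
    ((∀ s, complYoung A s < ∞) → Submultiplicative (complYoung A) →
      ∀ w : Rn n → ℝ, IsAInfty w →
      ∃ c : ℝ≥0, ∀ b : Rn n → ℝ, IsBMO b → ∀ f : Rn n → ℝ, IsBoundedCompact f →
        ∀ r : ℝ≥0, 0 < r →
          volume.withDensity (fun x => ENNReal.ofReal (w x))
              {x | (r : ℝ≥0∞) < commutatorNorm K b k f x} ≤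
            c * ∫⁻ x, complYoung A ((bmoNorm b).toNNReal ^ k * ‖f x‖₊ / r) * hlMaximal w x) := by
  exact ⟨fun b hb p hp w hw =>
      (exists_lintegral_commutatorNorm_le hn hA hB hAB hK hKB hKA hb hp hw).imp
        fun _ hC f hf _ => hC f hf,
    fun hfin hsub w hw =>
      exists_withDensity_commutatorNorm_le hn hk hB hAB hK hKB hKA hfin hsub hw⟩
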